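/- **Conventions.** A *computable metric space* is a complete metric space $(X,d)$ with a dense sequence $(s_i)_{i\in\mathbb N}$ of *ideal points* such that the reals $d(s_i,s_j)$ are computable uniformly in $(i,j)$. A *name* of $x\in X$ is a sequence of indices $(k_n)_n$ with $d(s_{k_n},s_{k_{n+1}})<2^{-n}$ for all $n$ and $s_{k_n}\to x$; a function $f:D\subseteq X\to Y$ between such spaces is *computable* if a recursive operator on $\mathbb N^{\mathbb N}$ sends every name of every $x\in D$ to a name of $f(x)$. An open set is *r.e.* if it is the union of a recursively enumerable family of balls $B(s_i,q)$ with $q\in\mathbb Q_{>0}$, and a *$\Pi^0_2$-set* is an intersection $\bigcap_n U_n$ of uniformly r.e. open sets. A Borel probability measure $\mu$ on $X$ is *computable* if it has a recursive name in the space of Borel probability measures with the Prokhorov metric, the ideal points being the measures supported on finitely many $s_i$ with rational weights; $(X,\mu)$ is then a *computable probability space*. The Cantor space $2^\omega$ carries the metric $2^{-\min\{n:\omega_n\ne\omega'_n\}}$ and the ideal points $w000\ldots$ A *$\mu$-randomness test* is a function $t:X\to[0,+\infty]$ with $\int t\,d\mu\le 1$ that is lower semicomputable from $\mu$ (some recursive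 operator sends each name of $\mu$ to an enumeration, possibly empty, of functions of the form $q\,1_{B(s_i,r)}$, $q,r\in\mathbb Q_{>0}$, with supremum $t$). A point $x$ is *$\mu$-random* if $t(x)<+\infty$ for every $\mu$-randomness test $t$. A *binary representation* of $(X,\mu)$ consists of a computable probability measure $\mu_\delta$ on $2^\omega$ and a surjective computable function $\delta:D_\delta\to X$, where $D_\delta\subseteq 2^\omega$ is a $\Pi^0_2$-set with $\mu_\delta(D_\delta)=1$ and $\mu(A)=\mu_\delta(\delta^{-1}(A))$ for all Borel $A\subseteq X$, together with a dense $\Pi^0_2$-set $D\subseteq X$ with $\mu(D)=1$ such that every $x\in D$ has exactly one *expansion* (element of $\delta^{-1}(x)$) and $\delta^{-1}:D\to 2^\omega$ is computable. Let $H$ be prefix Kolmogorov complexity: $H(w)$ is the length of a shortest $p$ with $U(p)=w$, where $U$ is a universal (additively optimal) partial recursive function on binary words with prefix-free domain. For $x\in D$ with expansion $\omega$ put $H_n(x)=H(\omega_0\ldots\omega_{n-1})$ and $\Gamma_n(x)=\delta([\omega_0\ldots\omega_{n-1}])=\{\delta(\omega'):\omega'\in D_\delta,\ \omega'_i=\omega_i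 \text{ for all } i<n\}$. **Statement.** Let $\delta$ be a binary representation, with set $D$ as above, of a computable probability space $(X,\mu)$ (not necessarily compact), and let $U$ be any universal prefix machine. Then a point $x\in X$ is $\mu$-random if and only if $x\in D$ and there is a real constant $c$ such that, for all $n\in\mathbb N$, $$H_n(x)\ \ge\ -\log_2 \mu(\Gamma_n(x)) - c ,$$ where $-\log_2 0=+\infty$. -/

import Mathlib

open MeasureTheory Filter Topology
open scoped ENNReal

noncomputable section

/-! ### Recursive functions and representations -/

/-- The word `σ₀ … σ_{n-1}`. -/
def initialWord {α : Type*} (σ : ℕ → α) (n : ℕ) : List α := (List.range n).map σ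

/-- A function on Baire space is recursive on `A` if on `A` it is the limit of a recursive
function on finite words that is monotone for the prefix order. -/
def RecursiveOn (F : (ℕ → ℕ) → (ℕ → ℕ)) (A : Set (ℕ → ℕ)) : Prop :=
  ∃ Φ : List ℕ → List ℕ, Computable Φ ∧ (∀ u v, u <+: v → Φ u <+: Φ v) ∧
    ∀ σ ∈ A, (∀ m, ∃ n, Φ (initialWord σ m) = initialWord (F σ) n) ∧
      ∀ n, ∃ m, initialWord (F σ) n <+: Φ (initialWord σ m)

/-- A partial map from Baire space to `X`, given by its graph: `ρ σ x` means that `σ` is in the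
domain and is sent to `x`. It represents the elements of its range. -/
abbrev NameRelation (X : Type*) := (ℕ → ℕ) → X → Prop

/-- `x` has a recursive name. -/
def Constructive {X : Type*} (ρ : NameRelation X) (x : X) : Prop :=
  ∃ σ : ℕ → ℕ, Computable σ ∧ ρ σ x

/-- The `x i` have names that are recursive uniformly in `i`. -/
def UniformlyConstructive {X : Type*} (ρ : NameRelation X) (x : ℕ → X) : Prop :=
  ∃ σ : ℕ → ℕ → ℕ, Computable₂ σ ∧ ∀ i, ρ (σ i) (x i)

/-- Some recursive function sends each name of each `x ∈ D` to a name of `f x`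
(the values of `f` outside `D` are irrelevant). -/
def ConstructiveOn {X Y : Type*} (ρX : NameRelation X) (ρY : NameRelation Y)
    (f : X → Y) (D : Set X) : Prop :=
  ∃ F : (ℕ → ℕ) → (ℕ → ℕ), RecursiveOn F {σ | ∃ x ∈ D, ρX σ x} ∧
    ∀ σ, ∀ x ∈ D, ρX σ x → ρY (F σ) (f x)

/-- `y` is `x`-constructive: it is the value at `x` of a function that is constructive
on `{x}`. -/
def ConstructiveFrom {X Y : Type*} (ρX : NameRelation X) (ρY : NameRelation Y)
    (x : X) (y : Y) : Prop :=
  ∃ f : X → Y, ConstructiveOn ρX ρY f {x} ∧ f x = y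

/-- The Cauchy representation: names of `x` are the fast sequences of ideal points converging
to `x`. -/
def cauchyRep {X : Type*} [PseudoMetricSpace X] (s : ℕ → X) : NameRelation X :=
  fun σ x => (∀ n, dist (s (σ n)) (s (σ (n + 1))) < (1 / 2 : ℝ) ^ n) ∧
    Tendsto (fun n => s (σ n)) atTop (𝓝 x)

/-- The representation of suprema of a numbered family in a complete lattice. The entry `k + 1`
of a name lists the object `p k`, the entry `0` lists nothing, so that the enumerated family may
be empty or finite. -/
def enumRep {L : Type*} [CompleteLattice L] (p : ℕ → L) : NameRelation L :=
  fun σ y => y = ⨆ (n : ℕ) (k : ℕ) (_ : σ n = k + 1), p k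

/-! ### Computable metric spaces -/

/-- The standard numbering of the rationals. -/
def ratNum (n : ℕ) : ℚ :=
  ((n.unpair.1 : ℚ) - n.unpair.2.unpair.1) / (n.unpair.2.unpair.2 + 1)

/-- The standard numbering of the positive rationals. -/
def posRatNum (n : ℕ) : ℚ := ((n.unpair.1 : ℚ) + 1) / (n.unpair.2 + 1)

/-- The canonical representation of the reals. -/
def realRep : NameRelation ℝ := cauchyRep fun n => (ratNum n : ℝ)

/-- `s` enumerates the ideal points of a computable metric space structure on `X`. -/
structure IsComputableMetricSpace {X : Type*} [MetricSpace X] (s : ℕ → X) : Prop where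
  complete : CompleteSpace X
  dense : DenseRange s
  dist_computable : UniformlyConstructive realRep
    fun n => dist (s n.unpair.1) (s n.unpair.2)

/-- The ideal ball `B_⟨i,j⟩ = B(s_i, q_j)`. -/
def idealBall {X : Type*} [MetricSpace X] (s : ℕ → X) (k : ℕ) : Set X :=
  Metric.ball (s k.unpair.1) (posRatNum k.unpair.2 : ℝ)

/-- The canonical representation of open sets, as unions of ideal balls. -/
def openRep {X : Type*} [MetricSpace X] (s : ℕ → X) : NameRelation (Set X) :=
  enumRep (idealBall s)

/-- Intersections of uniformly r.e. open sets. -/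
def IsPi02 {X : Type*} [MetricSpace X] (s : ℕ → X) (D : Set X) : Prop :=
  ∃ U : ℕ → Set X, UniformlyConstructive (openRep s) U ∧ D = ⋂ n, U n

/-- The step function `f_⟨i,j⟩`, equal to `q_j` on the ideal ball `B_i` and to `0` elsewhere. -/
def stepFunction {X : Type*} [MetricSpace X] (s : ℕ → X) (k : ℕ) : X → ℝ≥0∞ :=
  (idealBall s k.unpair.1).indicator fun _ => ENNReal.ofReal (posRatNum k.unpair.2 : ℝ)

/-- The canonical representation of nonnegative lower semicontinuous functions, as suprema of
step functions. -/
def lscRep {X : Type*} [MetricSpace X] (s : ℕ → X) : NameRelation (X → ℝ≥0∞) :=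
  enumRep (stepFunction s)

/-! ### Computable probability measures -/

/-- The `n`-th nonempty finite list of pairs (index of an ideal point, weight). -/
def weightList (n : ℕ) : List (ℕ × ℕ) :=
  let a := Denumerable.ofNat ((ℕ × ℕ) × List (ℕ × ℕ)) n
  a.1 :: a.2

/-- The mass of a list of pairs; the pair `(i, w)` has weight `w + 1`. -/
def totalWeight (l : List (ℕ × ℕ)) : ℝ≥0∞ := (l.map fun a => (a.2 + 1 : ℝ≥0∞)).sum

/-- The unnormalized sum of point masses. -/
def pointMasses {X : Type*} [MeasurableSpace X] (s : ℕ → X) (l : List (ℕ × ℕ)) : Measure X :=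
  (l.map fun a => (a.2 + 1 : ℝ≥0∞) • Measure.dirac (s a.1)).sum

theorem pointMasses_univ {X : Type*} [MeasurableSpace X] (s : ℕ → X) (l : List (ℕ × ℕ)) :
    pointMasses s l Set.univ = totalWeight l := by
  induction l with
  | nil => simp [pointMasses, totalWeight]
  | cons a l ih =>
    simp only [pointMasses, totalWeight, List.map_cons, List.sum_cons] at ih ⊢
    rw [Measure.add_apply, ih]
    simp

theorem totalWeight_ne_top (l : List (ℕ × ℕ)) : totalWeight l ≠ ∞ := by
  induction l with
  | nil => simp [totalWeight]
  | cons a l ih =>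
    simp only [totalWeight, List.map_cons, List.sum_cons] at ih ⊢
    exact ENNReal.add_ne_top.2 ⟨ENNReal.add_ne_top.2 ⟨ENNReal.natCast_ne_top _,
      ENNReal.one_ne_top⟩, ih⟩

theorem totalWeight_weightList_ne_zero (n : ℕ) : totalWeight (weightList n) ≠ 0 := by
  simp [totalWeight, weightList]

/-- The numbering of the ideal measures: the probability measures concentrated on finitely many
ideal points and giving them rational weights. -/
def idealMeasure {X : Type*} [MeasurableSpace X] (s : ℕ → X) (n : ℕ) : ProbabilityMeasure X :=
  ⟨(totalWeight (weightList n))⁻¹ • pointMasses s (weightList n), ⟨by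
    rw [Measure.smul_apply, pointMasses_univ, smul_eq_mul]
    exact ENNReal.inv_mul_cancel (totalWeight_weightList_ne_zero n) (totalWeight_ne_top _)⟩⟩

/-- The Cauchy representation of Borel probability measures, for the Prokhorov metric and the
ideal measures. -/
def measureRep {X : Type*} [MetricSpace X] [MeasurableSpace X] [BorelSpace X] (s : ℕ → X) :
    NameRelation (LevyProkhorov (ProbabilityMeasure X)) :=
  cauchyRep fun n => LevyProkhorov.ofMeasure (idealMeasure s n)

/-- Computable probability measures. -/
def IsComputableMeasure {X : Type*} [MetricSpace X] [MeasurableSpace X] [BorelSpace X]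
    (s : ℕ → X) (μ : ProbabilityMeasure X) : Prop :=
  Constructive (measureRep s) (LevyProkhorov.ofMeasure μ)

/-- Computable probability spaces. -/
structure IsComputableProbabilitySpace {X : Type*} [MetricSpace X] [MeasurableSpace X]
    [BorelSpace X] (s : ℕ → X) (μ : ProbabilityMeasure X) : Prop where
  space : IsComputableMetricSpace s
  measure : IsComputableMeasure s μ

/-- `F : D ⊆ X → Y` is a morphism of computable probability spaces (the values of `F` outside
`D` are irrelevant). -/
structure IsMorphism {X Y : Type*} [MetricSpace X] [MeasurableSpace X] [BorelSpace X]
    [MetricSpace Y] [MeasurableSpace Y] [BorelSpace Y] (sX : ℕ → X) (μ : ProbabilityMeasure X)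
    (sY : ℕ → Y) (ν : ProbabilityMeasure Y) (F : X → Y) (D : Set X) : Prop where
  pi02 : IsPi02 sX D
  full : (μ : Measure X) D = 1
  computable : ConstructiveOn (cauchyRep sX) (cauchyRep sY) F D
  preserving : ∀ A : Set Y, MeasurableSet A →
    (ν : Measure Y) A = (μ : Measure X) (D ∩ F ⁻¹' A)

/-! ### Randomness -/

/-- `t` is a `μ`-randomness test. -/
def IsRandomnessTest {X : Type*} [MetricSpace X] [MeasurableSpace X] [BorelSpace X]
    (s : ℕ → X) (μ : ProbabilityMeasure X) (t : X → ℝ≥0∞) : Prop :=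
  ConstructiveFrom (measureRep s) (lscRep s) (LevyProkhorov.ofMeasure μ) t ∧
    ∫⁻ x, t x ∂(μ : Measure X) ≤ 1

/-- `N` is a `μ`-effective null set. -/
def IsEffectiveNull {X : Type*} [MetricSpace X] [MeasurableSpace X] [BorelSpace X]
    (s : ℕ → X) (μ : ProbabilityMeasure X) (N : Set X) : Prop :=
  ∃ t, IsRandomnessTest s μ t ∧ N ⊆ {x | t x = ∞}

/-- `x` is `μ`-random: it lies in no `μ`-effective null set. -/
def IsRandom {X : Type*} [MetricSpace X] [MeasurableSpace X] [BorelSpace X]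
    (s : ℕ → X) (μ : ProbabilityMeasure X) (x : X) : Prop :=
  ∀ N : Set X, IsEffectiveNull s μ N → x ∉ N

/-! ### Cantor space and binary representations -/

/-- Cantor space carries the metric `d(ω, ω') = 2 ^ (-min {n | ω_n ≠ ω'_n})`. -/
instance cantorMetricSpace : MetricSpace (ℕ → Bool) :=
  PiNat.metricSpaceOfDiscreteUniformity fun _ => rfl

/-- The ideal points `w000…` of Cantor space: the binary digits of `n`, lowest first. -/
def cantorIdeal (n : ℕ) : ℕ → Bool := fun i => n.testBit i

/-- A binary representation `(δ, μ_δ)` of `(X, μ)`: the partial map `δ` is `toFun` on `dom`, and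
`D` is a dense full-measure `Π⁰₂` set of points with a unique expansion on which the inverse
of `δ` is computable. -/
structure BinaryRepresentation {X : Type*} [MetricSpace X] [MeasurableSpace X] [BorelSpace X]
    (s : ℕ → X) (μ : ProbabilityMeasure X) where
  measure : ProbabilityMeasure (ℕ → Bool)
  measure_computable : IsComputableMeasure cantorIdeal measure
  toFun : (ℕ → Bool) → X
  dom : Set (ℕ → Bool)
  morphism : IsMorphism cantorIdeal measure s μ toFun dom
  surjective : Set.SurjOn toFun dom Set.univ
  D : Set X
  dense_D : Dense D
  full_D : (μ : Measure X) D = 1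
  pi02_D : IsPi02 s D
  unique : ∀ x ∈ D, ∃! ω, ω ∈ dom ∧ toFun ω = x
  inverse_computable :
    ConstructiveOn (cauchyRep s) (cauchyRep cantorIdeal) (Function.invFunOn toFun dom) D

/-! ### Prefix complexity -/

/-- A partial recursive function on binary words with prefix-free domain. -/
def IsPrefixMachine (M : List Bool →. List Bool) : Prop :=
  Partrec M ∧ ∀ p ∈ M.Dom, ∀ q ∈ M.Dom, p <+: q → p = q

/-- A prefix machine that simulates every prefix machine up to an additive constant in the
length of programs. -/
def IsUniversalPrefixMachine (U : List Bool →. List Bool) : Prop :=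
  IsPrefixMachine U ∧ ∀ M, IsPrefixMachine M →
    ∃ c : ℕ, ∀ p w, w ∈ M p → ∃ q, w ∈ U q ∧ q.length ≤ p.length + c

/-- Comparability for the prefix order. -/
def comparableWords (x y : List Bool) : Bool := decide (x.take y.length = y.take x.length)

theorem comparableWords_iff (x y : List Bool) :
    comparableWords x y = true ↔ x <+: y ∨ y <+: x := by
  rw [comparableWords, decide_eq_true_iff]
  constructor
  · intro h
    rcases le_total x.length y.length with hl | hl
    · left
      rw [List.take_of_length_le hl] at h
      exact h ▸ List.take_prefix _ _
    · right
      rw [List.take_of_length_le hl] at h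
      exact h ▸ List.take_prefix _ _
  · rintro (⟨z, rfl⟩ | ⟨z, rfl⟩) <;> simp

/-- The `t`-th attempt, for `t = ⟨e, ⟨n, k⟩⟩`: if the program `e` halts within bound `n` on the
input `k` that codes the word `q`, the word `1^e 0 q` and the output. -/
def machineAttempt (t : ℕ) : Option (List Bool × ℕ) :=
  (Encodable.decode (α := List Bool) t.unpair.2.unpair.2).bind fun q =>
    (Nat.Partrec.Code.evaln t.unpair.2.unpair.1
      (Denumerable.ofNat Nat.Partrec.Code t.unpair.1) t.unpair.2.unpair.2).map fun y =>
        ((List.range t.unpair.1).map (fun _ => true) ++ false :: q, y)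

/-- Search for the first successful attempt whose word is comparable with the input, and answer
if this word is the input. -/
def universalMachine : List Bool →. List Bool := fun x =>
  (Nat.rfind fun t => Part.some
    (((machineAttempt t).map fun r => comparableWords r.1 x).getD false)).bind fun t =>
      (((machineAttempt t).bind fun r =>
        bif decide (r.1 = x) then Encodable.decode (α := List Bool) r.2 else none :
          Option (List Bool)) : Part (List Bool))

theorem machineAttempt_primrec : Primrec machineAttempt := by
  have h2 : Primrec fun t : ℕ => t.unpair.2 := Primrec.snd.comp Primrec.unpair
  have h1 : Primrec fun t : ℕ => t.unpair.1 := Primrec.fst.comp Primrec.unpair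
  have h22 : Primrec fun t : ℕ => t.unpair.2.unpair.2 := h2.comp h2
  have h21 : Primrec fun t : ℕ => t.unpair.2.unpair.1 := h1.comp h2
  refine Primrec.option_bind (Primrec.decode.comp h22) ?_
  refine Primrec.option_map (f := fun a : ℕ × List Bool => Nat.Partrec.Code.evaln
    a.1.unpair.2.unpair.1 (Denumerable.ofNat Nat.Partrec.Code a.1.unpair.1)
      a.1.unpair.2.unpair.2) ?_ ?_
  · exact Nat.Partrec.Code.primrec_evaln.comp
      (((h21.comp Primrec.fst).pair ((Primrec.ofNat _).comp (h1.comp Primrec.fst))).pair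
        (h22.comp Primrec.fst))
  · refine Primrec.pair (Primrec.list_append.comp ?_ ?_) Primrec.snd
    · exact Primrec.list_map (Primrec.list_range.comp
        (h1.comp (Primrec.fst.comp Primrec.fst))) (Primrec.const true).to₂
    · exact Primrec.list_cons.comp (Primrec.const false) (Primrec.snd.comp Primrec.fst)

theorem comparableWords_primrec : Primrec₂ comparableWords := by
  have : PrimrecRel fun x y : List Bool => x.take y.length = y.take x.length :=
    Primrec.eq.comp₂
      (Primrec.list_take.comp (Primrec.list_length.comp Primrec.snd) Primrec.fst)
      (Primrec.list_take.comp (Primrec.list_length.comp Primrec.fst) Primrec.snd)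
  exact this.decide

theorem universalMachine_partrec : Partrec universalMachine := by
  refine Partrec.bind (Partrec.rfind ?_) ?_
  · refine Computable.partrec (Primrec.to_comp ?_)
    refine Primrec.option_getD.comp (Primrec.option_map
      (machineAttempt_primrec.comp Primrec.snd) ?_) (Primrec.const false)
    exact comparableWords_primrec.comp (Primrec.fst.comp Primrec.snd)
      (Primrec.fst.comp Primrec.fst)
  · refine Computable.ofOption (Primrec.to_comp ?_)
    refine Primrec.option_bind (machineAttempt_primrec.comp Primrec.snd) ?_
    refine Primrec.cond (Primrec.eq.decide.comp (Primrec.fst.comp Primrec.snd)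
      (Primrec.fst.comp Primrec.fst)) (Primrec.decode.comp (Primrec.snd.comp Primrec.snd))
      (Primrec.const none)

theorem mem_universalMachine {x w : List Bool} : w ∈ universalMachine x ↔
    ∃ t y, machineAttempt t = some (x, y) ∧ Encodable.decode (α := List Bool) y = some w ∧
      ∀ t' < t, ∀ r, machineAttempt t' = some r → comparableWords r.1 x = false := by
  simp only [universalMachine, Part.mem_bind_iff, Part.mem_ofOption, Option.mem_def, Option.bind_eq_some_iff]
  constructor
  · rintro ⟨t, hfind, ⟨r, y⟩, hr, hw⟩
    obtain ⟨-, ht⟩ := Nat.mem_rfind.1 hfind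
    by_cases hx : r = x
    · subst hx
      refine ⟨t, y, hr, by simpa using hw, fun t' ht' r' hr' => ?_⟩
      have := Part.mem_some_iff.1 (ht ht')
      rw [hr'] at this
      simpa using this.symm
    · simp [hx] at hw
  · rintro ⟨t, y, hr, hw, ht⟩
    refine ⟨t, Nat.mem_rfind.2 ⟨Part.mem_some_iff.2 ?_, fun {m} hm =>
      Part.mem_some_iff.2 ?_⟩, (x, y), hr, by simpa using hw⟩
    · simp [hr, comparableWords]
    · cases h : machineAttempt m with
      | none => rfl
      | some r => simpa using (ht m hm r h).symm

theorem universalMachine_isUniversal : IsUniversalPrefixMachine universalMachine := by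
  refine ⟨⟨universalMachine_partrec, fun p hp q hq hpq => ?_⟩, fun M hM => ?_⟩
  · obtain ⟨w, hw⟩ := Part.dom_iff_mem.1 hp
    obtain ⟨v, hv⟩ := Part.dom_iff_mem.1 hq
    obtain ⟨t, y, ht, -, hlt⟩ := mem_universalMachine.1 hw
    obtain ⟨t', y', ht', -, hlt'⟩ := mem_universalMachine.1 hv
    rcases lt_trichotomy t t' with h | h | h
    · have := hlt' t h _ ht
      rw [(comparableWords_iff _ _).2 (Or.inl hpq)] at this
      cases this
    · subst h
      rw [ht] at ht'
      simpa using congrArg (fun o => o.map Prod.fst) ht'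
    · have := hlt t' h _ ht'
      rw [(comparableWords_iff _ _).2 (Or.inr hpq)] at this
      cases this
  · obtain ⟨c, hc⟩ := Nat.Partrec.Code.exists_code.1 hM.1
    have hev : ∀ k y, y ∈ c.eval k ↔ ∃ q w, Encodable.decode (α := List Bool) k = some q ∧
        w ∈ M q ∧ Encodable.encode w = y := by
      intro k y
      rw [hc]
      simp [Part.mem_bind_iff]
    refine ⟨Encodable.encode c + 1, fun p w hw => ?_⟩
    let code : List Bool → List Bool := fun q =>
      (List.range (Encodable.encode c)).map (fun _ => true) ++ false :: q
    have hpre : ∀ e q, (List.range e).map (fun _ => true) ++ false :: q =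
        List.replicate e true ++ false :: q := by
      intro e q
      congr 1
      exact List.ext_getElem (by simp) (by simp)
    have hcmp : ∀ e e' : ℕ, ∀ q q' : List Bool,
        List.replicate e true ++ false :: q <+: List.replicate e' true ++ false :: q' →
          e = e' ∧ q <+: q' := by
      intro e
      induction e with
      | zero =>
        intro e' q q' h
        cases e' with
        | zero => simpa using h
        | succ e' => simp [List.replicate_succ, List.cons_prefix_cons] at h
      | succ e ih =>
        intro e' q q' h
        cases e' with
        | zero => simp [List.replicate_succ, List.cons_prefix_cons] at h
        | succ e' =>
          simp only [List.replicate_succ, List.cons_append, List.cons_prefix_cons, true_and] at h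
          obtain ⟨h1, h2⟩ := ih e' q q' h
          exact ⟨by rw [h1], h2⟩
    -- every successful attempt comparable with the code word of `p` is for `p` itself
    have huniq : ∀ t r, machineAttempt t = some r → comparableWords r.1 (code p) = true →
        r.1 = code p ∧ Encodable.decode (α := List Bool) r.2 = some w := by
      rintro t ⟨x, y⟩ ht hcp
      simp only [machineAttempt, Option.bind_eq_some_iff, Option.map_eq_some_iff,
        Prod.mk.injEq] at ht
      obtain ⟨q, hq, y', hy', hx, rfl⟩ := ht
      rw [comparableWords_iff, ← hx, hpre] at hcp
      simp only [code, hpre] at hcp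
      have heq : t.unpair.1 = Encodable.encode c ∧ (q <+: p ∨ p <+: q) := by
        rcases hcp with h | h
        · obtain ⟨h1, h2⟩ := hcmp _ _ _ _ h
          exact ⟨h1, Or.inl h2⟩
        · obtain ⟨h1, h2⟩ := hcmp _ _ _ _ h
          exact ⟨h1.symm, Or.inr h2⟩
      obtain ⟨he, hqp⟩ := heq
      rw [he, Denumerable.ofNat_encode] at hy'
      obtain ⟨q', v, hq', hv, hvy⟩ := (hev _ _).1 (Nat.Partrec.Code.evaln_sound hy')
      rw [hq] at hq'
      cases hq'
      have hqd : q ∈ M.Dom := Part.dom_iff_mem.2 ⟨v, hv⟩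
      have hpd : p ∈ M.Dom := Part.dom_iff_mem.2 ⟨w, hw⟩
      have hqp' : q = p := by
        rcases hqp with h | h
        · exact hM.2 q hqd p hpd h
        · exact (hM.2 p hpd q hqd h).symm
      subst hqp'
      have := Part.mem_unique hv hw
      subst this
      refine ⟨?_, ?_⟩
      · rw [← hx]
        simp only [code, he]
      · simp [← hvy]
    obtain ⟨n, hn⟩ := Nat.Partrec.Code.evaln_complete.1
      ((hev (Encodable.encode p) (Encodable.encode w)).2 ⟨p, w, by simp, hw, rfl⟩)
    have hex : ∃ t r, machineAttempt t = some r ∧ comparableWords r.1 (code p) = true := by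
      refine ⟨Nat.pair (Encodable.encode c) (Nat.pair n (Encodable.encode p)),
        (code p, Encodable.encode w), ?_, by simp [comparableWords]⟩
      simp only [machineAttempt, Nat.unpair_pair, Encodable.encodek, Option.bind_some,
        Denumerable.ofNat_encode, Option.mem_def.1 hn, Option.map_some, code]
    classical
    obtain ⟨r, hr, hrc⟩ := Nat.find_spec hex
    obtain ⟨h1, h2⟩ := huniq _ _ hr hrc
    refine ⟨code p, mem_universalMachine.2 ⟨Nat.find hex, r.2, ?_, h2, ?_⟩, ?_⟩
    · rw [hr, ← h1]
    · intro t' ht' r' hr'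
      by_contra hne
      exact Nat.find_min hex ht' ⟨r', hr', by simpa using hne⟩
    · simp [code]
      omega

/-- The complexity of `w` with respect to `U`: the length of a shortest program for `w`. For
universal `U` every word has a program, so the minimum exists. -/
def complexity (U : List Bool →. List Bool) (w : List Bool) : ℕ :=
  sInf {k | ∃ p, w ∈ U p ∧ p.length = k}

/-- The base-two logarithm, with `log 0 = -∞`. -/
def log2 (a : ℝ≥0∞) : EReal := ENNReal.log a / (Real.log 2 : ℝ)

namespace BinaryRepresentation

variable {X : Type*} [MetricSpace X] [MeasurableSpace X] [BorelSpace X]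
  {s : ℕ → X} {μ : ProbabilityMeasure X}

/-- An expansion of `x`; for `x ∈ D` it is the only one. -/
def expansion (δ : BinaryRepresentation s μ) (x : X) : ℕ → Bool :=
  Function.invFunOn δ.toFun δ.dom x

/-- `H_n(x) = H(ω_{0..n-1})`, for `ω` the expansion of `x` and `H` the complexity with respect
to `U`. -/
def pointComplexity (δ : BinaryRepresentation s μ) (U : List Bool →. List Bool) (x : X) (n : ℕ) :
    ℕ :=
  complexity U (initialWord (δ.expansion x) n)

/-- `Γ_n(x) = δ([ω_{0..n-1}])`, for `ω` the expansion of `x`. -/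
def cell (δ : BinaryRepresentation s μ) (x : X) (n : ℕ) : Set X :=
  δ.toFun '' (δ.dom ∩ PiNat.cylinder (δ.expansion x) n)

end BinaryRepresentation

end

/-! The proof works with words instead of cells. If `w` consists of the first `n` digits of the
expansion of `x`, then `Γ_n(x)` has the same measure as the cylinder `[w]` under `μ_δ`
(`measure_cell`): computability of the inverse on `D` gives an r.e. open set `V_w` which agrees on
`D` with the points whose expansion begins with `w`, and null sets do not matter. Since `μ` is
computable, a randomness test is just an r.e. family of step functions whose supremum has integral
at most one; the oracle disappears.

Random implies complex. A random point lies in every r.e. open set of measure one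
(`IsRandom.mem_ballUnion`), hence in `D`. The function that adds, for every halting program `p` with
output `w`, the value `2^(-|p|) / μ_δ[w]` on `V_w` has integral at most `∑ 2^(-|p|) ≤ 1` by Kraft's
inequality. A test below it is finite at a random point, and a shortest program of `w` turns this
finiteness into `2^(-H(w)) ≤ 2^c μ_δ[w]`.

Complex implies random. If a test `t` is infinite at `x`, the sets `{t > 4^m}` have measure at most
`4^(-m)`, and their preimages under `δ` are generated by prefix-free r.e. sets of words
(`exists_prefixFree_of_isRandomnessTest`). These words can be requested with lengths about `-log
μ_δ[w] - m`, because the total weight remains at most one. A Kraft-Chaitin machine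
(`exists_prefixMachine_of_requests`) serves the requests, so arbitrarily large `m` make the
complexity of beginnings of the expansion fall below every bound `-log μ_δ[w] - c`.

Two effectivity facts carry both directions: computable maps pull r.e. open sets back to r.e. open
sets (`ConstructiveOn.exists_rePred_preimage`), and the measure of a finite union of balls is lower
semicomputable (`IsComputableMeasure.rePred_lt_measure`). Cylinders are clopen, so their measures
are also upper semicomputable. Algorithms are seldom written out; predicates are shown to be r.e. by
closure properties, and witnesses are found by search. -/

noncomputable section

/-! ### Closure properties of computable functions -/

attribute [fun_prop] Computable
attribute [fun_prop] Computable.comp Computable.pair Computable.const Computable.fst Computable.snd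

namespace Computable

variable {α β γ σ : Type*} [Primcodable α] [Primcodable β] [Primcodable γ] [Primcodable σ]

@[fun_prop]
theorem fun_id : Computable fun a : α => a := Computable.id

@[fun_prop]
theorem fst_comp {f : α → β × γ} (hf : Computable f) : Computable fun a => (f a).1 :=
  Computable.fst.comp hf

@[fun_prop]
theorem snd_comp {f : α → β × γ} (hf : Computable f) : Computable fun a => (f a).2 :=
  Computable.snd.comp hf

/-- Types on which addition is computable. -/
class HasAdd (M : Type*) [Primcodable M] [Add M] : Prop where
  add : Computable fun p : M × M => p.1 + p.2

/-- Types on which subtraction is computable. -/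
class HasSub (M : Type*) [Primcodable M] [Sub M] : Prop where
  sub : Computable fun p : M × M => p.1 - p.2

/-- Types on which multiplication is computable. -/
class HasMul (M : Type*) [Primcodable M] [Mul M] : Prop where
  mul : Computable fun p : M × M => p.1 * p.2

instance : HasAdd ℕ := ⟨Primrec.nat_add.to_comp⟩

instance : HasSub ℕ := ⟨Primrec.nat_sub.to_comp⟩

instance : HasMul ℕ := ⟨Primrec.nat_mul.to_comp⟩

@[fun_prop]
theorem add_comp {M : Type*} [Primcodable M] [Add M] [HasAdd M] {f g : α → M} (hf : Computable f)
    (hg : Computable g) : Computable fun a => f a + g a := HasAdd.add.comp (hf.pair hg)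

@[fun_prop]
theorem sub_comp {M : Type*} [Primcodable M] [Sub M] [HasSub M] {f g : α → M} (hf : Computable f)
    (hg : Computable g) : Computable fun a => f a - g a := HasSub.sub.comp (hf.pair hg)

@[fun_prop]
theorem mul_comp {M : Type*} [Primcodable M] [Mul M] [HasMul M] {f g : α → M} (hf : Computable f)
    (hg : Computable g) : Computable fun a => f a * g a := HasMul.mul.comp (hf.pair hg)

@[fun_prop]
theorem natDiv {f g : α → ℕ} (hf : Computable f) (hg : Computable g) :
    Computable fun a => f a / g a := Primrec.nat_div.to_comp.comp hf hg

@[fun_prop]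
theorem natMod {f g : α → ℕ} (hf : Computable f) (hg : Computable g) :
    Computable fun a => f a % g a := Primrec.nat_mod.to_comp.comp hf hg

@[fun_prop]
theorem natPair {f g : α → ℕ} (hf : Computable f) (hg : Computable g) :
    Computable fun a => Nat.pair (f a) (g a) := Primrec₂.natPair.to_comp.comp hf hg

@[fun_prop]
theorem natUnpair {f : α → ℕ} (hf : Computable f) : Computable fun a => Nat.unpair (f a) :=
  Computable.unpair.comp hf

theorem decide_natLt {f g : α → ℕ} (hf : Computable f) (hg : Computable g) :
    Computable fun a => decide (f a < g a) := Primrec.nat_lt.decide.to_comp.comp hf hg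

theorem decide_eq [DecidableEq β] {f g : α → β} (hf : Computable f) (hg : Computable g) :
    Computable fun a => decide (f a = g a) := Primrec.eq.decide.to_comp.comp hf hg

@[fun_prop]
theorem bool_and {f g : α → Bool} (hf : Computable f) (hg : Computable g) :
    Computable fun a => f a && g a := Primrec.and.to_comp.comp hf hg

@[fun_prop]
theorem bool_or {f g : α → Bool} (hf : Computable f) (hg : Computable g) :
    Computable fun a => f a || g a := Primrec.or.to_comp.comp hf hg

@[fun_prop]
theorem bool_not {f : α → Bool} (hf : Computable f) : Computable fun a => !f a :=
  Primrec.not.to_comp.comp hf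

@[fun_prop]
theorem bool_cond {c : α → Bool} {f g : α → σ} (hc : Computable c) (hf : Computable f)
    (hg : Computable g) : Computable fun a => bif c a then f a else g a := Computable.cond hc hf hg

@[fun_prop]
theorem some_comp {f : α → β} (hf : Computable f) : Computable fun a => some (f a) :=
  Computable.option_some.comp hf

@[fun_prop]
theorem getD_comp {f : α → Option β} {g : α → β} (hf : Computable f) (hg : Computable g) :
    Computable fun a => (f a).getD (g a) := Computable.option_getD hf hg

@[fun_prop]
theorem isSome_comp {f : α → Option β} (hf : Computable f) : Computable fun a => (f a).isSome :=
  Primrec.option_isSome.to_comp.comp hf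

@[fun_prop]
theorem getElem?_comp {f : α → List β} {g : α → ℕ} (hf : Computable f) (hg : Computable g) :
    Computable fun a => (f a)[g a]? := Computable.list_getElem?.comp hf hg

@[fun_prop]
theorem length_comp {f : α → List β} (hf : Computable f) : Computable fun a => (f a).length :=
  Computable.list_length.comp hf

@[fun_prop]
theorem take_comp {f : α → ℕ} {g : α → List β} (hf : Computable f) (hg : Computable g) :
    Computable fun a => (g a).take (f a) := Primrec.list_take.to_comp.comp hf hg

@[fun_prop]
theorem cons_comp {f : α → β} {g : α → List β} (hf : Computable f) (hg : Computable g) :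
    Computable fun a => f a :: g a := Computable.list_cons.comp hf hg

@[fun_prop]
theorem append_comp {f g : α → List β} (hf : Computable f) (hg : Computable g) :
    Computable fun a => f a ++ g a := Computable.list_append.comp hf hg

@[fun_prop]
theorem encode_comp {f : α → β} (hf : Computable f) : Computable fun a => Encodable.encode (f a) :=
  Computable.encode.comp hf

@[fun_prop]
theorem decode_comp {f : α → ℕ} (hf : Computable f) :
    Computable fun a => Encodable.decode (α := β) (f a) :=
  Computable.decode.comp hf

/-- With `g` uncurried, its side condition is a plain `Computable` goal that `fun_prop` can
discharge. -/
theorem option_map_uncurried {f : α → Option β} {g : α × β → σ} (hf : Computable f)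
    (hg : Computable g) : Computable fun a => (f a).map fun b => g (a, b) :=
  Computable.option_map hf hg.to₂

theorem option_bind_uncurried {f : α → Option β} {g : α × β → Option σ} (hf : Computable f)
    (hg : Computable g) : Computable fun a => (f a).bind fun b => g (a, b) :=
  Computable.option_bind hf hg.to₂

/-- Computability of iteration, in a form without curried arguments. -/
theorem nat_rec_uncurried {n : α → ℕ} {z : α → σ} {h : α × ℕ × σ → σ} (hn : Computable n)
    (hz : Computable z) (hh : Computable h) :
    Computable fun a => Nat.rec (motive := fun _ => σ) (z a) (fun i r => h (a, i, r)) (n a) :=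
  Computable.nat_rec hn hz (h := fun a p => h (a, p)) hh.to₂

theorem decide_forall_lt {n : α → ℕ} {f : α × ℕ → Bool} (hn : Computable n) (hf : Computable f) :
    Computable fun a => decide (∀ i < n a, f (a, i) = true) := by
  have h := nat_rec_uncurried (σ := Bool) (h := fun p : α × ℕ × Bool => p.2.2 && f (p.1, p.2.1))
    hn (Computable.const true) (by fun_prop)
  refine h.of_eq fun a => ?_
  induction n a with
  | zero => simp
  | succ n ih =>
    simp only [ih, Nat.forall_lt_succ_right, Bool.decide_and, Bool.decide_eq_true]

theorem sum_range {M : Type*} [AddCommMonoid M] [Primcodable M] [HasAdd M] {n : α → ℕ}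
    {f : α × ℕ → M} (hn : Computable n) (hf : Computable f) :
    Computable fun a => ∑ i ∈ Finset.range (n a), f (a, i) := by
  have h := nat_rec_uncurried (σ := M) (h := fun p : α × ℕ × M => p.2.2 + f (p.1, p.2.1))
    hn (Computable.const 0) (by fun_prop)
  refine h.of_eq fun a => ?_
  induction n a with
  | zero => simp
  | succ n ih => simp only [ih, Finset.sum_range_succ]

@[fun_prop]
theorem pow_comp {M : Type*} [Monoid M] [Primcodable M] [HasMul M] {f : α → M} {n : α → ℕ}
    (hf : Computable f) (hn : Computable n) : Computable fun a => f a ^ n a := by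
  have h := nat_rec_uncurried (σ := M) (h := fun p : α × ℕ × M => p.2.2 * f p.1)
    hn (Computable.const 1) (by fun_prop)
  refine h.of_eq fun a => ?_
  induction n a with
  | zero => simp
  | succ n ih => simp only [ih, pow_succ]

theorem map_range {n : α → ℕ} {f : α × ℕ → β} (hn : Computable n) (hf : Computable f) :
    Computable fun a => (List.range (n a)).map fun i => f (a, i) := by
  have h := nat_rec_uncurried (σ := List β)
    (h := fun p : α × ℕ × List β => p.2.2 ++ [f (p.1, p.2.1)])
    hn (Computable.const []) (by fun_prop)
  refine h.of_eq fun a => ?_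
  induction n a with
  | zero => simp
  | succ n ih => simp only [ih, List.range_succ, List.map_append, List.map_cons, List.map_nil]

end Computable

/-! ### Recursively enumerable predicates -/

/-- The stage is the step bound of `evaln`. This normal form reduces the closure properties to
operations on a decidable predicate. -/
theorem rePred_iff_exists_stage {α : Type*} [Primcodable α] {p : α → Prop} :
    REPred p ↔ ∃ f : α × ℕ → Bool, Computable f ∧ ∀ a, p a ↔ ∃ n, f (a, n) = true := by
  constructor
  · intro h
    obtain ⟨c, hc⟩ := Nat.Partrec.Code.exists_code.1 h
    refine ⟨fun q => (Nat.Partrec.Code.evaln q.2 c (Encodable.encode q.1)).isSome, ?_, fun a => ?_⟩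
    · have := Nat.Partrec.Code.primrec_evaln.to_comp
      have h2 : Computable fun q : α × ℕ => Nat.Partrec.Code.evaln q.2 c (Encodable.encode q.1) :=
        this.comp (g := fun q : α × ℕ => ((q.2, c), Encodable.encode q.1)) (by fun_prop)
      fun_prop
    · have h1 : p a ↔ (c.eval (Encodable.encode a)).Dom := by
        rw [hc]
        simp [Part.dom_iff_mem]
      rw [h1, Part.dom_iff_mem]
      simp only [Nat.Partrec.Code.evaln_complete, Option.isSome_iff_exists, Option.mem_def]
      exact exists_comm
  · rintro ⟨f, hf, hp⟩
    have : Partrec fun a => Nat.rfind fun n => Part.some (f (a, n)) :=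
      Partrec.rfind hf.to₂.partrec₂
    refine this.dom_re.of_eq fun a => ?_
    rw [hp]
    refine Nat.rfind_dom.trans ?_
    simp only [Part.mem_some_iff, Part.some_dom, implies_true, and_true]
    exact exists_congr fun _ => eq_comm

namespace REPred

variable {α β γ : Type*} [Primcodable α] [Primcodable β] [Primcodable γ] {p q : α → Prop}

theorem of_decide [DecidablePred p] (h : Computable fun a => decide (p a)) : REPred p :=
  ComputablePred.to_re ⟨inferInstance, h⟩

theorem of_bool {f : α → Bool} (h : Computable f) : REPred fun a => f a = true :=
  of_decide (by simpa using h)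

theorem comp {p : β → Prop} (hp : REPred p) {f : α → β} (hf : Computable f) :
    REPred fun a => p (f a) := Partrec.comp hp hf

protected theorem and (hp : REPred p) (hq : REPred q) : REPred fun a => p a ∧ q a := by
  have : Partrec fun a => (Part.assert (p a) fun _ => Part.some ()).bind
      fun _ => Part.assert (q a) fun _ => Part.some () :=
    Partrec.bind hp (Partrec.comp hq Computable.fst)
  refine this.dom_re.of_eq fun a => ?_
  simp [Part.dom_iff_mem]

theorem projection {p : α × β → Prop} (hp : REPred p) : REPred fun a => ∃ b, p (a, b) := by
  obtain ⟨f, hf, h⟩ := rePred_iff_exists_stage.1 hp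
  refine rePred_iff_exists_stage.2 ⟨fun q => ((Encodable.decode (α := β) q.2.unpair.1).map
    fun b => f ((q.1, b), q.2.unpair.2)).getD false, ?_, fun a => ?_⟩
  · have := Computable.option_map_uncurried
      (f := fun q : α × ℕ => Encodable.decode (α := β) q.2.unpair.1)
      (g := fun r => f ((r.1.1, r.2), r.1.2.unpair.2)) (by fun_prop) (by fun_prop)
    fun_prop
  · constructor
    · rintro ⟨b, hb⟩
      obtain ⟨n, hn⟩ := (h _).1 hb
      exact ⟨Nat.pair (Encodable.encode b) n, by simpa using hn⟩
    · rintro ⟨n, hn⟩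
      cases hd : Encodable.decode (α := β) n.unpair.1 with
      | none => simp [hd] at hn
      | some b => exact ⟨b, (h _).2 ⟨n.unpair.2, by simpa [hd] using hn⟩⟩

/-- A list of stages, one for each instance, is a finite witness; once it is given the bounded
quantifier is decidable. -/
protected theorem forall_lt {n : α → ℕ} (hn : Computable n) {p : α × ℕ → Prop} (hp : REPred p) :
    REPred fun a => ∀ i < n a, p (a, i) := by
  obtain ⟨f, hf, h⟩ := rePred_iff_exists_stage.1 hp
  have hc : REPred fun q : α × List ℕ => ∀ i < n q.1, f ((q.1, i), q.2[i]?.getD 0) = true :=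
    of_decide (Computable.decide_forall_lt (α := α × List ℕ) (n := fun q => n q.1)
      (f := fun r => f ((r.1.1, r.2), r.1.2[r.2]?.getD 0)) (by fun_prop) (by fun_prop))
  refine hc.projection.of_eq fun a => ?_
  constructor
  · rintro ⟨l, hl⟩ i hi
    exact (h _).2 ⟨_, hl i hi⟩
  · intro ha
    have : ∀ i, ∃ t, i < n a → f ((a, i), t) = true := fun i => by
      by_cases hi : i < n a
      · obtain ⟨t, ht⟩ := (h _).1 (ha i hi)
        exact ⟨t, fun _ => ht⟩
      · exact ⟨0, fun h => (hi h).elim⟩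
    choose t ht using this
    refine ⟨(List.range (n a)).map t, fun i hi => ?_⟩
    simpa [hi] using ht i hi

protected theorem forall_mem {l : α → List β} (hl : Computable l) {p : α × β → Prop}
    (hp : REPred p) : REPred fun a => ∀ b ∈ l a, p (a, b) := by
  have h : REPred fun a => ∀ i < (l a).length, ∃ b, (l a)[i]? = some b ∧ p (a, b) := by
    refine REPred.forall_lt (p := fun q : α × ℕ => ∃ b, (l q.1)[q.2]? = some b ∧ p (q.1, b))
      (by fun_prop) ?_
    refine REPred.projection (p := fun r : (α × ℕ) × β => (l r.1.1)[r.1.2]? = some r.2 ∧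
      p (r.1.1, r.2)) (REPred.and ?_ (hp.comp (by fun_prop)))
    classical
    exact of_decide (Computable.decide_eq (by fun_prop) (by fun_prop))
  refine h.of_eq fun a => ?_
  constructor
  · intro h b hb
    obtain ⟨i, hi, rfl⟩ := List.mem_iff_getElem.1 hb
    obtain ⟨b, hb, hp⟩ := h i hi
    simp only [hi, getElem?_pos, Option.some.injEq] at hb
    exact hb ▸ hp
  · intro h i hi
    exact ⟨(l a)[i], by simp [hi], h _ (List.getElem_mem hi)⟩

theorem exists_mem {l : α → List β} (hl : Computable l) {p : α × β → Prop}
    (hp : REPred p) : REPred fun a => ∃ b ∈ l a, p (a, b) := by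
  have h : REPred fun r : (α × β) × ℕ => (l r.1.1)[r.2]? = some r.1.2 ∧ p (r.1.1, r.1.2) := by
    refine REPred.and ?_ (hp.comp (by fun_prop))
    classical
    exact of_decide (Computable.decide_eq (by fun_prop) (by fun_prop))
  refine h.projection.projection.of_eq fun a => ?_
  simp only [exists_and_right, List.mem_iff_getElem?]

/-- A recursively enumerable family of sets of numbers has a uniformly computable enumeration. -/
theorem exists_enumeration {p : α × ℕ → Prop} (hp : REPred p) :
    ∃ σ : α → ℕ → ℕ, Computable₂ σ ∧ ∀ a k, p (a, k) ↔ ∃ n, σ a n = k + 1 := by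
  obtain ⟨f, hf, h⟩ := rePred_iff_exists_stage.1 hp
  refine ⟨fun a n => bif f ((a, n.unpair.1), n.unpair.2) then n.unpair.1 + 1 else 0, ?_,
    fun a k => ?_⟩
  · change Computable fun q : α × ℕ =>
      bif f ((q.1, q.2.unpair.1), q.2.unpair.2) then q.2.unpair.1 + 1 else 0
    fun_prop
  · constructor
    · intro hk
      obtain ⟨n, hn⟩ := (h _).1 hk
      exact ⟨Nat.pair k n, by simp [hn]⟩
    · rintro ⟨n, hn⟩
      refine (h _).2 ⟨n.unpair.2, ?_⟩
      cases hb : f ((a, n.unpair.1), n.unpair.2) with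
      | false => simp [hb] at hn
      | true =>
        simp only [hb, cond_true, Nat.add_right_cancel_iff] at hn
        rw [← hn, hb]

/-- A recursively enumerable set has a computable enumeration without repetitions. -/
theorem exists_injective_enumeration (hp : REPred p) :
    ∃ e : ℕ → Option α, Computable e ∧ (∀ a, p a ↔ ∃ t, e t = some a) ∧
      ∀ t t' a, e t = some a → e t' = some a → t = t' := by
  obtain ⟨f, hf, h⟩ := rePred_iff_exists_stage.1 hp
  -- Only the first successful stage of each element counts, which excludes repetitions.
  let good : α × ℕ → Bool := fun q => f q && decide (∀ i < q.2, (!f (q.1, i)) = true)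
  have hgood : Computable good := by
    have := Computable.decide_forall_lt (α := α × ℕ) (n := fun q => q.2)
      (f := fun r => !f (r.1.1, r.2)) (by fun_prop) (by fun_prop)
    fun_prop
  have huniq : ∀ a n n', good (a, n) = true → good (a, n') = true → n = n' := by
    intro a n n' h h'
    simp only [good, Bool.and_eq_true, decide_eq_true_eq, Bool.not_eq_eq_eq_not, Bool.not_true]
      at h h'
    rcases lt_trichotomy n n' with hlt | heq | hlt
    · rw [h'.2 n hlt] at h; simp at h
    · exact heq
    · rw [h.2 n' hlt] at h'; simp at h'
  -- `decode₂` accepts no number but `encode a`, so an element cannot reappear under a second code.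
  let e : ℕ → Option α := fun t => (Encodable.decode₂ α t.unpair.1).bind fun a =>
    bif good (a, t.unpair.2) then some a else none
  have he : ∀ t a, e t = some a ↔
      t.unpair.1 = Encodable.encode a ∧ good (a, t.unpair.2) = true := by
    intro t a
    simp only [e, Option.bind_eq_some_iff]
    constructor
    · rintro ⟨b, hb, hba⟩
      rw [← Option.mem_def, Encodable.mem_decode₂] at hb
      cases hg : good (b, t.unpair.2) with
      | false => simp [hg] at hba
      | true =>
        simp only [hg, cond_true, Option.some.injEq] at hba
        subst hba
        exact ⟨hb.symm, hg⟩
    · rintro ⟨h1, h2⟩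
      exact ⟨a, Encodable.mem_decode₂.2 h1.symm, by simp [h2]⟩
  refine ⟨e, ?_, fun a => ?_, fun t t' a ht ht' => ?_⟩
  · have hd : Computable fun t : ℕ => Encodable.decode₂ α t.unpair.1 :=
      Primrec.decode₂.to_comp.comp (by fun_prop)
    exact Computable.option_bind_uncurried
      (g := fun q : ℕ × α => bif good (q.2, q.1.unpair.2) then some q.2 else none) hd
      (by fun_prop)
  · simp only [he, h]
    constructor
    · intro hex
      classical
      refine ⟨Nat.pair (Encodable.encode a) (Nat.find hex), by simp, ?_⟩
      simp only [good, Nat.unpair_pair, Bool.and_eq_true, decide_eq_true_eq]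
      exact ⟨Nat.find_spec hex, fun i hi => by simpa using Nat.find_min hex hi⟩
    · rintro ⟨t, -, ht⟩
      exact ⟨_, (Bool.and_eq_true_iff.1 ht).1⟩
  · obtain ⟨h1, h2⟩ := (he _ _).1 ht
    obtain ⟨h1', h2'⟩ := (he _ _).1 ht'
    rw [← Nat.pair_unpair t, ← Nat.pair_unpair t', h1, h1', huniq _ _ _ h2 h2']

/-- Uniformization of recursively enumerable relations. -/
theorem exists_selector [Inhabited β] {p : α × β → Prop} (hp : REPred p) (h : ∀ a, ∃ b, p (a, b)) :
    ∃ g : α → β, Computable g ∧ ∀ a, p (a, g a) := by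
  obtain ⟨f, hf, hfp⟩ := rePred_iff_exists_stage.1 hp
  let F : α × ℕ → Option β := fun q => (Encodable.decode (α := β) q.2.unpair.1).bind
    fun b => bif f ((q.1, b), q.2.unpair.2) then some b else none
  have hF : Computable F := Computable.option_bind_uncurried
    (g := fun r : (α × ℕ) × β => bif f ((r.1.1, r.2), r.1.2.unpair.2) then some r.2 else none)
    (by fun_prop) (by fun_prop)
  have hpart : Partrec fun a => Nat.rfindOpt fun n => F (a, n) := Partrec.rfindOpt hF.to₂
  have hsound : ∀ a b, b ∈ (Nat.rfindOpt fun n => F (a, n)) → p (a, b) := by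
    intro a b hb
    obtain ⟨n, hn⟩ := Nat.rfindOpt_spec hb
    simp only [F, Option.mem_def, Option.bind_eq_some_iff] at hn
    obtain ⟨b', -, hb'⟩ := hn
    cases hg : f ((a, b'), n.unpair.2) with
    | false => simp [hg] at hb'
    | true =>
      simp only [hg, cond_true, Option.some.injEq] at hb'
      subst hb'
      exact (hfp _).2 ⟨_, hg⟩
  have hdom : ∀ a, (Nat.rfindOpt fun n => F (a, n)).Dom := by
    intro a
    obtain ⟨b, hb⟩ := h a
    obtain ⟨n, hn⟩ := (hfp _).1 hb
    exact Nat.rfindOpt_dom.2 ⟨Nat.pair (Encodable.encode b) n, b, by simp [F, hn]⟩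
  exact ⟨fun a => (Nat.rfindOpt fun n => F (a, n)).get (hdom a),
    hpart.of_eq_tot fun a => Part.get_mem _, fun a => hsound _ _ (Part.get_mem _)⟩

end REPred

/-! ### Computability on the rationals -/

theorem ratNum_surjective : Function.Surjective ratNum := by
  intro q
  refine ⟨Nat.pair q.num.toNat (Nat.pair (-q.num).toNat (q.den - 1)), ?_⟩
  have hd : ((q.den - 1 : ℕ) : ℚ) + 1 = q.den := by
    have := q.pos
    rw [Nat.cast_sub (by omega)]
    simp
  have hn : ((q.num.toNat : ℕ) : ℚ) - ((-q.num).toNat : ℕ) = q.num := by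
    have : ((q.num.toNat : ℤ)) - ((-q.num).toNat : ℤ) = q.num := by omega
    exact_mod_cast this
  simp only [ratNum, Nat.unpair_pair, hd, hn]
  exact Rat.num_div_den q

theorem ratNum_eq_iff (m n : ℕ) : ratNum m = ratNum n ↔
    m.unpair.1 * (n.unpair.2.unpair.2 + 1) + n.unpair.2.unpair.1 * (m.unpair.2.unpair.2 + 1) =
      n.unpair.1 * (m.unpair.2.unpair.2 + 1) + m.unpair.2.unpair.1 * (n.unpair.2.unpair.2 + 1) := by
  rw [ratNum, ratNum, div_eq_div_iff (by positivity) (by positivity)]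
  rw [← @Nat.cast_inj ℚ]
  push_cast
  constructor <;> intro h <;> linarith

theorem ratNum_lt_iff (m n : ℕ) : ratNum m < ratNum n ↔
    m.unpair.1 * (n.unpair.2.unpair.2 + 1) + n.unpair.2.unpair.1 * (m.unpair.2.unpair.2 + 1) <
      n.unpair.1 * (m.unpair.2.unpair.2 + 1) + m.unpair.2.unpair.1 * (n.unpair.2.unpair.2 + 1) := by
  rw [ratNum, ratNum, div_lt_div_iff₀ (by positivity) (by positivity)]
  rw [← @Nat.cast_lt ℚ]
  push_cast
  constructor <;> intro h <;> linarith

theorem primrecRel_ratNum_eq : PrimrecRel fun m n => ratNum m = ratNum n := by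
  have h1 : Primrec fun p : ℕ × ℕ => p.1.unpair.1 := Primrec.fst.comp (Primrec.unpair.comp .fst)
  have h2 : Primrec fun p : ℕ × ℕ => p.1.unpair.2 := Primrec.snd.comp (Primrec.unpair.comp .fst)
  have h21 : Primrec fun p : ℕ × ℕ => p.1.unpair.2.unpair.1 :=
    Primrec.fst.comp (Primrec.unpair.comp h2)
  have h22 : Primrec fun p : ℕ × ℕ => p.1.unpair.2.unpair.2 + 1 :=
    Primrec.succ.comp (Primrec.snd.comp (Primrec.unpair.comp h2))
  have hs : Primrec fun p : ℕ × ℕ => (p.2, p.1) := Primrec.pair .snd .fst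
  have h : PrimrecPred fun p : ℕ × ℕ =>
      p.1.unpair.1 * (p.2.unpair.2.unpair.2 + 1) + p.2.unpair.2.unpair.1 *
        (p.1.unpair.2.unpair.2 + 1) = p.2.unpair.1 * (p.1.unpair.2.unpair.2 + 1) +
          p.1.unpair.2.unpair.1 * (p.2.unpair.2.unpair.2 + 1) :=
    Primrec.eq.comp
      (Primrec.nat_add.comp (Primrec.nat_mul.comp h1 (h22.comp hs))
        (Primrec.nat_mul.comp (h21.comp hs) h22))
      (Primrec.nat_add.comp (Primrec.nat_mul.comp (h1.comp hs) h22)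
        (Primrec.nat_mul.comp h21 (h22.comp hs)))
  exact (h.of_eq fun p => (ratNum_eq_iff p.1 p.2).symm).primrecRel

/-- The least number of a rational in the standard numbering. -/
def IsLeastRatNum (n : ℕ) : Prop := ¬ ∃ m < n, ratNum m = ratNum n

instance : DecidablePred IsLeastRatNum := fun n => inferInstanceAs (Decidable (¬ ∃ m < n, _))

theorem primrecPred_isLeastRatNum : PrimrecPred IsLeastRatNum :=
  PrimrecPred.not ((PrimrecRel.exists_lt primrecRel_ratNum_eq).comp Primrec.id Primrec.id)

theorem exists_isLeastRatNum (q : ℚ) : ∃ n, IsLeastRatNum n ∧ ratNum n = q := by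
  classical
  refine ⟨Nat.find (ratNum_surjective q), ?_, Nat.find_spec (ratNum_surjective q)⟩
  rintro ⟨m, hm, h⟩
  exact Nat.find_min (ratNum_surjective q) hm (h.trans (Nat.find_spec (ratNum_surjective q)))

/-- The equivalence between the rationals and their least numbers. -/
def ratEquivLeast : ℚ ≃ {n // IsLeastRatNum n} where
  toFun q := ⟨(exists_isLeastRatNum q).choose, (exists_isLeastRatNum q).choose_spec.1⟩
  invFun n := ratNum n
  left_inv q := (exists_isLeastRatNum q).choose_spec.2
  right_inv n := by
    have h := (exists_isLeastRatNum (ratNum n)).choose_spec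
    refine Subtype.ext ?_
    rcases lt_trichotomy (exists_isLeastRatNum (ratNum n)).choose n.1 with hlt | heq | hlt
    · exact (n.2 ⟨_, hlt, h.2⟩).elim
    · exact heq
    · exact (h.1 ⟨_, hlt, h.2.symm⟩).elim

/-- Rationals are encoded by their least number. -/
instance ratPrimcodable : Primcodable ℚ :=
  @Primcodable.ofEquiv _ _ (Primcodable.subtype primrecPred_isLeastRatNum) ratEquivLeast

/-- The least number of `q`. -/
def ratCode (q : ℚ) : ℕ := (ratEquivLeast q).1

theorem ratNum_ratCode (q : ℚ) : ratNum (ratCode q) = q := ratEquivLeast.left_inv q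

section

variable {α : Type*} [Primcodable α]

namespace Computable

@[fun_prop]
theorem ratCode_comp {f : α → ℚ} (hf : Computable f) : Computable fun a => ratCode (f a) := by
  let _ := Primcodable.subtype primrecPred_isLeastRatNum
  have h1 : Primrec ratEquivLeast := Primrec.of_equiv
  have h2 : Primrec ratCode := Primrec.subtype_val.comp h1
  exact h2.to_comp.comp hf

@[fun_prop]
theorem ratNum_comp {f : α → ℕ} (hf : Computable f) : Computable fun a => ratNum (f a) := by
  let _ := Primcodable.subtype primrecPred_isLeastRatNum
  have hex : ∀ n, ∃ m, ratNum m = ratNum n := fun n => ⟨n, rfl⟩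
  -- A rational is encoded by its least number, which is found by searching upwards; the search ends
  -- because `n` itself qualifies.
  have hfind : Computable fun n => Nat.find (hex n) := by
    refine Computable.find (P := fun n m => ratNum m = ratNum n) ?_ hex
    have h : PrimrecPred fun p : ℕ × ℕ => ratNum p.2 = ratNum p.1 :=
      primrecRel_ratNum_eq.comp Primrec.snd Primrec.fst
    exact h.computablePred
  have hleast : ∀ n, IsLeastRatNum (Nat.find (hex n)) := fun n ⟨m, hm, h⟩ =>
    Nat.find_min (hex n) hm (h.trans (Nat.find_spec (hex n)))
  have h1 : Computable fun n => (⟨Nat.find (hex n), hleast n⟩ : {n // IsLeastRatNum n}) :=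
    Computable.subtype_mk primrecPred_isLeastRatNum hfind
  have h2 : Primrec ratEquivLeast.symm := Primrec.of_equiv_symm
  have h3 : Computable ratNum := (h2.to_comp.comp h1).of_eq fun n => Nat.find_spec (hex n)
  exact h3.comp hf

theorem decide_ratLt {f g : α → ℚ} (hf : Computable f) (hg : Computable g) :
    Computable fun a => decide (f a < g a) := by
  have h : Computable fun p : ℕ × ℕ => decide (ratNum p.1 < ratNum p.2) := by
    refine Computable.of_eq (f := fun p : ℕ × ℕ => decide
      (p.1.unpair.1 * (p.2.unpair.2.unpair.2 + 1) + p.2.unpair.2.unpair.1 *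
        (p.1.unpair.2.unpair.2 + 1) < p.2.unpair.1 * (p.1.unpair.2.unpair.2 + 1) +
          p.1.unpair.2.unpair.1 * (p.2.unpair.2.unpair.2 + 1)))
      (Computable.decide_natLt (by fun_prop) (by fun_prop)) fun p => ?_
    rw [decide_eq_decide, ratNum_lt_iff]
  refine (h.comp (g := fun a => (ratCode (f a), ratCode (g a))) (by fun_prop)).of_eq fun a => ?_
  simp only [ratNum_ratCode]

theorem decide_ratLe {f g : α → ℚ} (hf : Computable f) (hg : Computable g) :
    Computable fun a => decide (f a ≤ g a) := by
  refine (bool_not (decide_ratLt hg hf)).of_eq fun a => ?_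
  rw [← decide_not]
  simp only [not_lt]

theorem rat_of_natDiv {f : α → ℚ} {a b c : α → ℕ} (ha : Computable a) (hb : Computable b)
    (hc : Computable c) (h : ∀ x, f x = ((a x : ℚ) - b x) / (c x + 1)) : Computable f := by
  refine (ratNum_comp (f := fun x => Nat.pair (a x) (Nat.pair (b x) (c x)))
    (by fun_prop)).of_eq fun x => ?_
  rw [h]
  simp [ratNum]

@[fun_prop]
theorem natCast_rat {f : α → ℕ} (hf : Computable f) : Computable fun a => (f a : ℚ) :=
  rat_of_natDiv (b := fun _ => 0) (c := fun _ => 0) hf (by fun_prop) (by fun_prop)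
    fun x => by simp

/-- A binary operation on rationals is computable if it is so on fractions. -/
theorem rat_binary {op : ℚ → ℚ → ℚ} {a b c : (ℕ × ℕ × ℕ) × (ℕ × ℕ × ℕ) → ℕ}
    (ha : Computable a) (hb : Computable b) (hc : Computable c)
    (h : ∀ x y : ℕ × ℕ × ℕ, op (((x.1 : ℚ) - x.2.1) / (x.2.2 + 1))
      (((y.1 : ℚ) - y.2.1) / (y.2.2 + 1)) = ((a (x, y) : ℚ) - b (x, y)) / (c (x, y) + 1))
    {f g : α → ℚ} (hf : Computable f) (hg : Computable g) : Computable fun t => op (f t) (g t) := by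
  let frac : ℚ → ℕ × ℕ × ℕ := fun q =>
    ((ratCode q).unpair.1, (ratCode q).unpair.2.unpair.1, (ratCode q).unpair.2.unpair.2)
  have hfrac : Computable frac := by fun_prop
  have hq : ∀ q : ℚ, (((frac q).1 : ℚ) - (frac q).2.1) / ((frac q).2.2 + 1) = q := ratNum_ratCode
  refine rat_of_natDiv (a := fun t => a (frac (f t), frac (g t)))
    (b := fun t => b (frac (f t), frac (g t))) (c := fun t => c (frac (f t), frac (g t)))
    (by fun_prop) (by fun_prop) (by fun_prop) fun t => ?_
  rw [← h, hq, hq]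

instance : HasAdd ℚ := by
  refine ⟨rat_binary
    (a := fun p => p.1.1 * (p.2.2.2 + 1) + p.2.1 * (p.1.2.2 + 1))
    (b := fun p => p.1.2.1 * (p.2.2.2 + 1) + p.2.2.1 * (p.1.2.2 + 1))
    -- Denominators are coded by their predecessors, and this is the predecessor of the product.
    (c := fun p => p.1.2.2 * p.2.2.2 + p.1.2.2 + p.2.2.2)
    (by fun_prop) (by fun_prop) (by fun_prop) (fun x y => ?_)
    Computable.fst Computable.snd⟩
  have h : ((x.2.2 * y.2.2 + x.2.2 + y.2.2 : ℕ) : ℚ) + 1 = (x.2.2 + 1) * (y.2.2 + 1) := by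
    push_cast; ring
  rw [h]
  push_cast
  field_simp
  ring

instance : HasSub ℚ := by
  refine ⟨rat_binary
    (a := fun p => p.1.1 * (p.2.2.2 + 1) + p.2.2.1 * (p.1.2.2 + 1))
    (b := fun p => p.1.2.1 * (p.2.2.2 + 1) + p.2.1 * (p.1.2.2 + 1))
    (c := fun p => p.1.2.2 * p.2.2.2 + p.1.2.2 + p.2.2.2)
    (by fun_prop) (by fun_prop) (by fun_prop) (fun x y => ?_)
    Computable.fst Computable.snd⟩
  have h : ((x.2.2 * y.2.2 + x.2.2 + y.2.2 : ℕ) : ℚ) + 1 = (x.2.2 + 1) * (y.2.2 + 1) := by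
    push_cast; ring
  rw [h]
  push_cast
  field_simp
  ring

instance : HasMul ℚ := by
  refine ⟨rat_binary
    (a := fun p => p.1.1 * p.2.1 + p.1.2.1 * p.2.2.1)
    (b := fun p => p.1.1 * p.2.2.1 + p.1.2.1 * p.2.1)
    (c := fun p => p.1.2.2 * p.2.2.2 + p.1.2.2 + p.2.2.2)
    (by fun_prop) (by fun_prop) (by fun_prop) (fun x y => ?_)
    Computable.fst Computable.snd⟩
  have h : ((x.2.2 * y.2.2 + x.2.2 + y.2.2 : ℕ) : ℚ) + 1 = (x.2.2 + 1) * (y.2.2 + 1) := by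
    push_cast; ring
  rw [h]
  push_cast
  field_simp
  ring

@[fun_prop]
theorem posRatNum_comp {f : α → ℕ} (hf : Computable f) : Computable fun a => posRatNum (f a) :=
  rat_of_natDiv (a := fun x => (f x).unpair.1 + 1) (b := fun _ => 0)
    (c := fun x => (f x).unpair.2) (by fun_prop) (by fun_prop) (by fun_prop)
    fun x => by simp [posRatNum]

end Computable

end

theorem posRatNum_pos (n : ℕ) : 0 < posRatNum n := by
  unfold posRatNum
  positivity

theorem exists_posRatNum_eq {q : ℚ} (hq : 0 < q) : ∃ n, posRatNum n = q := by
  refine ⟨Nat.pair (q.num.toNat - 1) (q.den - 1), ?_⟩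
  have hd : ((q.den - 1 : ℕ) : ℚ) + 1 = q.den := by
    have := q.pos
    rw [Nat.cast_sub (by omega)]
    simp
  have hn : ((q.num.toNat - 1 : ℕ) : ℚ) + 1 = q.num := by
    have h0 := Rat.num_pos.2 hq
    have : ((q.num.toNat - 1 : ℕ) : ℤ) + 1 = q.num := by omega
    exact_mod_cast this
  simp only [posRatNum, Nat.unpair_pair, hd, hn]
  exact Rat.num_div_den q

/-! ### Prefix machines from requests -/

/-- The left end point of the dyadic interval of a word. -/
def dyadicValue : List Bool → ℚ
  | [] => 0
  | b :: l => ((bif b then 1 else 0) + dyadicValue l) * (1 / 2)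

/-- The closed form replaces recursion on words by a finite sum, whose computability is already
available. -/
theorem dyadicValue_eq_sum (l : List Bool) : dyadicValue l =
    ∑ i ∈ Finset.range l.length, (bif l[i]?.getD false then 1 else 0) * (1 / 2 : ℚ) ^ (i + 1) := by
  induction l with
  | nil => simp [dyadicValue]
  | cons b l ih =>
    rw [dyadicValue, ih, List.length_cons, Finset.sum_range_succ', add_mul, Finset.sum_mul, add_comm]
    congr 1
    · refine Finset.sum_congr rfl fun i _ => ?_
      rw [List.getElem?_cons_succ, pow_succ _ (i + 1)]
      ring
    · simp

theorem computable_dyadicValue : Computable dyadicValue := by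
  have h := Computable.sum_range (α := List Bool) (n := fun l => l.length)
    (f := fun q => (bif q.1[q.2]?.getD false then 1 else 0) * (1 / 2 : ℚ) ^ (q.2 + 1))
    (by fun_prop) (by fun_prop)
  exact h.of_eq fun l => (dyadicValue_eq_sum l).symm

theorem dyadicValue_nonneg (l : List Bool) : 0 ≤ dyadicValue l := by
  induction l with
  | nil => simp [dyadicValue]
  | cons b l ih => cases b <;> simp [dyadicValue] <;> positivity

theorem dyadicValue_add_le_one (l : List Bool) : dyadicValue l + (1 / 2) ^ l.length ≤ 1 := by
  induction l with
  | nil => simp [dyadicValue]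
  | cons b l ih =>
    rw [dyadicValue, List.length_cons, pow_succ]
    cases b
    · simp only [cond_false]; linarith
    · simp only [cond_true]; linarith

theorem dyadicValue_append (l m : List Bool) :
    dyadicValue (l ++ m) = dyadicValue l + (1 / 2) ^ l.length * dyadicValue m := by
  induction l with
  | nil => simp [dyadicValue]
  | cons b l ih =>
    rw [List.cons_append, dyadicValue, ih, dyadicValue, List.length_cons, pow_succ]
    ring

theorem exists_dyadicValue_eq (n k : ℕ) (hk : k < 2 ^ n) :
    ∃ l : List Bool, l.length = n ∧ dyadicValue l = k * (1 / 2) ^ n := by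
  induction n generalizing k with
  | zero => exact ⟨[], rfl, by simp [dyadicValue, Nat.lt_one_iff.1 hk]⟩
  | succ n ih =>
    by_cases h : k < 2 ^ n
    · obtain ⟨l, hl, hv⟩ := ih k h
      refine ⟨false :: l, by simp [hl], ?_⟩
      rw [dyadicValue, hv, pow_succ]
      simp only [cond_false]
      ring
    · obtain ⟨l, hl, hv⟩ := ih (k - 2 ^ n) (by rw [pow_succ] at hk; omega)
      refine ⟨true :: l, by simp [hl], ?_⟩
      rw [dyadicValue, hv, pow_succ, Nat.cast_sub (not_lt.1 h)]
      have : (2 : ℚ) ^ n * (1 / 2) ^ n = 1 := by rw [← mul_pow]; norm_num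
      simp only [cond_true]
      push_cast
      linear_combination (-1 / 2 : ℚ) * this

section Requests

variable {α : Type*} (e : ℕ → Option α) (len : α → ℕ)

/-- The measure `2 ^ (-len)` of the `t`-th request. -/
def requestWeight (t : ℕ) : ℚ := ((e t).map fun a => (1 / 2 : ℚ) ^ len a).getD 0

/-- The measure of the requests before the `t`-th. -/
def requestStart (t : ℕ) : ℚ := ∑ i ∈ Finset.range t, requestWeight e len i

/-- The `t`-th request, of length `n`, is served by the words of length `n + 1` whose dyadic
intervals lie in the `t`-th of consecutive intervals of the lengths requested. -/
def servesRequest (q : List Bool) (t : ℕ) : Bool :=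
  ((e t).map fun a => decide (q.length = len a + 1) &&
    (decide (requestStart e len t ≤ dyadicValue q) &&
    decide (dyadicValue q + (1 / 2) ^ q.length ≤ requestStart e len t + (1 / 2) ^ len a))).getD
      false

theorem requestWeight_nonneg (t : ℕ) : 0 ≤ requestWeight e len t := by
  unfold requestWeight
  cases e t <;> simp

theorem requestStart_mono : Monotone (requestStart e len) := by
  refine monotone_nat_of_le_succ fun t => ?_
  rw [requestStart, requestStart, Finset.sum_range_succ]
  linarith [requestWeight_nonneg e len t]

variable {e len}

theorem servesRequest_iff {q : List Bool} {t : ℕ} : servesRequest e len q t = true ↔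
    ∃ a, e t = some a ∧ q.length = len a + 1 ∧ requestStart e len t ≤ dyadicValue q ∧
      dyadicValue q + (1 / 2) ^ q.length ≤ requestStart e len (t + 1) := by
  have hs : requestStart e len (t + 1) = requestStart e len t + requestWeight e len t :=
    Finset.sum_range_succ _ _
  rw [hs, servesRequest, requestWeight]
  cases e t <;> simp

/-- The dyadic interval of an extension lies inside that of the prefix, while intervals reserved for
different requests do not overlap. -/
theorem eq_of_servesRequest {q r : List Bool} {t t' : ℕ} (hq : servesRequest e len q t = true)
    (hr : servesRequest e len r t' = true) (hqr : q <+: r) : t = t' := by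
  obtain ⟨a, -, -, h1, h2⟩ := servesRequest_iff.1 hq
  obtain ⟨a', -, -, h1', h2'⟩ := servesRequest_iff.1 hr
  obtain ⟨z, rfl⟩ := hqr
  rw [dyadicValue_append, List.length_append, pow_add] at h2'
  rw [dyadicValue_append] at h1'
  have hq0 : (0 : ℚ) < (1 / 2) ^ q.length := by positivity
  have hz0 : (0 : ℚ) < (1 / 2) ^ z.length := by positivity
  have hz1 := dyadicValue_nonneg z
  have hz2 := dyadicValue_add_le_one z
  rcases lt_trichotomy t t' with h | h | h
  · have := requestStart_mono e len (Nat.succ_le_of_lt h)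
    simp only [Nat.succ_eq_add_one] at this
    nlinarith
  · exact h
  · have := requestStart_mono e len (Nat.succ_le_of_lt h)
    simp only [Nat.succ_eq_add_one] at this
    nlinarith [mul_nonneg hq0.le hz1, mul_pos hq0 hz0]

/-- Rounding the left end of an interval of length `2^(-n)` up to a multiple of `2^(-n-1)` leaves
room for an aligned dyadic interval of half the length. This rounding costs the extra bit. -/
theorem exists_servesRequest {t : ℕ} {a : α} (ht : e t = some a)
    (h1 : requestStart e len (t + 1) ≤ 1) :
    ∃ q : List Bool, q.length = len a + 1 ∧ servesRequest e len q t = true := by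
  have hs : requestStart e len (t + 1) = requestStart e len t + (1 / 2) ^ len a := by
    rw [requestStart, Finset.sum_range_succ, requestWeight, ht]
    rfl
  have h0 : 0 ≤ requestStart e len t :=
    Finset.sum_nonneg fun i _ => requestWeight_nonneg e len i
  have hp : (2 : ℚ) ^ (len a + 1) * (1 / 2) ^ (len a + 1) = 1 := by rw [← mul_pow]; norm_num
  have hp' : (0 : ℚ) < (1 / 2) ^ (len a + 1) := by positivity
  have hpp : (0 : ℚ) < 2 ^ (len a + 1) := by positivity
  have hd : (1 / 2 : ℚ) ^ len a = 2 * (1 / 2) ^ (len a + 1) := by rw [pow_succ]; ring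
  obtain ⟨k, hk⟩ : ∃ k, k = ⌈requestStart e len t * 2 ^ (len a + 1)⌉₊ := ⟨_, rfl⟩
  have hk1 : requestStart e len t * 2 ^ (len a + 1) ≤ k := hk ▸ Nat.le_ceil _
  have hk2 : (k : ℚ) < requestStart e len t * 2 ^ (len a + 1) + 1 :=
    hk ▸ Nat.ceil_lt_add_one (by positivity)
  have hk1' : requestStart e len t ≤ k * (1 / 2) ^ (len a + 1) := by
    have := mul_le_mul_of_nonneg_right hk1 hp'.le
    rwa [mul_assoc, hp, mul_one] at this
  have hk2' : k * (1 / 2) ^ (len a + 1) < requestStart e len t + (1 / 2) ^ (len a + 1) := by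
    have := mul_lt_mul_of_pos_right hk2 hp'
    rwa [add_mul, mul_assoc, hp, mul_one, one_mul] at this
  have hlt : k < 2 ^ (len a + 1) := by
    have h : (k : ℚ) * (1 / 2) ^ (len a + 1) < 1 := by linarith
    have := mul_lt_mul_of_pos_left h hpp
    rw [mul_comm, mul_assoc, mul_comm (_ ^ _), hp, mul_one, mul_one] at this
    exact_mod_cast this
  obtain ⟨q, hq, hv⟩ := exists_dyadicValue_eq _ _ hlt
  refine ⟨q, hq, servesRequest_iff.2 ⟨a, ht, hq, hv ▸ hk1', ?_⟩⟩
  rw [hs, hv, hq]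
  linarith

end Requests

/-- A recursively enumerable set of requests of total measure at most one is served by a prefix
machine, at the cost of one more bit. -/
theorem exists_prefixMachine_of_requests {α : Type*} [Primcodable α] {p : α → Prop}
    (hp : REPred p) {out : α → List Bool} {len : α → ℕ} (hout : Computable out)
    (hlen : Computable len) (hsum : ∑' a : {a // p a}, (1 / 2 : ℝ≥0∞) ^ len a ≤ 1) :
    ∃ M, IsPrefixMachine M ∧ ∀ a, p a → ∃ q : List Bool, out a ∈ M q ∧ q.length = len a + 1 := by
  obtain ⟨e, he, hpe, hinj⟩ := hp.exists_injective_enumeration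
  have hw : Computable (requestWeight e len) := by
    have := Computable.option_map_uncurried (f := e)
      (g := fun q : ℕ × α => (1 / 2 : ℚ) ^ len q.2) he (by fun_prop)
    unfold requestWeight
    fun_prop
  have hstart : Computable (requestStart e len) :=
    Computable.sum_range (α := ℕ) (n := fun t => t) (f := fun q => requestWeight e len q.2)
      (by fun_prop) (by fun_prop)
  have hd := computable_dyadicValue
  have hserves : Computable fun q : List Bool × ℕ => servesRequest e len q.1 q.2 := by
    refine Computable.getD_comp (Computable.option_map_uncurried (α := List Bool × ℕ)
      (f := fun q => e q.2) (g := fun r => decide (r.1.1.length = len r.2 + 1) &&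
        (decide (requestStart e len r.1.2 ≤ dyadicValue r.1.1) &&
        decide (dyadicValue r.1.1 + (1 / 2) ^ r.1.1.length ≤
          requestStart e len r.1.2 + (1 / 2) ^ len r.2))) (by fun_prop) ?_) (by fun_prop)
    exact (Computable.decide_eq (by fun_prop) (by fun_prop)).bool_and
      ((Computable.decide_ratLe (by fun_prop) (by fun_prop)).bool_and
        (Computable.decide_ratLe (by fun_prop) (by fun_prop)))
  -- As the enumeration is injective, its partial sums are bounded by the sum over the set of
  -- requests.
  have hle : ∀ t, requestStart e len t ≤ 1 := by
    intro t
    have h1 : ∀ i, ENNReal.ofReal (requestWeight e len i : ℝ) =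
        ((e i).map fun a => (1 / 2 : ℝ≥0∞) ^ len a).getD 0 := by
      intro i
      unfold requestWeight
      cases e i with
      | none => simp
      | some a => simp [ENNReal.ofReal_pow, ENNReal.ofReal_inv_of_pos, ENNReal.inv_pow]
    have h2 : ENNReal.ofReal (requestStart e len t : ℝ) =
        ∑ i ∈ Finset.range t, ((e i).map fun a => (1 / 2 : ℝ≥0∞) ^ len a).getD 0 := by
      rw [requestStart, Rat.cast_sum, ENNReal.ofReal_sum_of_nonneg]
      · exact Finset.sum_congr rfl fun i _ => h1 i
      · exact fun i _ => by exact_mod_cast requestWeight_nonneg e len i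
    have h3 : ∑' i, ((e i).map fun a => (1 / 2 : ℝ≥0∞) ^ len a).getD 0 ≤ 1 := by
      have hget : ∀ i : {i // (e i).isSome}, e i = some ((e i).get i.2) := fun i =>
        (Option.some_get i.2).symm
      let g : {i // (e i).isSome} → {a // p a} := fun i =>
        ⟨(e i).get i.2, (hpe _).2 ⟨i, hget i⟩⟩
      have hg : Function.Injective g := by
        intro i j hij
        have := congrArg Subtype.val hij
        exact Subtype.ext (hinj _ _ _ (hget i) ((hget j).trans (congrArg some this.symm)))
      have hsub : ∑' i : {i // (e i).isSome}, ((e i).map fun a => (1 / 2 : ℝ≥0∞) ^ len a).getD 0 =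
          ∑' i, ((e i).map fun a => (1 / 2 : ℝ≥0∞) ^ len a).getD 0 := by
        refine tsum_subtype_eq_of_support_subset
          (f := fun i => ((e i).map fun a => (1 / 2 : ℝ≥0∞) ^ len a).getD 0) fun i hi => ?_
        change (e i).isSome = true
        cases h : e i with
        | none => simp [h] at hi
        | some a => rfl
      rw [← hsub]
      refine le_trans ?_ hsum
      refine le_trans (le_of_eq ?_)
        (ENNReal.tsum_comp_le_tsum_of_injective hg fun a => (1 / 2 : ℝ≥0∞) ^ len a.1)
      refine tsum_congr fun i => ?_
      conv_lhs => rw [hget i]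
      rfl
    have h4 : ENNReal.ofReal (requestStart e len t : ℝ) ≤ 1 :=
      h2 ▸ (ENNReal.sum_le_tsum _).trans h3
    have h5 := ENNReal.ofReal_le_one.1 h4
    exact_mod_cast h5
  let M : List Bool →. List Bool := fun q =>
    (Nat.rfind fun t => Part.some (servesRequest e len q t)).bind
      fun t => ((e t).map out : Option (List Bool))
  have hM : ∀ q v, v ∈ M q ↔ ∃ t a, servesRequest e len q t = true ∧ e t = some a ∧ out a = v := by
    intro q v
    simp only [M, Part.mem_bind_iff, Part.mem_ofOption, Option.mem_def, Option.map_eq_some_iff]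
    constructor
    · rintro ⟨t, ht, a, ha, hv⟩
      exact ⟨t, a, (Part.mem_some_iff.1 (Nat.mem_rfind.1 ht).1).symm, ha, hv⟩
    · rintro ⟨t, a, ht, ha, hv⟩
      refine ⟨t, Nat.mem_rfind.2 ⟨Part.mem_some_iff.2 ht.symm, fun {m} hm =>
        Part.mem_some_iff.2 ?_⟩, a, ha, hv⟩
      by_contra hne
      have := eq_of_servesRequest (r := q) (t := m) (by simpa using Ne.symm hne) ht
        (List.prefix_refl q)
      omega
  refine ⟨M, ⟨?_, ?_⟩, fun a ha => ?_⟩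
  · refine Partrec.bind (Partrec.rfind hserves.to₂.partrec₂) (Computable.ofOption ?_)
    exact Computable.option_map_uncurried (f := fun r : List Bool × ℕ => e r.2)
      (g := fun r => out r.2) (by fun_prop) (by fun_prop)
  · intro q hq r hr hqr
    obtain ⟨v, hv⟩ := Part.dom_iff_mem.1 hq
    obtain ⟨v', hv'⟩ := Part.dom_iff_mem.1 hr
    obtain ⟨t, a, ht, ha, -⟩ := (hM _ _).1 hv
    obtain ⟨t', a', ht', ha', -⟩ := (hM _ _).1 hv'
    -- Comparable programs serve the same request, hence have the same length and coincide.
    have htt := eq_of_servesRequest ht ht' hqr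
    subst htt
    obtain ⟨b, hb, hbq, -⟩ := servesRequest_iff.1 ht
    obtain ⟨b', hb', hbr, -⟩ := servesRequest_iff.1 ht'
    rw [hb] at hb'
    cases hb'
    exact hqr.eq_of_length (hbq.trans hbr.symm)
  · obtain ⟨t, ht⟩ := (hpe a).1 ha
    obtain ⟨q, hq, hs⟩ := exists_servesRequest (len := len) ht (hle _)
    exact ⟨q, (hM _ _).2 ⟨t, a, hs, ht, rfl⟩, hq⟩

/-! ### Further closure properties of recursively enumerable predicates -/

namespace REPred

variable {α β : Type*} [Primcodable α] [Primcodable β]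

protected theorem or {p q : α → Prop} (hp : REPred p) (hq : REPred q) :
    REPred fun a => p a ∨ q a := by
  obtain ⟨f, hf, hfp⟩ := rePred_iff_exists_stage.1 hp
  obtain ⟨g, hg, hgq⟩ := rePred_iff_exists_stage.1 hq
  refine rePred_iff_exists_stage.2 ⟨fun r => f r || g r, by fun_prop, fun a => ?_⟩
  simp only [hfp, hgq, Bool.or_eq_true, exists_or]

theorem eq {f g : α → β} (hf : Computable f) (hg : Computable g) : REPred fun a => f a = g a := by
  classical
  exact of_decide (Computable.decide_eq hf hg)

theorem ne {f g : α → β} (hf : Computable f) (hg : Computable g) : REPred fun a => f a ≠ g a := by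
  classical
  refine of_decide ((Computable.decide_eq hf hg).bool_not.of_eq fun a => ?_)
  rw [← decide_not]

theorem nat_lt {f g : α → ℕ} (hf : Computable f) (hg : Computable g) :
    REPred fun a => f a < g a := of_decide (Computable.decide_natLt hf hg)

theorem rat_lt {f g : α → ℚ} (hf : Computable f) (hg : Computable g) :
    REPred fun a => f a < g a := of_decide (Computable.decide_ratLt hf hg)

end REPred

/-! ### Names of points -/

theorem initialWord_length {α : Type*} (σ : ℕ → α) (n : ℕ) : (initialWord σ n).length = n := by
  simp [initialWord]

theorem initialWord_getElem? {α : Type*} (σ : ℕ → α) {n i : ℕ} (hi : i < n) :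
    (initialWord σ n)[i]? = some (σ i) := by
  simp [initialWord, hi]

theorem initialWord_isPrefix {α : Type*} (σ : ℕ → α) {m n : ℕ} (h : m ≤ n) :
    initialWord σ m <+: initialWord σ n := by
  obtain ⟨k, rfl⟩ := Nat.exists_eq_add_of_le h
  rw [initialWord, initialWord, List.range_add, List.map_append]
  exact List.prefix_append _ _

theorem getElem?_eq_of_prefix_initialWord {α : Type*} {σ : ℕ → α} {u : List α} {n i : ℕ} {c : α}
    (h : u <+: initialWord σ n) (hc : u[i]? = some c) : c = σ i := by
  have hi : i < u.length := (List.getElem?_eq_some_iff.1 hc).1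
  have hin : i < n := by simpa [initialWord_length] using hi.trans_le h.length_le
  obtain ⟨z, hz⟩ := h
  have h1 : (initialWord σ n)[i]? = some c := by rw [← hz, List.getElem?_append_left hi, hc]
  rw [initialWord_getElem? σ hin] at h1
  exact (Option.some.inj h1).symm

section Metric

variable {X Y : Type*} [PseudoMetricSpace X] {s : ℕ → X}

theorem cauchyRep_dist_le {σ : ℕ → ℕ} {x : X} (h : cauchyRep s σ x) (n : ℕ) :
    dist (s (σ n)) x ≤ 2 * (1 / 2) ^ n := by
  have := dist_le_of_le_geometric_two_of_tendsto (C := 2) (f := fun n => s (σ n))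
    (fun n => (h.1 n).le.trans (by simp)) h.2 n
  simpa [div_eq_mul_inv] using this

/-- The conditions under which a word is the beginning of a name of the points of a ball about
its last entry. -/
def IsNamePrefix (s : ℕ → X) (u : List ℕ) : Prop :=
  0 < u.length ∧ ∀ i < u.length - 1,
    dist (s (u[i]?.getD 0)) (s (u[i + 1]?.getD 0)) < (1 / 2 : ℝ) ^ i

/-- The strict inequality leaves a slack `δ`; the entries after `u` are chosen within `δ` of `x`, so
that the step from `u` to them is short enough, and within `2^(-n-2)`, so that the later steps are.
-/
theorem exists_name_of_isNamePrefix (hs : DenseRange s) {u : List ℕ} (hu : IsNamePrefix s u) {x : X}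
    (hx : dist (s (u[u.length - 1]?.getD 0)) x < (1 / 2 : ℝ) ^ (u.length - 1)) :
    ∃ σ, cauchyRep s σ x ∧ initialWord σ u.length = u := by
  obtain ⟨hpos, hu⟩ := hu
  obtain ⟨δ, hδ⟩ : ∃ δ, δ = (1 / 2 : ℝ) ^ (u.length - 1) - dist (s (u[u.length - 1]?.getD 0)) x :=
    ⟨_, rfl⟩
  have hδ0 : 0 < δ := by linarith
  have hex : ∀ n : ℕ, ∃ k, dist x (s k) < min ((1 / 2 : ℝ) ^ (n + 2)) δ := fun n =>
    hs.exists_dist_lt x (lt_min (by positivity) hδ0)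
  choose τ hτ using hex
  have hτ1 : ∀ n, dist x (s (τ n)) < (1 / 2 : ℝ) ^ (n + 2) := fun n =>
    (hτ n).trans_le (min_le_left _ _)
  have hτ2 : ∀ n, dist x (s (τ n)) < δ := fun n => (hτ n).trans_le (min_le_right _ _)
  let σ : ℕ → ℕ := fun n => if n < u.length then u[n]?.getD 0 else τ n
  have h1 : ∀ n, n < u.length → σ n = u[n]?.getD 0 := fun n hn => if_pos hn
  have h2 : ∀ n, u.length ≤ n → σ n = τ n := fun n hn => if_neg (not_lt.2 hn)
  refine ⟨σ, ⟨fun n => ?_, ?_⟩, ?_⟩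
  · rcases lt_trichotomy (n + 1) u.length with h | h | h
    · rw [h1 n (by omega), h1 (n + 1) h]
      exact hu n (by omega)
    · rw [h1 n (by omega), h2 (n + 1) h.ge]
      have hn : u.length - 1 = n := by omega
      rw [hn] at hδ
      calc _ ≤ dist (s (u[n]?.getD 0)) x + dist x (s (τ (n + 1))) := dist_triangle _ _ _
        _ < dist (s (u[n]?.getD 0)) x + δ := by gcongr; exact hτ2 _
        _ = _ := by rw [hδ]; ring
    · rw [h2 n (by omega), h2 (n + 1) (by omega)]
      have := dist_triangle_left (s (τ n)) (s (τ (n + 1))) x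
      have ha := hτ1 n
      have hb := hτ1 (n + 1)
      have hp : (0 : ℝ) < (1 / 2) ^ n := by positivity
      rw [pow_add] at ha hb
      rw [pow_add] at hb
      norm_num at ha hb
      linarith
  · rw [tendsto_iff_dist_tendsto_zero]
    refine squeeze_zero' (Eventually.of_forall fun n => dist_nonneg)
      (g := fun n : ℕ => (1 / 2 : ℝ) ^ n) ?_
      (tendsto_pow_atTop_nhds_zero_of_lt_one (by norm_num) (by norm_num))
    filter_upwards [eventually_ge_atTop u.length] with n hn
    rw [h2 n hn, dist_comm]
    refine (hτ1 n).le.trans ?_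
    exact pow_le_pow_of_le_one (by norm_num) (by norm_num) (by omega)
  · refine List.ext_getElem? fun i => ?_
    by_cases hi : i < u.length
    · rw [initialWord_getElem? σ hi, h1 i hi]
      simp [hi]
    · rw [List.getElem?_eq_none (by rw [initialWord_length]; omega),
        List.getElem?_eq_none (by omega)]

/-- An arbitrary name only guarantees distance at most `2 * 2^(-n)`. The better bound places `x` in
the ball about the last entry on which the beginning of the name can be continued. -/
theorem exists_close_name (hs : DenseRange s) (x : X) :
    ∃ σ, cauchyRep s σ x ∧ ∀ n, dist (s (σ n)) x < (1 / 2 : ℝ) ^ n := by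
  have hex : ∀ n : ℕ, ∃ k, dist x (s k) < (1 / 2 : ℝ) ^ (n + 2) := fun n =>
    hs.exists_dist_lt x (by positivity)
  choose σ hσ using hex
  have hlt : ∀ n, dist (s (σ n)) x < (1 / 2 : ℝ) ^ n := fun n => by
    rw [dist_comm]
    exact (hσ n).trans_le (pow_le_pow_of_le_one (by norm_num) (by norm_num) (by omega))
  refine ⟨σ, ⟨fun n => ?_, ?_⟩, hlt⟩
  · have := dist_triangle_left (s (σ n)) (s (σ (n + 1))) x
    have ha := hσ n
    have hb := hσ (n + 1)
    have hp : (0 : ℝ) < (1 / 2) ^ n := by positivity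
    rw [pow_add] at ha hb
    rw [pow_add] at hb
    norm_num at ha hb
    linarith
  · rw [tendsto_iff_dist_tendsto_zero]
    exact squeeze_zero (fun n => dist_nonneg) (fun n => (hlt n).le)
      (tendsto_pow_atTop_nhds_zero_of_lt_one (by norm_num) (by norm_num))

theorem isNamePrefix_initialWord {σ : ℕ → ℕ} {x : X} (h : cauchyRep s σ x) {n : ℕ} (hn : 0 < n) :
    IsNamePrefix s (initialWord σ n) := by
  rw [IsNamePrefix, initialWord_length]
  refine ⟨hn, fun i hi => ?_⟩
  rw [initialWord_getElem? σ (by omega), initialWord_getElem? σ (by omega)]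
  exact h.1 i

end Metric

/-! ### Comparison of computable reals with rationals -/

/-- The `n`-th entry of a name has error at most `2 * 2^(-n)`. Adding this error gives upper bounds
that converge to the real, so every strict inequality is eventually witnessed. -/
theorem UniformlyConstructive.rePred_lt {x : ℕ → ℝ} (h : UniformlyConstructive realRep x) :
    REPred fun p : ℕ × ℚ => x p.1 < (p.2 : ℝ) := by
  obtain ⟨σ, hσ, hx⟩ := h
  have hσ' : Computable fun p : ℕ × ℕ => σ p.1 p.2 := hσ
  have hre : REPred fun r : (ℕ × ℚ) × ℕ =>
      ratNum (σ r.1.1 r.2) + 2 * (1 / 2) ^ r.2 < r.1.2 :=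
    REPred.rat_lt (by fun_prop) (by fun_prop)
  refine hre.projection.of_eq fun p => ?_
  have hb := cauchyRep_dist_le (hx p.1)
  have hlim := (hx p.1).2
  constructor
  · rintro ⟨n, hn⟩
    have h1 := (abs_le.1 (hb n)).1
    dsimp only at hn h1
    have hn' := (Rat.cast_lt (K := ℝ)).2 hn
    push_cast at hn'
    linarith
  · intro hlt
    have hz : Tendsto (fun n => (ratNum (σ p.1 n) : ℝ) + 2 * (1 / 2) ^ n) atTop
        (𝓝 (x p.1 + 2 * 0)) :=
      hlim.add ((tendsto_pow_atTop_nhds_zero_of_lt_one (by norm_num) (by norm_num)).const_mul 2)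
    obtain ⟨n, hn⟩ := (hz.eventually_lt_const (by simpa using hlt)).exists
    exact ⟨n, (Rat.cast_lt (K := ℝ)).1 (by push_cast; exact hn)⟩

theorem UniformlyConstructive.rePred_gt {x : ℕ → ℝ} (h : UniformlyConstructive realRep x) :
    REPred fun p : ℕ × ℚ => (p.2 : ℝ) < x p.1 := by
  obtain ⟨σ, hσ, hx⟩ := h
  have hσ' : Computable fun p : ℕ × ℕ => σ p.1 p.2 := hσ
  have hre : REPred fun r : (ℕ × ℚ) × ℕ =>
      r.1.2 < ratNum (σ r.1.1 r.2) - 2 * (1 / 2) ^ r.2 :=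
    REPred.rat_lt (by fun_prop) (by fun_prop)
  refine hre.projection.of_eq fun p => ?_
  have hb := cauchyRep_dist_le (hx p.1)
  have hlim := (hx p.1).2
  constructor
  · rintro ⟨n, hn⟩
    have h1 := (abs_le.1 (hb n)).2
    dsimp only at hn h1
    have hn' := (Rat.cast_lt (K := ℝ)).2 hn
    push_cast at hn'
    linarith
  · intro hlt
    have hz : Tendsto (fun n => (ratNum (σ p.1 n) : ℝ) - 2 * (1 / 2) ^ n) atTop
        (𝓝 (x p.1 - 2 * 0)) :=
      hlim.sub ((tendsto_pow_atTop_nhds_zero_of_lt_one (by norm_num) (by norm_num)).const_mul 2)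
    obtain ⟨n, hn⟩ := (hz.eventually_const_lt (by simpa using hlt)).exists
    exact ⟨n, (Rat.cast_lt (K := ℝ)).1 (by push_cast; exact hn)⟩

/-- The distances of the ideal points are uniformly upper semicomputable. -/
def SemidecidableDistLT {X : Type*} [PseudoMetricSpace X] (s : ℕ → X) : Prop :=
  REPred fun p : (ℕ × ℕ) × ℚ => dist (s p.1.1) (s p.1.2) < (p.2 : ℝ)

theorem IsComputableMetricSpace.semidecidableDistLT {X : Type*} [MetricSpace X] {s : ℕ → X}
    (h : IsComputableMetricSpace s) : SemidecidableDistLT s := by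
  refine (h.dist_computable.rePred_lt.comp
    (f := fun p : (ℕ × ℕ) × ℚ => (Nat.pair p.1.1 p.1.2, p.2)) (by fun_prop)).of_eq fun p => ?_
  simp

theorem IsComputableMetricSpace.rePred_lt_dist {X : Type*} [MetricSpace X] {s : ℕ → X}
    (h : IsComputableMetricSpace s) :
    REPred fun p : (ℕ × ℕ) × ℚ => (p.2 : ℝ) < dist (s p.1.1) (s p.1.2) := by
  refine (h.dist_computable.rePred_gt.comp
    (f := fun p : (ℕ × ℕ) × ℚ => (Nat.pair p.1.1 p.1.2, p.2)) (by fun_prop)).of_eq fun p => ?_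
  simp

/-! ### Recursively enumerable open sets -/

section Open

variable {X Y : Type*} [MetricSpace X] [MetricSpace Y] {sX : ℕ → X} {sY : ℕ → Y}

/-- The union of the ideal balls with numbers in `S`. -/
def ballUnion (s : ℕ → X) (S : ℕ → Prop) : Set X := {x | ∃ k, S k ∧ x ∈ idealBall s k}

theorem mem_idealBall {s : ℕ → X} {k : ℕ} {x : X} :
    x ∈ idealBall s k ↔ dist x (s k.unpair.1) < (posRatNum k.unpair.2 : ℝ) := Iff.rfl

theorem isOpen_ballUnion (s : ℕ → X) (S : ℕ → Prop) : IsOpen (ballUnion s S) := by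
  refine isOpen_iff_mem_nhds.2 fun x ⟨k, hk, hx⟩ => ?_
  exact mem_of_superset (Metric.isOpen_ball.mem_nhds hx) fun y hy => ⟨k, hk, hy⟩

theorem IsPi02.exists_rePred {s : ℕ → X} {D : Set X} (hD : IsPi02 s D) :
    ∃ S : ℕ × ℕ → Prop, REPred S ∧ ∀ x, x ∈ D ↔ ∀ n, x ∈ ballUnion s fun k => S (n, k) := by
  obtain ⟨U, ⟨σ, hσ, hU⟩, rfl⟩ := hD
  have hσ' : Computable fun p : ℕ × ℕ => σ p.1 p.2 := hσ
  have hre : REPred fun r : (ℕ × ℕ) × ℕ => σ r.1.1 r.2 = r.1.2 + 1 :=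
    REPred.eq (by fun_prop) (by fun_prop)
  refine ⟨_, hre.projection, fun x => ?_⟩
  rw [Set.mem_iInter]
  refine forall_congr' fun n => ?_
  rw [hU n]
  simp only [Set.iSup_eq_iUnion, Set.mem_iUnion, ballUnion]
  constructor
  · rintro ⟨m, k, h, hx⟩
    exact ⟨k, ⟨m, h⟩, hx⟩
  · rintro ⟨k, ⟨m, h⟩, hx⟩
    exact ⟨m, k, h, hx⟩

theorem IsPi02.measurableSet [MeasurableSpace X] [BorelSpace X] {s : ℕ → X} {D : Set X}
    (hD : IsPi02 s D) : MeasurableSet D := by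
  obtain ⟨S, -, hS⟩ := hD.exists_rePred
  have : D = ⋂ n, ballUnion s fun k => S (n, k) := Set.ext fun x => by simp [hS]
  rw [this]
  exact MeasurableSet.iInter fun n => (isOpen_ballUnion _ _).measurableSet

theorem rePred_isNamePrefix (hX : SemidecidableDistLT sX) : REPred (IsNamePrefix sX) := by
  refine (REPred.nat_lt (by fun_prop) (by fun_prop)).and (REPred.forall_lt
    (n := fun u : List ℕ => u.length - 1) (p := fun q : List ℕ × ℕ =>
      dist (sX (q.1[q.2]?.getD 0)) (sX (q.1[q.2 + 1]?.getD 0)) < (1 / 2 : ℝ) ^ q.2)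
    (by fun_prop) ?_)
  refine (hX.comp (f := fun q : List ℕ × ℕ => ((q.1[q.2]?.getD 0, q.1[q.2 + 1]?.getD 0),
    (1 / 2 : ℚ) ^ q.2)) (by fun_prop)).of_eq fun q => ?_
  push_cast
  rfl

/-- Preimages of ideal balls under a computable map are uniformly recursively enumerable open. -/
theorem ConstructiveOn.exists_rePred_preimage (hX : SemidecidableDistLT sX) (hs : DenseRange sX)
    (hY : SemidecidableDistLT sY) {f : X → Y} {D : Set X}
    (hf : ConstructiveOn (cauchyRep sX) (cauchyRep sY) f D) :
    ∃ R : ℕ × ℕ → Prop, REPred R ∧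
      ∀ k, ∀ x ∈ D, f x ∈ idealBall sY k ↔ x ∈ ballUnion sX fun j => R (k, j) := by
  obtain ⟨F, ⟨Φ, hΦ, hmono, hlim⟩, hF⟩ := hf
  -- A certificate for the source ball `j` is a name prefix `u`, with `j` the ball on which `u` can
  -- be continued, such that `Φ u` has at some place `n` an entry `c` whose `2 *
  -- 2^(-n)`-neighbourhood lies in the target ball.
  have hre : REPred fun r : (((ℕ × ℕ) × List ℕ) × ℕ) × ℕ =>
      (IsNamePrefix sX r.1.1.2 ∧
        (r.1.1.2[r.1.1.2.length - 1]?.getD 0 = r.1.1.1.2.unpair.1 ∧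
          posRatNum r.1.1.1.2.unpair.2 = (1 / 2) ^ (r.1.1.2.length - 1))) ∧
      ((Φ r.1.1.2)[r.1.2]? = some r.2 ∧ dist (sY r.2) (sY r.1.1.1.1.unpair.1) <
        ((posRatNum r.1.1.1.1.unpair.2 - 2 * (1 / 2) ^ r.1.2 : ℚ) : ℝ)) := by
    refine (((rePred_isNamePrefix hX).comp (by fun_prop)).and
      ((REPred.eq (by fun_prop) (by fun_prop)).and (REPred.eq (by fun_prop) (by fun_prop)))).and
      ((REPred.eq (by fun_prop) (by fun_prop)).and ?_)
    exact hY.comp (f := fun r : (((ℕ × ℕ) × List ℕ) × ℕ) × ℕ => ((r.2, r.1.1.1.1.unpair.1),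
      posRatNum r.1.1.1.1.unpair.2 - 2 * (1 / 2) ^ r.1.2)) (by fun_prop)
  refine ⟨_, hre.projection.projection.projection, fun k x hx => ?_⟩
  constructor
  · intro hfx
    obtain ⟨σ, hσ, hclose⟩ := exists_close_name hs x
    have hFσ := hF σ x hx hσ
    obtain ⟨h1, h2⟩ := hlim σ ⟨x, hx, hσ⟩
    rw [mem_idealBall] at hfx
    have hz : Tendsto (fun n => dist (sY (F σ n)) (sY k.unpair.1) + 2 * (1 / 2 : ℝ) ^ n) atTop
        (𝓝 (dist (f x) (sY k.unpair.1) + 2 * 0)) :=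
      (hFσ.2.dist tendsto_const_nhds).add
        ((tendsto_pow_atTop_nhds_zero_of_lt_one (by norm_num) (by norm_num)).const_mul 2)
    obtain ⟨n, hn⟩ := (hz.eventually_lt_const (by simpa using hfx)).exists
    obtain ⟨m, hm⟩ := h2 (n + 1)
    -- Lengthening the input to `m + 1` makes it nonempty, with last entry `σ m`.
    have hm1 : initialWord (F σ) (n + 1) <+: Φ (initialWord σ (m + 1)) :=
      hm.trans (hmono _ _ (initialWord_isPrefix σ (Nat.le_succ m)))
    obtain ⟨j, hj⟩ := exists_posRatNum_eq (q := (1 / 2) ^ m) (by positivity)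
    refine ⟨Nat.pair (σ m) j, ⟨initialWord σ (m + 1), n, F σ n,
      ⟨isNamePrefix_initialWord hσ (Nat.succ_pos m), ?_, ?_⟩, ?_, ?_⟩, ?_⟩
    · rw [initialWord_length, Nat.add_sub_cancel, initialWord_getElem? σ (Nat.lt_succ_self m),
        Nat.unpair_pair, Option.getD_some]
    · simpa [initialWord_length] using hj
    · obtain ⟨z, hz⟩ := hm1
      rw [← hz, List.getElem?_append_left (by rw [initialWord_length]; exact Nat.lt_succ_self n),
        initialWord_getElem? _ (Nat.lt_succ_self n)]
    · push_cast
      linarith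
    · rw [mem_idealBall, Nat.unpair_pair, dist_comm, hj]
      simpa using hclose m
  -- A point of the certified ball has a name that extends `u`; on it the operator must output `c`
  -- at place `n`.
  · rintro ⟨j, ⟨u, n, c, ⟨hu, hj1, hj2⟩, hc, hd⟩, hxj⟩
    simp only at hu hj1 hj2 hc hd
    rw [mem_idealBall, ← hj1, hj2, dist_comm] at hxj
    obtain ⟨σ, hσ, hσu⟩ := exists_name_of_isNamePrefix hs hu (x := x) (by simpa using hxj)
    obtain ⟨N, hN⟩ := (hlim σ ⟨x, hx, hσ⟩).1 u.length
    rw [hσu] at hN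
    have hcn : c = F σ n := getElem?_eq_of_prefix_initialWord (n := N) (hN ▸ List.prefix_refl _) hc
    have hle := cauchyRep_dist_le (hF σ x hx hσ) n
    rw [hcn] at hd
    push_cast at hd
    rw [mem_idealBall]
    have := dist_triangle_left (f x) (sY k.unpair.1) (sY (F σ n))
    linarith

end Open

/-! ### Lower semicomputability of the measure of finite unions of balls -/

theorem List.sum_map_eq_sum_range {β M : Type*} [AddCommMonoid M] (l : List β) (d : β) (f : β → M) :
    (l.map f).sum = ∑ i ∈ Finset.range l.length, f (l[i]?.getD d) := by
  induction l with
  | nil => simp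
  | cons b l ih =>
    rw [List.map_cons, List.sum_cons, ih, List.length_cons, Finset.sum_range_succ', add_comm]
    simp

@[fun_prop]
theorem Computable.weightList_comp {α : Type*} [Primcodable α] {f : α → ℕ} (hf : Computable f) :
    Computable fun a => weightList (f a) := by
  have h : Computable fun n : ℕ => Denumerable.ofNat ((ℕ × ℕ) × List (ℕ × ℕ)) n := by
    have h1 : Computable fun n : ℕ =>
        (Encodable.decode (α := (ℕ × ℕ) × List (ℕ × ℕ)) n).getD ((0, 0), []) := by fun_prop
    refine h1.of_eq fun n => ?_
    rw [Denumerable.decode_eq_ofNat]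
    rfl
  unfold weightList
  fun_prop

section ShrunkBalls

variable {X : Type*} [MetricSpace X]

/-- The union of the ideal balls with numbers in `l`, of radii diminished by `ε`. -/
def shrunkBalls (s : ℕ → X) (l : List ℕ) (ε : ℚ) : Set X :=
  {x | ∃ k ∈ l, dist x (s k.unpair.1) < ((posRatNum k.unpair.2 - ε : ℚ) : ℝ)}

theorem isOpen_shrunkBalls (s : ℕ → X) (l : List ℕ) (ε : ℚ) : IsOpen (shrunkBalls s l ε) := by
  refine isOpen_iff_mem_nhds.2 fun x ⟨k, hk, hx⟩ => ?_
  exact mem_of_superset (Metric.isOpen_ball.mem_nhds hx) fun y hy => ⟨k, hk, hy⟩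

theorem shrunkBalls_anti (s : ℕ → X) (l : List ℕ) : Antitone (shrunkBalls s l) := by
  rintro ε ε' h x ⟨k, hk, hx⟩
  refine ⟨k, hk, hx.trans_le ?_⟩
  gcongr

theorem thickening_shrunkBalls_subset (s : ℕ → X) (l : List ℕ) (δ ε : ℚ) :
    Metric.thickening (ε : ℝ) (shrunkBalls s l (δ + ε)) ⊆ shrunkBalls s l δ := by
  intro x hx
  obtain ⟨y, ⟨k, hk, hy⟩, hxy⟩ := Metric.mem_thickening_iff.1 hx
  refine ⟨k, hk, ?_⟩
  have := dist_triangle x y (s k.unpair.1)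
  push_cast at hy ⊢
  linarith

theorem iUnion_shrunkBalls (s : ℕ → X) (l : List ℕ) (δ : ℚ) {ε : ℕ → ℚ} (h0 : ∀ n, 0 ≤ ε n)
    (hε : Tendsto (fun n => (ε n : ℝ)) atTop (𝓝 0)) :
    ⋃ n, shrunkBalls s l (δ + ε n) = shrunkBalls s l δ := by
  refine Set.Subset.antisymm
    (Set.iUnion_subset fun n => shrunkBalls_anti s l (le_add_of_nonneg_right (h0 n))) ?_
  rintro x ⟨k, hk, hx⟩
  push_cast at hx
  obtain ⟨n, hn⟩ := (hε.eventually_lt_const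
    (show (0 : ℝ) < posRatNum k.unpair.2 - δ - dist x (s k.unpair.1) by linarith)).exists
  refine Set.mem_iUnion.2 ⟨n, k, hk, ?_⟩
  push_cast
  linarith

end ShrunkBalls

section IdealMeasure

theorem pointMasses_apply {X : Type*} [MeasurableSpace X] (s : ℕ → X) (l : List (ℕ × ℕ)) {G : Set X} (hG : MeasurableSet G) :
    pointMasses s l G = (l.map fun a => (a.2 + 1 : ℝ≥0∞) * G.indicator 1 (s a.1)).sum := by
  induction l with
  | nil => simp [pointMasses]
  | cons a l ih =>
    simp only [pointMasses, List.map_cons, List.sum_cons] at ih ⊢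
    rw [Measure.add_apply, ih, Measure.smul_apply, Measure.dirac_apply' _ hG, smul_eq_mul]

open Classical in
theorem idealMeasure_real_apply {X : Type*} [MeasurableSpace X] (s : ℕ → X) (n : ℕ) {G : Set X} (hG : MeasurableSet G) :
    (idealMeasure s n : Measure X).real G =
      (∑ i ∈ Finset.range (weightList n).length, if s ((weightList n)[i]?.getD (0, 0)).1 ∈ G
        then (((weightList n)[i]?.getD (0, 0)).2 + 1 : ℝ) else 0) /
      ∑ i ∈ Finset.range (weightList n).length,
        (((weightList n)[i]?.getD (0, 0)).2 + 1 : ℝ) := by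
  have h : (idealMeasure s n : Measure X) G =
      (totalWeight (weightList n))⁻¹ * pointMasses s (weightList n) G := by
    simp only [idealMeasure, ProbabilityMeasure.coe_mk, Measure.smul_apply, smul_eq_mul]
  have hcast : ∀ k : ℕ, ((k : ℝ≥0∞) + 1).toReal = (k : ℝ) + 1 := fun k => by
    rw [ENNReal.toReal_add (by simp) (by simp)]; simp
  have hW : (totalWeight (weightList n)).toReal = ∑ i ∈ Finset.range (weightList n).length,
      (((weightList n)[i]?.getD (0, 0)).2 + 1 : ℝ) := by
    rw [totalWeight, List.sum_map_eq_sum_range _ (0, 0), ENNReal.toReal_sum (fun i _ => by simp)]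
    exact Finset.sum_congr rfl fun i _ => hcast _
  have hN : (pointMasses s (weightList n) G).toReal = ∑ i ∈ Finset.range (weightList n).length,
      if s ((weightList n)[i]?.getD (0, 0)).1 ∈ G
        then (((weightList n)[i]?.getD (0, 0)).2 + 1 : ℝ) else 0 := by
    rw [pointMasses_apply s _ hG, List.sum_map_eq_sum_range _ (0, 0), ENNReal.toReal_sum]
    · refine Finset.sum_congr rfl fun i _ => ?_
      rw [ENNReal.toReal_mul, hcast, Set.indicator_apply]
      split_ifs <;> simp
    · intro i _
      refine ENNReal.mul_ne_top (by simp) ?_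
      rw [Set.indicator_apply]
      split_ifs <;> simp
  rw [measureReal_def, h, ENNReal.toReal_mul, ENNReal.toReal_inv, hW, hN, inv_mul_eq_div]

variable {X : Type*} [MetricSpace X] [MeasurableSpace X] [BorelSpace X] {s : ℕ → X}

/-- Membership of an atom in an open set is only semidecidable. A Boolean mask guesses atoms that
are then confirmed to lie in the set, and the weight of these is a lower bound, attained when the
mask is complete. -/
theorem rePred_lt_idealMeasure (hs : SemidecidableDistLT s) :
    REPred fun p : (ℕ × List ℕ) × ℚ × ℚ =>
      (p.2.1 : ℝ) < (idealMeasure s p.1.1 : Measure X).real (shrunkBalls s p.1.2 p.2.2) := by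
  have hmem : REPred fun r : ((((ℕ × List ℕ) × ℚ × ℚ) × List Bool) × ℕ) =>
      r.1.2[r.2]?.getD false = false ∨
        ∃ k ∈ r.1.1.1.2, dist (s ((weightList r.1.1.1.1)[r.2]?.getD (0, 0)).1) (s k.unpair.1) <
          ((posRatNum k.unpair.2 - r.1.1.2.2 : ℚ) : ℝ) := by
    refine (REPred.eq (by fun_prop) (by fun_prop)).or (REPred.exists_mem
      (l := fun r : ((((ℕ × List ℕ) × ℚ × ℚ) × List Bool) × ℕ) => r.1.1.1.2)
      (p := fun r => dist (s ((weightList r.1.1.1.1.1)[r.1.2]?.getD (0, 0)).1) (s r.2.unpair.1) <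
          ((posRatNum r.2.unpair.2 - r.1.1.1.2.2 : ℚ) : ℝ)) (by fun_prop) ?_)
    exact hs.comp (f := fun r : ((((ℕ × List ℕ) × ℚ × ℚ) × List Bool) × ℕ) × ℕ =>
      ((((weightList r.1.1.1.1.1)[r.1.2]?.getD (0, 0)).1, r.2.unpair.1),
        posRatNum r.2.unpair.2 - r.1.1.1.2.2)) (by fun_prop)
  have hall := REPred.forall_lt (n := fun q : ((ℕ × List ℕ) × ℚ × ℚ) × List Bool =>
    (weightList q.1.1.1).length) (by fun_prop) hmem
  have hW : Computable fun q : ((ℕ × List ℕ) × ℚ × ℚ) × List Bool =>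
      ∑ i ∈ Finset.range (weightList q.1.1.1).length,
        (((weightList q.1.1.1)[i]?.getD (0, 0)).2 + 1 : ℚ) :=
    Computable.sum_range (f := fun r : (((ℕ × List ℕ) × ℚ × ℚ) × List Bool) × ℕ =>
      (((weightList r.1.1.1.1)[r.2]?.getD (0, 0)).2 + 1 : ℚ)) (by fun_prop) (by fun_prop)
  have hN : Computable fun q : ((ℕ × List ℕ) × ℚ × ℚ) × List Bool =>
      ∑ i ∈ Finset.range (weightList q.1.1.1).length, (bif q.2[i]?.getD false then
        (((weightList q.1.1.1)[i]?.getD (0, 0)).2 + 1 : ℚ) else 0) :=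
    Computable.sum_range (f := fun r : (((ℕ × List ℕ) × ℚ × ℚ) × List Bool) × ℕ =>
      (bif r.1.2[r.2]?.getD false then
        (((weightList r.1.1.1.1)[r.2]?.getD (0, 0)).2 + 1 : ℚ) else 0)) (by fun_prop) (by fun_prop)
  have hlt := REPred.rat_lt (f := fun q : ((ℕ × List ℕ) × ℚ × ℚ) × List Bool =>
    q.1.2.1 * ∑ i ∈ Finset.range (weightList q.1.1.1).length,
      (((weightList q.1.1.1)[i]?.getD (0, 0)).2 + 1 : ℚ))
    (Computable.mul_comp (by fun_prop) hW) hN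
  refine (hall.and hlt).projection.of_eq ?_
  rintro ⟨⟨n, l⟩, q, ε⟩
  dsimp only
  classical
  rw [idealMeasure_real_apply s n (isOpen_shrunkBalls s l ε).measurableSet, lt_div_iff₀]
  · constructor
    · rintro ⟨mask, h1, h2⟩
      have h2' := (Rat.cast_lt (K := ℝ)).2 h2
      push_cast at h2'
      refine h2'.trans_le (Finset.sum_le_sum fun i hi => ?_)
      rcases h1 i (Finset.mem_range.1 hi) with h | h
      · rw [h]
        simp only [cond_false]
        split_ifs
        · simp; positivity
        · simp
      · rw [if_pos (show s _ ∈ shrunkBalls s l ε from h)]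
        cases mask[i]?.getD false
        · simp; positivity
        · simp
    · intro h
      obtain ⟨mask, hmask⟩ : ∃ mask : List Bool, ∀ i < (weightList n).length,
          mask[i]?.getD false =
            decide (s ((weightList n)[i]?.getD (0, 0)).1 ∈ shrunkBalls s l ε) :=
        ⟨(List.range (weightList n).length).map fun i =>
          decide (s ((weightList n)[i]?.getD (0, 0)).1 ∈ shrunkBalls s l ε), fun i hi => by
            rw [List.getElem?_map, List.getElem?_range hi]
            rfl⟩
      refine ⟨mask, fun i hi => ?_, ?_⟩
      · by_cases hm : s ((weightList n)[i]?.getD (0, 0)).1 ∈ shrunkBalls s l ε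
        · exact Or.inr hm
        · left
          rw [hmask i hi, decide_eq_false hm]
      · refine (Rat.cast_lt (K := ℝ)).1 ?_
        push_cast
        refine h.trans_le (Finset.sum_le_sum fun i hi => ?_)
        rw [hmask i (Finset.mem_range.1 hi)]
        by_cases hm : s ((weightList n)[i]?.getD (0, 0)).1 ∈ shrunkBalls s l ε
        · rw [if_pos hm, decide_eq_true hm]
          simp
        · rw [if_neg hm, decide_eq_false hm]
          simp
  · refine Finset.sum_pos (fun i _ => by positivity) ⟨0, ?_⟩
    simp [weightList]

theorem measureReal_le_of_dist_lt {μ ν : ProbabilityMeasure X} {ε : ℝ}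
    (h : dist (LevyProkhorov.ofMeasure μ) (LevyProkhorov.ofMeasure ν) < ε) {B : Set X}
    (hB : MeasurableSet B) :
    (μ : Measure X).real B ≤ (ν : Measure X).real (Metric.thickening ε B) + ε := by
  have hε : 0 < ε := dist_nonneg.trans_lt h
  have h1 : levyProkhorovEDist (μ : Measure X) (ν : Measure X) < ENNReal.ofReal ε :=
    (ENNReal.lt_ofReal_iff_toReal_lt (levyProkhorovEDist_ne_top _ _)).2 h
  have h2 := left_measure_le_of_levyProkhorovEDist_lt h1 hB
  rw [ENNReal.toReal_ofReal hε.le] at h2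
  have h3 := ENNReal.toReal_mono (by simp) h2
  rwa [ENNReal.toReal_add (by simp) (by simp), ENNReal.toReal_ofReal hε.le] at h3

/-- The measure of a finite union of balls is lower semicomputable. -/
theorem IsComputableMeasure.rePred_lt_measure (hs : SemidecidableDistLT s)
    {μ : ProbabilityMeasure X} (hμ : IsComputableMeasure s μ) :
    REPred fun p : List ℕ × ℚ × ℚ =>
      (p.2.1 : ℝ) < (μ : Measure X).real (shrunkBalls s p.1 p.2.2) := by
  obtain ⟨σ, hσ, hname⟩ := hμ
  -- The tolerance `4 * 2^(-n)` strictly exceeds the error `2 * 2^(-n)` of the name. Passing from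
  -- the ideal measure to `μ` costs this much in mass and, through the thickening, this much in
  -- radius.
  have hre := (rePred_lt_idealMeasure hs).comp (f := fun r : (List ℕ × ℚ × ℚ) × ℕ =>
    ((σ r.2, r.1.1), r.1.2.1 + 4 * (1 / 2) ^ r.2, r.1.2.2 + 4 * (1 / 2) ^ r.2)) (by fun_prop)
  refine hre.projection.of_eq ?_
  rintro ⟨l, q, δ⟩
  dsimp only
  have hdist : ∀ n, dist (LevyProkhorov.ofMeasure (idealMeasure s (σ n)))
      (LevyProkhorov.ofMeasure μ) < ((4 * (1 / 2) ^ n : ℚ) : ℝ) := fun n => by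
    refine (cauchyRep_dist_le hname n).trans_lt ?_
    push_cast
    have : (0 : ℝ) < (1 / 2) ^ n := by positivity
    linarith
  constructor
  · rintro ⟨n, hn⟩
    have h1 := measureReal_le_of_dist_lt (hdist n)
      (isOpen_shrunkBalls s l (δ + 4 * (1 / 2) ^ n)).measurableSet
    have h2 := measureReal_mono (μ := (μ : Measure X))
      (thickening_shrunkBalls_subset s l δ (4 * (1 / 2) ^ n))
    rw [Rat.cast_add] at hn
    linarith
  · intro h
    -- For the converse the tolerance is paid twice: once in passing from `μ` to the ideal measure
    -- and once in the searched condition. Both losses vanish in the limit.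
    have hε : Tendsto (fun n : ℕ => ((2 * (4 * (1 / 2) ^ n) : ℚ) : ℝ)) atTop (𝓝 0) := by
      have := (tendsto_pow_atTop_nhds_zero_of_lt_one (r := (1 / 2 : ℝ)) (by norm_num)
        (by norm_num)).const_mul 8
      rw [mul_zero] at this
      refine this.congr fun n => ?_
      push_cast
      ring
    have hmono : Monotone fun n : ℕ => shrunkBalls s l (δ + 2 * (4 * (1 / 2) ^ n)) := by
      intro m n hmn
      refine shrunkBalls_anti s l ?_
      have : (1 / 2 : ℚ) ^ n ≤ (1 / 2) ^ m :=
        pow_le_pow_of_le_one (by norm_num) (by norm_num) hmn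
      linarith
    have hlim := tendsto_measure_iUnion_atTop (μ := (μ : Measure X)) hmono
    rw [iUnion_shrunkBalls s l δ (fun n => by positivity) hε] at hlim
    have hlim' := ((ENNReal.tendsto_toReal (measure_ne_top _ _)).comp hlim).sub hε
    rw [sub_zero] at hlim'
    obtain ⟨n, hn⟩ := (hlim'.eventually_const_lt h).exists
    refine ⟨n, ?_⟩
    have h1 := measureReal_le_of_dist_lt (by rw [dist_comm]; exact hdist n)
      (isOpen_shrunkBalls s l (δ + 2 * (4 * (1 / 2) ^ n))).measurableSet
    have h2 := measureReal_mono (μ := (idealMeasure s (σ n) : Measure X))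
      (thickening_shrunkBalls_subset s l (δ + 4 * (1 / 2) ^ n) (4 * (1 / 2) ^ n))
    have h3 : δ + 4 * (1 / 2) ^ n + 4 * (1 / 2) ^ n = δ + 2 * (4 * (1 / 2 : ℚ) ^ n) := by ring
    rw [h3] at h2
    simp only [Function.comp_apply, measureReal_def] at hn h1 h2 ⊢
    push_cast at hn h1 h2 ⊢
    linarith

end IdealMeasure

/-! ### Randomness tests and recursively enumerable families of step functions -/

theorem computable_initialWord {σ : ℕ → ℕ} (hσ : Computable σ) : Computable (initialWord σ) :=
  Computable.map_range (α := ℕ) (n := fun n => n) (f := fun q => σ q.2) (by fun_prop) (by fun_prop)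

section Tests

variable {X : Type*} [MetricSpace X] [MeasurableSpace X] [BorelSpace X] {s : ℕ → X}
  {μ : ProbabilityMeasure X}

/-- The operator ignores the name of `μ` and prints a fixed recursive enumeration of `T`. -/
theorem isRandomnessTest_of_rePred {T : ℕ → Prop} (hT : REPred T)
    (hInt : ∫⁻ x, (⨆ (k : ℕ) (_ : T k), stepFunction s k) x ∂(μ : Measure X) ≤ 1) :
    IsRandomnessTest s μ (⨆ (k : ℕ) (_ : T k), stepFunction s k) := by
  obtain ⟨σ, hσ, hσT⟩ := (hT.comp (f := fun q : Unit × ℕ => q.2) (by fun_prop)).exists_enumeration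
  have hσ' : Computable (σ ()) := hσ.comp (Computable.const ()) Computable.id
  refine ⟨⟨fun _ => ⨆ (k : ℕ) (_ : T k), stepFunction s k, ⟨fun _ => σ (),
    ⟨fun u => initialWord (σ ()) u.length, ?_, ?_, ?_⟩, ?_⟩, rfl⟩, hInt⟩
  · exact (computable_initialWord hσ').comp (by fun_prop)
  · exact fun u v h => initialWord_isPrefix _ h.length_le
  · refine fun τ _ => ⟨fun m => ⟨m, ?_⟩, fun n => ⟨n, ?_⟩⟩
    · dsimp only
      rw [initialWord_length]
    · dsimp only
      rw [initialWord_length]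
  · intro τ x _ _
    change _ = ⨆ (n : ℕ) (k : ℕ) (_ : σ () n = k + 1), stepFunction s k
    rw [iSup_comm]
    refine iSup_congr fun k => ?_
    have := hσT () k
    dsimp only at this
    simp only [this, iSup_exists]

/-- Feeding a recursive name of `μ` to the operator removes the oracle. Monotonicity of the operator
is not needed: its outputs on the beginnings of this name exhaust the enumeration. -/
theorem IsRandomnessTest.exists_rePred {t : X → ℝ≥0∞} (ht : IsRandomnessTest s μ t)
    (hμ : IsComputableMeasure s μ) :
    ∃ T : ℕ → Prop, REPred T ∧ t = ⨆ (k : ℕ) (_ : T k), stepFunction s k := by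
  obtain ⟨⟨f, ⟨F, ⟨Φ, hΦ, -, hlim⟩, hF⟩, rfl⟩, -⟩ := ht
  obtain ⟨σ, hσ, hname⟩ := hμ
  have hmem := hlim σ ⟨_, rfl, hname⟩
  have hw := computable_initialWord hσ
  have hre : REPred fun r : (ℕ × ℕ) × ℕ => (Φ (initialWord σ r.1.2))[r.2]? = some (r.1.1 + 1) :=
    REPred.eq (by fun_prop) (by fun_prop)
  refine ⟨_, hre.projection.projection, ?_⟩
  have hrep : f _ = ⨆ (n : ℕ) (k : ℕ) (_ : F σ n = k + 1), stepFunction s k := hF σ _ rfl hname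
  rw [hrep, iSup_comm]
  refine iSup_congr fun k => ?_
  rw [← iSup_exists (p := fun n => F σ n = k + 1) (f := fun _ => stepFunction s k)]
  refine iSup_congr_Prop ?_ fun _ => rfl
  constructor
  · rintro ⟨n, hn⟩
    obtain ⟨m, z, hz⟩ := hmem.2 (n + 1)
    refine ⟨m, n, ?_⟩
    rw [← hz, List.getElem?_append_left (by rw [initialWord_length]; exact Nat.lt_succ_self n),
      initialWord_getElem? _ (Nat.lt_succ_self n), hn]
  · rintro ⟨m, n, h⟩
    obtain ⟨N, hN⟩ := hmem.1 m
    exact ⟨n, (getElem?_eq_of_prefix_initialWord (n := N) (hN ▸ List.prefix_refl _) h).symm⟩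

/-- A uniformly recursively enumerable family of open sets with computable weights, dominated by
a function of integral at most one, has bounded weights at a random point. -/
theorem IsRandom.exists_bound {α : Type*} [Primcodable α] {x : X} (hx : IsRandom s μ x)
    {R : α × ℕ → Prop} (hR : REPred R) {g : α → ℚ} (hg : Computable g) (hpos : ∀ a, 0 < g a)
    {h : X → ℝ≥0∞} (hInt : ∫⁻ y, h y ∂(μ : Measure X) ≤ 1)
    (hle : ∀ a, ∀ y ∈ ballUnion s (fun k => R (a, k)), ENNReal.ofReal (g a) ≤ h y) :
    ∃ M : ℝ≥0∞, M ≠ ∞ ∧ ∀ a, x ∈ ballUnion s (fun k => R (a, k)) → ENNReal.ofReal (g a) ≤ M := by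
  have hre : REPred fun r : ℕ × α => R (r.2, r.1.unpair.1) ∧ posRatNum r.1.unpair.2 = g r.2 :=
    (hR.comp (by fun_prop)).and (REPred.eq (by fun_prop) (by fun_prop))
  -- The supremum of the listed step functions lies below `h`, so it is a test although `h` need not
  -- be semicomputable. Its finite value at `x` is the bound.
  have htest := isRandomnessTest_of_rePred (s := s) (μ := μ) hre.projection <| by
    refine (lintegral_mono fun y => ?_).trans hInt
    simp only [iSup_apply]
    refine iSup_le fun k => iSup_le fun ⟨a, ha, hk⟩ => ?_
    by_cases hy : y ∈ idealBall s k.unpair.1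
    · rw [stepFunction, Set.indicator_of_mem hy, hk]
      exact hle a y ⟨_, ha, hy⟩
    · rw [stepFunction, Set.indicator_of_notMem hy]
      exact zero_le
  refine ⟨_, fun htop => hx {y | _ = ∞} ⟨_, htest, subset_rfl⟩ htop, fun a ⟨k, hk, hxk⟩ => ?_⟩
  obtain ⟨j, hj⟩ := exists_posRatNum_eq (hpos a)
  simp only [iSup_apply]
  refine le_iSup_of_le (Nat.pair k j) (le_iSup_of_le ⟨a, by simpa using hk, by simpa using hj⟩ ?_)
  rw [stepFunction, Nat.unpair_pair, Set.indicator_of_mem hxk, hj]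

/-- Random points lie in all recursively enumerable open sets of measure one. -/
theorem IsRandom.mem_ballUnion {x : X} (hx : IsRandom s μ x)
    (hX : IsComputableProbabilitySpace s μ) {S : ℕ → Prop} (hS : REPred S)
    (hfull : (μ : Measure X) (ballUnion s S) = 1) : x ∈ ballUnion s S := by
  by_contra hxS
  -- The open set is the increasing union of finite unions of its balls with radii diminished by
  -- `2^(-N)`, so one of these has measure close to one. Lower semicomputability lets a search find
  -- it.
  have hex : ∀ m : ℕ, ∃ b : List ℕ × ℕ, (∀ k ∈ b.1, S k) ∧ ((1 - (1 / 4) ^ (m + 1) : ℚ) : ℝ) <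
      (μ : Measure X).real (shrunkBalls s b.1 ((1 / 2) ^ b.2)) := by
    intro m
    classical
    have hmono : Monotone fun N : ℕ => shrunkBalls s ((List.range N).filter (S ·))
        ((1 / 2) ^ N) := by
      rintro M N hMN y ⟨k, hk, hy⟩
      simp only [List.mem_filter, List.mem_range, decide_eq_true_eq] at hk
      refine ⟨k, by simpa using ⟨hk.1.trans_le hMN, hk.2⟩, hy.trans_le ?_⟩
      have : (1 / 2 : ℚ) ^ N ≤ (1 / 2) ^ M := pow_le_pow_of_le_one (by norm_num) (by norm_num) hMN
      exact_mod_cast sub_le_sub_left this _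
    have hU : ⋃ N : ℕ, shrunkBalls s ((List.range N).filter (S ·)) ((1 / 2) ^ N) =
        ballUnion s S := by
      ext y
      simp only [Set.mem_iUnion]
      constructor
      · rintro ⟨N, k, hk, hy⟩
        refine ⟨k, by simpa using (List.mem_filter.1 hk).2, hy.trans_le ?_⟩
        have : (0 : ℚ) ≤ (1 / 2) ^ N := by positivity
        exact_mod_cast sub_le_self _ this
      · rintro ⟨k, hk, hy⟩
        rw [mem_idealBall] at hy
        have hlim := (tendsto_pow_atTop_nhds_zero_of_lt_one (r := (1 / 2 : ℝ)) (by norm_num)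
          (by norm_num)).eventually_lt_const (sub_pos.2 hy)
        obtain ⟨N, hN, hkN⟩ := (hlim.and (eventually_gt_atTop k)).exists
        refine ⟨N, k, by simpa using ⟨hkN, hk⟩, ?_⟩
        push_cast
        linarith
    have hlim := tendsto_measure_iUnion_atTop (μ := (μ : Measure X)) hmono
    rw [hU, hfull] at hlim
    have hlim' := (ENNReal.tendsto_toReal ENNReal.one_ne_top).comp hlim
    have hlt : ((1 - (1 / 4) ^ (m + 1) : ℚ) : ℝ) < (1 : ℝ≥0∞).toReal := by
      have : (0 : ℝ) < (1 / 4) ^ (m + 1) := by positivity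
      push_cast
      rw [ENNReal.toReal_one]
      linarith
    obtain ⟨N, hN⟩ := (hlim'.eventually_const_lt hlt).exists
    exact ⟨((List.range N).filter (S ·), N), fun k hk => by simpa using (List.mem_filter.1 hk).2,
      hN⟩
  have hre : REPred fun q : ℕ × List ℕ × ℕ => (∀ k ∈ q.2.1, S k) ∧
      ((1 - (1 / 4) ^ (q.1 + 1) : ℚ) : ℝ) <
        (μ : Measure X).real (shrunkBalls s q.2.1 ((1 / 2) ^ q.2.2)) :=
    (REPred.forall_mem (p := fun r : (ℕ × List ℕ × ℕ) × ℕ => S r.2) (by fun_prop)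
      (hS.comp (by fun_prop))).and
      ((hX.measure.rePred_lt_measure hX.space.semidecidableDistLT).comp
        (f := fun q : ℕ × List ℕ × ℕ => (q.2.1, 1 - (1 / 4) ^ (q.1 + 1), (1 / 2) ^ q.2.2))
        (by fun_prop))
  obtain ⟨b, hb, hspec⟩ := hre.exists_selector hex
  dsimp only at hspec
  -- The balls whose centre is farther from the centre of every chosen shrunk ball than the sum of
  -- the two radii. They miss the shrunk balls, and the condition is r.e. in any computable metric
  -- space; compactness plays no role.
  let R : ℕ × ℕ → Prop := fun q => ∀ k ∈ (b q.1).1,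
    ((posRatNum k.unpair.2 - (1 / 2) ^ (b q.1).2 + posRatNum q.2.unpair.2 : ℚ) : ℝ) <
      dist (s q.2.unpair.1) (s k.unpair.1)
  have hR : REPred R := by
    refine REPred.forall_mem (l := fun q : ℕ × ℕ => (b q.1).1) (p := fun r : (ℕ × ℕ) × ℕ =>
      ((posRatNum r.2.unpair.2 - (1 / 2) ^ (b r.1.1).2 + posRatNum r.1.2.unpair.2 : ℚ) : ℝ) <
        dist (s r.1.2.unpair.1) (s r.2.unpair.1)) (by fun_prop) ?_
    exact hX.space.rePred_lt_dist.comp (f := fun r : (ℕ × ℕ) × ℕ =>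
      ((r.1.2.unpair.1, r.2.unpair.1),
        posRatNum r.2.unpair.2 - (1 / 2) ^ (b r.1.1).2 + posRatNum r.1.2.unpair.2)) (by fun_prop)
  have hV : ∀ m, (μ : Measure X) (ballUnion s fun k => R (m, k)) ≤
      ENNReal.ofReal ((1 / 4) ^ (m + 1)) := by
    intro m
    have hdisj : (ballUnion s fun k => R (m, k)) ⊆
        (shrunkBalls s (b m).1 ((1 / 2) ^ (b m).2))ᶜ := by
      rintro y ⟨j, hj, hyj⟩ ⟨k, hk, hyk⟩
      have h1 := hj k hk
      rw [mem_idealBall] at hyj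
      have h2 := dist_triangle_left (s j.unpair.1) (s k.unpair.1) y
      push_cast at h1 hyk
      linarith
    refine (measure_mono hdisj).trans ?_
    rw [← ofReal_measureReal, probReal_compl_eq_one_sub (isOpen_shrunkBalls _ _ _).measurableSet]
    refine ENNReal.ofReal_le_ofReal ?_
    have := (hspec m).2
    push_cast at this
    linarith
  have hVx : ∀ m, x ∈ ballUnion s fun k => R (m, k) := by
    intro m
    -- A point outside the open set keeps a gap `2^(-N)` from the shrunk balls, which a ball of a
    -- quarter of that radius about a nearby ideal point does not use up.
    obtain ⟨j, hj⟩ := hX.space.dense.exists_dist_lt x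
      (show (0 : ℝ) < (1 / 2) ^ ((b m).2 + 2) by positivity)
    obtain ⟨i, hi⟩ := exists_posRatNum_eq (q := (1 / 2) ^ ((b m).2 + 2)) (by positivity)
    refine ⟨Nat.pair j i, fun k hk => ?_, ?_⟩
    · have h1 : ¬ dist x (s k.unpair.1) < (posRatNum k.unpair.2 : ℝ) := fun h =>
        hxS ⟨k, (hspec m).1 k hk, h⟩
      have h2 := dist_triangle x (s j) (s k.unpair.1)
      have h3 : (0 : ℝ) < (1 / 2) ^ (b m).2 := by positivity
      simp only [Nat.unpair_pair, hi]
      push_cast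
      rw [pow_add] at hj ⊢
      norm_num at hj ⊢
      linarith
    · rw [mem_idealBall, Nat.unpair_pair, hi]
      push_cast
      exact hj
  obtain ⟨M, hM, hbound⟩ := hx.exists_bound hR (g := fun m => 2 ^ m) (by fun_prop)
    (fun m => by positivity)
    -- Weights `2^m` against measures at most `4^(-m-1)` give an integral at most `∑ 2^(-m-1) = 1`,
    -- yet they are unbounded at a point lying in all the sets.
    (h := fun y => ∑' m : ℕ, (ballUnion s fun k => R (m, k)).indicator (fun _ => 2 ^ m) y) (by
      rw [lintegral_tsum fun m => (measurable_const.indicator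
        (isOpen_ballUnion _ _).measurableSet).aemeasurable]
      have hterm : ∀ m : ℕ, ∫⁻ y, (ballUnion s fun k => R (m, k)).indicator (fun _ => 2 ^ m) y
          ∂(μ : Measure X) ≤ 2⁻¹ ^ (m + 1) := by
        intro m
        rw [lintegral_indicator_const (isOpen_ballUnion _ _).measurableSet]
        refine (mul_le_mul_right (hV m) _).trans ?_
        have h2 : (2 : ℝ≥0∞) = ENNReal.ofReal 2 := by simp
        rw [h2, ← ENNReal.ofReal_inv_of_pos (by norm_num), ← ENNReal.ofReal_pow (by norm_num),
          ← ENNReal.ofReal_pow (by norm_num), ← ENNReal.ofReal_mul (by positivity)]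
        refine ENNReal.ofReal_le_ofReal ?_
        have h4 : (1 / 4 : ℝ) ^ (m + 1) = 2⁻¹ ^ (m + 1) * 2⁻¹ ^ (m + 1) := by
          rw [← mul_pow]; norm_num
        have h5 : (2 : ℝ) ^ m * 2⁻¹ ^ (m + 1) = 2⁻¹ := by
          rw [pow_succ, ← mul_assoc, ← mul_pow]; norm_num
        rw [h4, ← mul_assoc, h5]
        have : (0 : ℝ) < 2⁻¹ ^ (m + 1) := by positivity
        linarith
      refine (ENNReal.tsum_le_tsum hterm).trans ?_
      rw [ENNReal.tsum_geometric_add_one, ENNReal.one_sub_inv_two, inv_inv,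
        ENNReal.inv_mul_cancel (by simp) (by simp)])
    (fun m y hy => by
      refine le_trans ?_ (ENNReal.le_tsum m)
      rw [Set.indicator_of_mem hy]
      push_cast
      rw [ENNReal.ofReal_pow (by norm_num)]
      simp)
  obtain ⟨n, hn⟩ := ENNReal.exists_nat_gt hM
  have h1 := hbound n (hVx n)
  push_cast at h1
  rw [ENNReal.ofReal_pow (by norm_num), ENNReal.ofReal_ofNat] at h1
  have h2 : (n : ℝ≥0∞) ≤ 2 ^ n := by exact_mod_cast Nat.lt_two_pow_self.le
  exact absurd (hn.trans_le (h2.trans h1)) (lt_irrefl _)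

end Tests

/-! ### Words and cylinders -/

/-- The sequences that begin with `w`. -/
def wordCylinder (w : List Bool) : Set (ℕ → Bool) := {ω | initialWord ω w.length = w}

theorem initialWord_eq_iff {α : Type*} {σ τ : ℕ → α} {n : ℕ} :
    initialWord σ n = initialWord τ n ↔ ∀ i < n, σ i = τ i := by
  simp [initialWord, List.map_inj_left]

theorem initialWord_take {α : Type*} (σ : ℕ → α) {i n : ℕ} (h : i ≤ n) :
    (initialWord σ n).take i = initialWord σ i := by
  rw [initialWord, initialWord, ← List.map_take, List.take_range, min_eq_left h]

theorem mem_wordCylinder_initialWord {ω ω' : ℕ → Bool} {n : ℕ} :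
    ω ∈ wordCylinder (initialWord ω' n) ↔ ∀ i < n, ω i = ω' i := by
  change initialWord ω (initialWord ω' n).length = _ ↔ _
  rw [initialWord_length, initialWord_eq_iff]

theorem cylinder_eq_wordCylinder (ω : ℕ → Bool) (n : ℕ) :
    PiNat.cylinder ω n = wordCylinder (initialWord ω n) := by
  ext ω'
  rw [mem_wordCylinder_initialWord]
  rfl

theorem mem_wordCylinder_iff {ω : ℕ → Bool} {w : List Bool} :
    ω ∈ wordCylinder w ↔ ∀ i < w.length, w[i]?.getD false = ω i := by
  constructor
  · intro h i hi
    have h' : initialWord ω w.length = w := h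
    rw [← h', initialWord_getElem? ω hi]
    rfl
  · intro h
    refine List.ext_getElem? fun i => ?_
    by_cases hi : i < w.length
    · rw [initialWord_getElem? ω hi, ← h i hi]
      simp [hi]
    · rw [List.getElem?_eq_none (by rw [initialWord_length]; omega),
        List.getElem?_eq_none (by omega)]

theorem measurableSet_wordCylinder (w : List Bool) : MeasurableSet (wordCylinder w) := by
  have : wordCylinder w = ⋂ i : Fin w.length, (fun ω : ℕ → Bool => ω i) ⁻¹' {w[(i : ℕ)]?.getD false} := by
    ext ω
    rw [mem_wordCylinder_iff]
    simp only [Set.mem_iInter, Set.mem_preimage, Set.mem_singleton_iff]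
    exact ⟨fun h i => (h i i.2).symm, fun h i hi => (h ⟨i, hi⟩).symm⟩
  rw [this]
  exact MeasurableSet.iInter fun i => measurable_pi_apply _ (measurableSet_singleton _)

/-- Two sequences, or words, with a common beginning are comparable. -/
theorem prefix_or_prefix_of_mem_wordCylinder {ω : ℕ → Bool} {v w : List Bool}
    (hv : ω ∈ wordCylinder v) (hw : ω ∈ wordCylinder w) : v <+: w ∨ w <+: v := by
  have hv' : initialWord ω v.length = v := hv
  have hw' : initialWord ω w.length = w := hw
  rcases le_total v.length w.length with h | h
  · exact Or.inl (hv' ▸ hw' ▸ initialWord_isPrefix ω h)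
  · exact Or.inr (hv' ▸ hw' ▸ initialWord_isPrefix ω h)

/-! ### The Kraft inequality -/

/-- The first factors of two factorizations are prefixes of the same word, hence comparable, hence
equal. The empty word must be excluded, since it can be inserted anywhere. -/
theorem uniquelyDecodable_of_prefixFree {S : Set (List Bool)} (hnil : [] ∉ S)
    (hS : ∀ p ∈ S, ∀ q ∈ S, p <+: q → p = q) : InformationTheory.UniquelyDecodable S := by
  intro l
  induction l with
  | nil =>
    intro l' _ h' heq
    cases l' with
    | nil => rfl
    | cons b l' =>
      simp only [List.flatten_nil, List.flatten_cons, List.nil_eq, List.append_eq_nil_iff] at heq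
      exact (hnil (heq.1 ▸ h' b (by simp))).elim
  | cons a l ih =>
    intro l' h h' heq
    cases l' with
    | nil =>
      simp only [List.flatten_nil, List.flatten_cons, List.append_eq_nil_iff] at heq
      exact (hnil (heq.1 ▸ h a (by simp))).elim
    | cons b l' =>
      simp only [List.flatten_cons] at heq
      have ha := h a (by simp)
      have hb := h' b (by simp)
      have hab : a = b := by
        rcases List.prefix_or_prefix_of_prefix (List.prefix_append a l.flatten)
          (heq ▸ List.prefix_append b l'.flatten) with hp | hp
        · exact hS a ha b hb hp
        · exact (hS b hb a ha hp).symm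
      subst hab
      rw [List.append_cancel_left_eq] at heq
      rw [ih l' (fun w hw => h w (by simp [hw])) (fun w hw => h' w (by simp [hw])) heq]

theorem tsum_two_pow_neg_length_le_one {S : Set (List Bool)}
    (hS : ∀ p ∈ S, ∀ q ∈ S, p <+: q → p = q) : ∑' p : S, (1 / 2 : ℝ≥0∞) ^ p.1.length ≤ 1 := by
  -- The empty word is a prefix of every word, so it is alone in a prefix-free set; otherwise the
  -- finite Kraft-McMillan inequality bounds all finite partial sums.
  by_cases hnil : [] ∈ S
  · have : S = {[]} := by
      ext p
      exact ⟨fun hp => (hS _ hnil p hp ⟨p, List.nil_append p⟩).symm, fun hp => hp ▸ hnil⟩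
    subst this
    rw [tsum_singleton ([] : List Bool) fun p => (1 / 2 : ℝ≥0∞) ^ p.length]
    simp
  · rw [ENNReal.tsum_eq_iSup_sum]
    refine iSup_le fun F => ?_
    classical
    have hsub : ∀ p ∈ F.map (Function.Embedding.subtype _), p ∈ S := fun p hp => by
      obtain ⟨q, -, rfl⟩ := Finset.mem_map.1 hp
      exact q.2
    have hK := InformationTheory.kraft_mcmillan_inequality
      (S := F.map (Function.Embedding.subtype _))
      (uniquelyDecodable_of_prefixFree (fun h => hnil (hsub _ h))
        fun p hp q hq => hS p (hsub p hp) q (hsub q hq))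
    rw [Finset.sum_map] at hK
    have hE := ENNReal.ofReal_le_ofReal hK
    rw [ENNReal.ofReal_sum_of_nonneg fun i _ => by positivity, ENNReal.ofReal_one] at hE
    refine le_trans (le_of_eq (Finset.sum_congr rfl fun p _ => ?_)) hE
    rw [ENNReal.ofReal_pow (by positivity)]
    simp [ENNReal.ofReal_inv_of_pos]

/-! ### Cantor space as a computable metric space -/

@[fun_prop]
theorem Computable.testBit_comp {α : Type*} [Primcodable α] {f g : α → ℕ} (hf : Computable f)
    (hg : Computable g) : Computable fun a => (f a).testBit (g a) := by
  have h : Computable fun p : ℕ × ℕ => p.1.testBit p.2 := by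
    refine (Computable.decide_eq (f := fun p : ℕ × ℕ => p.1 / 2 ^ p.2 % 2) (g := fun _ => 1)
      (by fun_prop) (by fun_prop)).of_eq fun p => ?_
    rw [Nat.testBit_eq_decide_div_mod_eq]
  exact h.comp (hf.pair hg)

theorem cantor_dist_le_iff {ω ω' : ℕ → Bool} {n : ℕ} :
    dist ω ω' ≤ (1 / 2 : ℝ) ^ n ↔ ∀ i < n, ω i = ω' i :=
  (PiNat.mem_cylinder_iff_dist_le (E := fun _ => Bool)).symm

theorem cantor_dist_lt_iff {ω ω' : ℕ → Bool} {q : ℝ} :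
    dist ω ω' < q ↔ ∃ n : ℕ, (1 / 2 : ℝ) ^ n < q ∧ ∀ i < n, ω i = ω' i := by
  constructor
  · intro h
    by_cases hne : ω = ω'
    · subst hne
      rw [dist_self] at h
      obtain ⟨n, hn⟩ := exists_pow_lt_of_lt_one h (show (1 / 2 : ℝ) < 1 by norm_num)
      exact ⟨n, hn, fun _ _ => rfl⟩
    · have hd : dist ω ω' = (1 / 2 : ℝ) ^ PiNat.firstDiff ω ω' := PiNat.dist_eq_of_ne hne
      exact ⟨PiNat.firstDiff ω ω', hd ▸ h, cantor_dist_le_iff.1 hd.le⟩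
  · rintro ⟨n, hn, h⟩
    exact (cantor_dist_le_iff.2 h).trans_lt hn

theorem semidecidableDistLT_cantorIdeal : SemidecidableDistLT cantorIdeal := by
  have h : REPred fun r : ((ℕ × ℕ) × ℚ) × ℕ => (1 / 2) ^ r.2 < r.1.2 ∧
      ∀ i < r.2, r.1.1.1.testBit i = r.1.1.2.testBit i :=
    (REPred.rat_lt (by fun_prop) (by fun_prop)).and (REPred.forall_lt
      (p := fun r : (((ℕ × ℕ) × ℚ) × ℕ) × ℕ => r.1.1.1.1.testBit r.2 = r.1.1.1.2.testBit r.2)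
      (by fun_prop) (REPred.eq (by fun_prop) (by fun_prop)))
  refine h.projection.of_eq fun p => ?_
  rw [cantor_dist_lt_iff]
  refine exists_congr fun n => and_congr ?_ Iff.rfl
  rw [← Rat.cast_lt (K := ℝ)]
  push_cast
  rfl

theorem exists_cantorIdeal_mem (w : List Bool) : ∃ n, cantorIdeal n ∈ wordCylinder w := by
  refine ⟨Nat.ofBits fun i : Fin w.length => w[(i : ℕ)], mem_wordCylinder_iff.2 fun i hi => ?_⟩
  rw [cantorIdeal, Nat.testBit_ofBits_lt _ _ hi]
  simp [hi]

theorem denseRange_cantorIdeal : DenseRange cantorIdeal := by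
  refine Metric.denseRange_iff.2 fun ω r hr => ?_
  obtain ⟨n, hn⟩ := exists_pow_lt_of_lt_one hr (show (1 / 2 : ℝ) < 1 by norm_num)
  obtain ⟨k, hk⟩ := exists_cantorIdeal_mem (initialWord ω n)
  refine ⟨k, cantor_dist_lt_iff.2 ⟨n, hn, fun i hi => ?_⟩⟩
  exact (mem_wordCylinder_initialWord.1 hk i hi).symm

/-- Cylinders are ideal balls, uniformly computably. -/
theorem exists_cylinder_code : ∃ code : List Bool → ℕ, Computable code ∧
    ∀ w, idealBall cantorIdeal (code w) = wordCylinder w := by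
  -- Nonzero distances are powers of one half, so the open ball of radius `2 * 2^(-n)` is the closed
  -- ball of radius `2^(-n)`, that is, a cylinder of length `n`.
  have hre : REPred fun q : List Bool × ℕ =>
      (∀ i < q.1.length, q.1[i]?.getD false = q.2.unpair.1.testBit i) ∧
        posRatNum q.2.unpair.2 = 2 * (1 / 2) ^ q.1.length :=
    (REPred.forall_lt (p := fun r : (List Bool × ℕ) × ℕ =>
      r.1.1[r.2]?.getD false = r.1.2.unpair.1.testBit r.2) (by fun_prop)
      (REPred.eq (by fun_prop) (by fun_prop))).and (REPred.eq (by fun_prop) (by fun_prop))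
  obtain ⟨code, hcode, hspec⟩ := hre.exists_selector fun w => by
    obtain ⟨n, hn⟩ := exists_cantorIdeal_mem w
    obtain ⟨j, hj⟩ := exists_posRatNum_eq (q := 2 * (1 / 2) ^ w.length) (by positivity)
    exact ⟨Nat.pair n j, by simpa [cantorIdeal] using mem_wordCylinder_iff.1 hn,
      by simpa using hj⟩
  refine ⟨code, hcode, fun w => ?_⟩
  obtain ⟨h1, h2⟩ := hspec w
  dsimp only at h1 h2
  ext ω
  have hc : ω ∈ wordCylinder w ↔ ∀ i < w.length, ω i = cantorIdeal (code w).unpair.1 i := by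
    rw [mem_wordCylinder_iff]
    refine forall₂_congr fun i hi => ?_
    rw [h1 i hi, eq_comm]
    rfl
  rw [hc, mem_idealBall, h2, cantor_dist_lt_iff]
  push_cast
  constructor
  · rintro ⟨n, hn, h⟩ i hi
    refine h i (hi.trans_le ?_)
    by_contra hlt
    have h3 : (1 / 2 : ℝ) ^ (w.length - 1) ≤ (1 / 2) ^ n :=
      pow_le_pow_of_le_one (by norm_num) (by norm_num) (by omega)
    have h4 : (2 : ℝ) * (1 / 2) ^ w.length = (1 / 2) ^ (w.length - 1) := by
      obtain ⟨m, hm⟩ : ∃ m, w.length = m + 1 := ⟨w.length - 1, by omega⟩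
      rw [hm, pow_succ, Nat.add_sub_cancel]
      ring
    linarith
  · intro h
    refine ⟨w.length, ?_, h⟩
    have : (0 : ℝ) < (1 / 2) ^ w.length := by positivity
    linarith

section

variable {α : Type*} [Primcodable α]

/-- Recursively enumerable open sets of Cantor space are generated by recursively enumerable sets
of words. -/
theorem exists_rePred_words {R : α × ℕ → Prop} (hR : REPred R) :
    ∃ Q : α × List Bool → Prop, REPred Q ∧ ∀ a ω,
      ω ∈ ballUnion cantorIdeal (fun k => R (a, k)) ↔ ∃ n, Q (a, initialWord ω n) := by
  -- A word is accepted if it agrees with the centre of a listed ball of radius greater than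
  -- `2^(-|w|)`; its cylinder then lies in the ball.
  have hre : REPred fun r : (α × List Bool) × ℕ => R (r.1.1, r.2) ∧
      ((1 / 2) ^ r.1.2.length < posRatNum r.2.unpair.2 ∧
        ∀ i < r.1.2.length, r.1.2[i]?.getD false = r.2.unpair.1.testBit i) :=
    (hR.comp (by fun_prop)).and ((REPred.rat_lt (by fun_prop) (by fun_prop)).and
      (REPred.forall_lt (p := fun r : ((α × List Bool) × ℕ) × ℕ =>
        r.1.1.2[r.2]?.getD false = r.1.2.unpair.1.testBit r.2) (by fun_prop)
        (REPred.eq (by fun_prop) (by fun_prop))))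
  refine ⟨_, hre.projection, fun a ω => ?_⟩
  dsimp only
  constructor
  · rintro ⟨k, hk, hω⟩
    rw [mem_idealBall, cantor_dist_lt_iff] at hω
    obtain ⟨n, hn, h⟩ := hω
    refine ⟨n, k, hk, ?_, fun i hi => ?_⟩
    · rw [initialWord_length, ← Rat.cast_lt (K := ℝ)]
      push_cast
      exact hn
    · rw [initialWord_length] at hi
      rw [initialWord_getElem? ω hi]
      exact h i hi
  · rintro ⟨n, k, hk, hn, h⟩
    refine ⟨k, hk, ?_⟩
    rw [mem_idealBall, cantor_dist_lt_iff]
    rw [initialWord_length] at hn h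
    refine ⟨n, ?_, fun i hi => ?_⟩
    · rw [← Rat.cast_lt (K := ℝ)] at hn
      push_cast at hn
      exact hn
    · have := h i hi
      rw [initialWord_getElem? ω hi] at this
      exact this

/-- A recursively enumerable set of words generates the same open set as a prefix-free one. -/
theorem exists_prefixFree_of_rePred {Q : α × List Bool → Prop} (hQ : REPred Q) :
    ∃ P : α × List Bool → Prop, REPred P ∧
      (∀ a v w, P (a, v) → P (a, w) → v <+: w → v = w) ∧
      ∀ a (ω : ℕ → Bool), (∃ n, Q (a, initialWord ω n)) ↔ ∃ n, P (a, initialWord ω n) := by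
  obtain ⟨f, hf, hfQ⟩ := rePred_iff_exists_stage.1 hQ
  -- `A` holds if some prefix of `w` is confirmed to be in `Q` within `|w|` stages. This is
  -- decidable and inherited by extensions, so its minimal words form a prefix-free r.e. set.
  let A : α × List Bool → Bool := fun q => !decide (∀ i < q.2.length + 1,
    decide (∀ j < q.2.length + 1, (!f ((q.1, q.2.take i), j)) = true) = true)
  have hA : ∀ a w, A (a, w) = true ↔ ∃ i ≤ w.length, ∃ j ≤ w.length,
      f ((a, w.take i), j) = true := by
    intro a w
    simp [A]
  have hAc : Computable A := by
    have h1 : Computable fun r : (α × List Bool) × ℕ =>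
        decide (∀ j < r.1.2.length + 1, (!f ((r.1.1, r.1.2.take r.2), j)) = true) :=
      Computable.decide_forall_lt (f := fun t : ((α × List Bool) × ℕ) × ℕ =>
        !f ((t.1.1.1, t.1.1.2.take t.1.2), t.2)) (by fun_prop) (by fun_prop)
    have h2 : Computable fun q : α × List Bool => decide (∀ i < q.2.length + 1,
        decide (∀ j < q.2.length + 1, (!f ((q.1, q.2.take i), j)) = true) = true) :=
      Computable.decide_forall_lt (f := fun r : (α × List Bool) × ℕ =>
        decide (∀ j < r.1.2.length + 1, (!f ((r.1.1, r.1.2.take r.2), j)) = true))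
        (by fun_prop) h1
    exact h2.bool_not
  refine ⟨fun q => A q = true ∧ ∀ i < q.2.length, (!A (q.1, q.2.take i)) = true, ?_, ?_, ?_⟩
  · exact (REPred.of_bool hAc).and (REPred.forall_lt
      (p := fun r : (α × List Bool) × ℕ => (!A (r.1.1, r.1.2.take r.2)) = true) (by fun_prop)
      (REPred.of_bool (by fun_prop)))
  · rintro a v w ⟨hv, -⟩ ⟨-, hw⟩ hvw
    by_contra hne
    have hlt : v.length < w.length := lt_of_le_of_ne hvw.length_le fun h =>
      hne (hvw.eq_of_length h)
    have := hw v.length hlt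
    dsimp only at this
    rw [← List.prefix_iff_eq_take.1 hvw, hv] at this
    simp at this
  · intro a ω
    constructor
    · rintro ⟨n, hn⟩
      obtain ⟨j, hj⟩ := (hfQ _).1 hn
      have hex : ∃ N, A (a, initialWord ω N) = true := by
        refine ⟨max n j, (hA _ _).2 ⟨n, ?_, j, ?_, ?_⟩⟩
        · rw [initialWord_length]; exact le_max_left _ _
        · rw [initialWord_length]; exact le_max_right _ _
        · rw [initialWord_take ω (le_max_left _ _), hj]
      classical
      refine ⟨Nat.find hex, Nat.find_spec hex, fun i hi => ?_⟩
      dsimp only at hi ⊢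
      rw [initialWord_length] at hi
      rw [initialWord_take ω hi.le]
      simpa using Nat.find_min hex hi
    · rintro ⟨n, hn, -⟩
      obtain ⟨i, hi, j, -, hj⟩ := (hA _ _).1 hn
      rw [initialWord_length] at hi
      rw [initialWord_take ω hi] at hj
      exact ⟨i, (hfQ _).2 ⟨j, hj⟩⟩

end

/-! ### Computability of the measure of cylinders -/

section

variable {ν : ProbabilityMeasure (ℕ → Bool)}

theorem IsComputableMeasure.rePred_lt_cylinder (hν : IsComputableMeasure cantorIdeal ν) :
    REPred fun p : List Bool × ℚ => (p.2 : ℝ) < (ν : Measure (ℕ → Bool)).real (wordCylinder p.1) := by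
  obtain ⟨code, hcode, hball⟩ := exists_cylinder_code
  refine ((hν.rePred_lt_measure semidecidableDistLT_cantorIdeal).comp
    (f := fun p : List Bool × ℚ => ([code p.1], p.2, 0)) (by fun_prop)).of_eq fun p => ?_
  have : shrunkBalls cantorIdeal [code p.1] 0 = wordCylinder p.1 := by
    rw [← hball]
    ext ω
    simp [shrunkBalls, mem_idealBall]
  rw [this]

/-- The complement of a cylinder is the finite union of the other cylinders of the same length, so a
lower bound on its measure is an upper bound here. Any list of such words is sound, and the full
list is sufficient. -/
theorem IsComputableMeasure.rePred_cylinder_lt (hν : IsComputableMeasure cantorIdeal ν) :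
    REPred fun p : List Bool × ℚ => (ν : Measure (ℕ → Bool)).real (wordCylinder p.1) < (p.2 : ℝ) := by
  obtain ⟨code, hcode, hball⟩ := exists_cylinder_code
  have hmem : REPred fun r : ((List Bool × ℚ) × List ℕ) × ℕ =>
      ∃ v : List Bool, v.length = r.1.1.1.length ∧ (v ≠ r.1.1.1 ∧ r.2 = code v) :=
    REPred.projection (p := fun t : (((List Bool × ℚ) × List ℕ) × ℕ) × List Bool =>
      t.2.length = t.1.1.1.1.length ∧ (t.2 ≠ t.1.1.1.1 ∧ t.1.2 = code t.2))
      ((REPred.eq (by fun_prop) (by fun_prop)).and ((REPred.ne (by fun_prop) (by fun_prop)).and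
        (REPred.eq (by fun_prop) (by fun_prop))))
  have hre := (REPred.forall_mem (l := fun q : (List Bool × ℚ) × List ℕ => q.2) (by fun_prop)
    hmem).and ((hν.rePred_lt_measure semidecidableDistLT_cantorIdeal).comp
      (f := fun q : (List Bool × ℚ) × List ℕ => (q.2, 1 - q.1.2, 0)) (by fun_prop))
  refine hre.projection.of_eq ?_
  rintro ⟨w, q⟩
  dsimp only
  have hcompl := probReal_compl_eq_one_sub (μ := (ν : Measure (ℕ → Bool)))
    (measurableSet_wordCylinder w)
  constructor
  · rintro ⟨l, hl, h⟩
    have hsub : shrunkBalls cantorIdeal l 0 ⊆ (wordCylinder w)ᶜ := by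
      rintro ω ⟨k, hk, hω⟩ hωw
      obtain ⟨v, hv1, hv2, rfl⟩ := hl k hk
      have hωv : ω ∈ wordCylinder v := by
        rw [← hball, mem_idealBall]
        simpa using hω
      have h1 : initialWord ω v.length = v := hωv
      have h2 : initialWord ω w.length = w := hωw
      exact hv2 (by rw [← h1, hv1, h2])
    have := measureReal_mono (μ := (ν : Measure (ℕ → Bool))) hsub
    push_cast at h
    linarith
  · intro h
    have hfin := List.finite_length_eq Bool w.length
    refine ⟨(hfin.toFinset.toList.filter (· ≠ w)).map code, ?_, ?_⟩
    · intro k hk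
      obtain ⟨v, hv, rfl⟩ := List.mem_map.1 hk
      simp only [ne_eq, decide_not, List.mem_filter, Finset.mem_toList, Set.Finite.mem_toFinset,
        Bool.not_eq_eq_eq_not, Bool.not_true, decide_eq_false_iff_not] at hv
      exact ⟨v, hv.1, hv.2, rfl⟩
    · have hsub : (wordCylinder w)ᶜ ⊆
          shrunkBalls cantorIdeal ((hfin.toFinset.toList.filter (· ≠ w)).map code) 0 := by
        intro ω hω
        refine ⟨code (initialWord ω w.length), List.mem_map.2 ⟨_, ?_, rfl⟩, ?_⟩
        · simp only [ne_eq, decide_not, List.mem_filter, Finset.mem_toList,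
            Set.Finite.mem_toFinset, Bool.not_eq_eq_eq_not, Bool.not_true,
            decide_eq_false_iff_not]
          exact ⟨initialWord_length _ _, hω⟩
        · have : ω ∈ idealBall cantorIdeal (code (initialWord ω w.length)) := by
            rw [hball, mem_wordCylinder_initialWord]
            exact fun _ _ => rfl
          rw [mem_idealBall] at this
          simpa using this
      have := measureReal_mono (μ := (ν : Measure (ℕ → Bool))) hsub
      push_cast
      linarith

end

/-! ### Complexity -/

theorem Partrec.rePred_mem {α β : Type*} [Primcodable α] [Primcodable β] {f : α →. β}
    (hf : Partrec f) : REPred fun q : α × β => q.2 ∈ f q.1 := by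
  classical
  have hp : Partrec fun q : α × β => (f q.1).bind fun b =>
      ((bif decide (b = q.2) then some () else Option.none : Option Unit) : Part Unit) := by
    refine Partrec.bind (hf.comp Computable.fst) (Computable.ofOption ?_)
    exact Computable.bool_cond (Computable.decide_eq (by fun_prop) (by fun_prop)) (by fun_prop)
      (by fun_prop)
  refine hp.dom_re.of_eq fun q => ?_
  simp only [Part.dom_iff_mem, Part.mem_bind_iff, Part.mem_ofOption, Option.mem_def]
  constructor
  · rintro ⟨u, b, hb, h⟩
    by_cases hbq : b = q.2
    · exact hbq ▸ hb
    · simp [hbq] at h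
  · intro h
    exact ⟨(), q.2, h, by simp⟩

theorem complexity_le_length {U : List Bool →. List Bool} {p w : List Bool} (h : w ∈ U p) :
    complexity U w ≤ p.length := Nat.sInf_le ⟨p, h, rfl⟩

/-- The existence of a program is asserted separately: without it the infimum could be that of the
empty set, which is `0`. -/
theorem IsUniversalPrefixMachine.exists_complexity_le {U : List Bool →. List Bool}
    (hU : IsUniversalPrefixMachine U) {α : Type*} [Primcodable α] {p : α → Prop} (hp : REPred p)
    {out : α → List Bool} {len : α → ℕ} (hout : Computable out) (hlen : Computable len)
    (hsum : ∑' a : {a // p a}, (1 / 2 : ℝ≥0∞) ^ len a ≤ 1) :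
    ∃ c : ℕ, ∀ a, p a → (∃ q, out a ∈ U q) ∧ complexity U (out a) ≤ len a + c := by
  obtain ⟨M, hM, hserve⟩ := exists_prefixMachine_of_requests hp hout hlen hsum
  obtain ⟨c, hc⟩ := hU.2 M hM
  refine ⟨c + 1, fun a ha => ?_⟩
  obtain ⟨q, hq, hql⟩ := hserve a ha
  obtain ⟨r, hr, hrl⟩ := hc q _ hq
  refine ⟨⟨r, hr⟩, (complexity_le_length hr).trans ?_⟩
  omega

/-- The single request of length zero for `w` has total weight one, so `w` has a program and the
infimum is attained. -/
theorem IsUniversalPrefixMachine.exists_program {U : List Bool →. List Bool}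
    (hU : IsUniversalPrefixMachine U) (w : List Bool) :
    ∃ p, w ∈ U p ∧ p.length = complexity U w := by
  obtain ⟨c, hc⟩ := hU.exists_complexity_le (α := List Bool) (p := fun v => v = w)
    (out := fun v => v) (len := fun _ => 0) (REPred.eq (by fun_prop) (by fun_prop)) (by fun_prop)
    (by fun_prop) (by
      have := tsum_singleton w fun _ => (1 / 2 : ℝ≥0∞) ^ 0
      exact (this.trans (pow_zero _)).le)
  obtain ⟨q, hq⟩ := (hc w rfl).1
  exact Nat.sInf_mem (s := {k | ∃ p, w ∈ U p ∧ p.length = k}) ⟨q.length, q, hq, rfl⟩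

/-- The exponential form with a natural constant, used in both directions. Both sides fail at `a =
0` and hold at `a = ∞`. -/
theorem neg_log2_sub_le_iff (a : ℝ≥0∞) (c n : ℕ) :
    -log2 a - ((c : ℝ) : EReal) ≤ (n : EReal) ↔ (1 / 2 : ℝ≥0∞) ^ (n + c) ≤ a := by
  have hlog : (0 : ℝ) < Real.log 2 := Real.log_pos (by norm_num)
  have hn : (n : EReal) = ((n : ℝ) : EReal) := rfl
  induction a with
  | top =>
    have : log2 ∞ = ⊤ := by
      rw [log2, ENNReal.log_top, EReal.top_div_of_pos_ne_top (by exact_mod_cast hlog)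
        (EReal.coe_ne_top _)]
    simp [this]
  | coe a =>
    rcases eq_or_ne a 0 with rfl | ha
    · have : log2 ((0 : NNReal) : ℝ≥0∞) = ⊥ := by
        rw [log2, ENNReal.coe_zero, ENNReal.log_zero,
          EReal.bot_div_of_pos_ne_top (by exact_mod_cast hlog) (EReal.coe_ne_top _)]
      rw [this, EReal.neg_bot, EReal.top_sub_coe, hn]
      simp only [top_le_iff, EReal.coe_ne_top, false_iff, not_le]
      exact ENNReal.pow_pos (by simp) _
    · have ha' : (0 : ℝ) < a := by positivity
      have h1 : log2 (a : ℝ≥0∞) = ((Real.log a / Real.log 2 : ℝ) : EReal) := by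
        rw [log2, ENNReal.log_pos_real' (by simpa using pos_iff_ne_zero.2 ha), EReal.coe_div]
        simp
      have h2 : (1 / 2 : ℝ≥0∞) ^ (n + c) ≤ a ↔ (1 / 2 : ℝ) ^ (n + c) ≤ a := by
        have h3 : (1 / 2 : ℝ≥0∞) ^ (n + c) = ENNReal.ofReal ((1 / 2 : ℝ) ^ (n + c)) := by
          rw [ENNReal.ofReal_pow (by norm_num)]
          simp [ENNReal.ofReal_inv_of_pos]
        have h4 : (a : ℝ≥0∞) = ENNReal.ofReal a := by simp
        rw [h3, h4, ENNReal.ofReal_le_ofReal_iff ha'.le]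
      rw [h1, h2, hn, ← EReal.coe_neg, ← EReal.coe_sub, EReal.coe_le_coe_iff,
        ← Real.log_le_log_iff (by positivity) ha', Real.log_pow, one_div, Real.log_inv]
      rw [sub_le_iff_le_add, ← neg_div, div_le_iff₀ hlog]
      push_cast
      constructor <;> intro h <;> linarith

/-! ### Auxiliary sums -/

/-- The geometric sum is at most twice its leading term, which is below `a`. -/
theorem tsum_half_pow_lt_le (a : ℝ≥0∞) :
    ∑' l : {l : ℕ // (1 / 2 : ℝ≥0∞) ^ l < a}, (1 / 2 : ℝ≥0∞) ^ (l : ℕ) ≤ 2 * a := by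
  by_cases hex : ∃ l : ℕ, (1 / 2 : ℝ≥0∞) ^ l < a
  · classical
    have hmin : ∀ l : {l : ℕ // (1 / 2 : ℝ≥0∞) ^ l < a}, Nat.find hex ≤ l := fun l =>
      Nat.find_min' hex l.2
    let g : {l : ℕ // (1 / 2 : ℝ≥0∞) ^ l < a} → ℕ := fun l => l - Nat.find hex
    have hg : Function.Injective g := fun l l' h => Subtype.ext (by
      have h1 := hmin l
      have h2 := hmin l'
      simp only [g] at h
      omega)
    calc ∑' l : {l : ℕ // (1 / 2 : ℝ≥0∞) ^ l < a}, (1 / 2 : ℝ≥0∞) ^ (l : ℕ)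
        = ∑' l, (1 / 2 : ℝ≥0∞) ^ Nat.find hex * (1 / 2 : ℝ≥0∞) ^ g l := by
          refine tsum_congr fun l => ?_
          rw [← pow_add, Nat.add_sub_cancel' (hmin l)]
      _ ≤ ∑' i : ℕ, (1 / 2 : ℝ≥0∞) ^ Nat.find hex * (1 / 2 : ℝ≥0∞) ^ i :=
          ENNReal.tsum_comp_le_tsum_of_injective hg
            fun i => (1 / 2 : ℝ≥0∞) ^ Nat.find hex * (1 / 2 : ℝ≥0∞) ^ i
      _ = (1 / 2 : ℝ≥0∞) ^ Nat.find hex * 2 := by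
          rw [ENNReal.tsum_mul_left, ENNReal.tsum_geometric]
          congr 1
          rw [one_div, ENNReal.one_sub_inv_two, inv_inv]
      _ ≤ 2 * a := by
          rw [mul_comm]
          gcongr
          exact (Nat.find_spec hex).le
  · have : IsEmpty {l : ℕ // (1 / 2 : ℝ≥0∞) ^ l < a} := ⟨fun l => hex ⟨l, l.2⟩⟩
    rw [tsum_empty]
    exact zero_le

/-! ### Binary representations -/

namespace BinaryRepresentation

variable {X : Type*} [MetricSpace X] [MeasurableSpace X] [BorelSpace X] {s : ℕ → X}
  {μ : ProbabilityMeasure X} (δ : BinaryRepresentation s μ)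

theorem expansion_mem_dom (x : X) : δ.expansion x ∈ δ.dom :=
  Function.invFunOn_mem (δ.surjective (Set.mem_univ x))

theorem toFun_expansion (x : X) : δ.toFun (δ.expansion x) = x :=
  Function.invFunOn_eq (δ.surjective (Set.mem_univ x))

theorem expansion_toFun {ω : ℕ → Bool} (hω : ω ∈ δ.dom) (h : δ.toFun ω ∈ δ.D) :
    δ.expansion (δ.toFun ω) = ω :=
  (δ.unique _ h).unique ⟨δ.expansion_mem_dom _, δ.toFun_expansion _⟩ ⟨hω, rfl⟩

theorem measure_dom_inter (A : Set (ℕ → Bool)) :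
    (δ.measure : Measure (ℕ → Bool)) (δ.dom ∩ A) = (δ.measure : Measure (ℕ → Bool)) A := by
  rw [Set.inter_comm]
  refine measure_inter_conull' ?_
  refine measure_mono_null (Set.sdiff_subset_compl _ _) ?_
  rw [prob_compl_eq_zero_iff δ.morphism.pi02.measurableSet]
  exact δ.morphism.full

theorem measure_D_inter (A : Set X) : (μ : Measure X) (δ.D ∩ A) = (μ : Measure X) A := by
  rw [Set.inter_comm]
  refine measure_inter_conull' ?_
  refine measure_mono_null (Set.sdiff_subset_compl _ _) ?_
  rw [prob_compl_eq_zero_iff δ.pi02_D.measurableSet]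
  exact δ.full_D

/-- The sets of points whose expansions begin with given words are uniformly recursively
enumerable open in `D`. -/
theorem exists_rePred_expansion (hX : IsComputableMetricSpace s) :
    ∃ R : List Bool × ℕ → Prop, REPred R ∧ ∀ w, ∀ x ∈ δ.D,
      δ.expansion x ∈ wordCylinder w ↔ x ∈ ballUnion s fun k => R (w, k) := by
  obtain ⟨code, hcode, hball⟩ := exists_cylinder_code
  obtain ⟨R, hR, hpre⟩ := δ.inverse_computable.exists_rePred_preimage hX.semidecidableDistLT
    hX.dense semidecidableDistLT_cantorIdeal
  refine ⟨fun q => R (code q.1, q.2), hR.comp (f := fun q : List Bool × ℕ => (code q.1, q.2))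
    (by fun_prop), fun w x hx => ?_⟩
  rw [← hball]
  exact hpre (code w) x hx

/-- Up to a null set `V` may be cut down to `D`, where taking the expansion inverts `δ`; the
preimage of `D ∩ V` then lies in `C`. -/
theorem measure_le_of_expansion_mem {V : Set X} (hV : IsOpen V) {C : Set (ℕ → Bool)}
    (h : ∀ x ∈ δ.D, x ∈ V → δ.expansion x ∈ C) :
    (μ : Measure X) V ≤ (δ.measure : Measure (ℕ → Bool)) C := by
  rw [← δ.measure_D_inter, δ.morphism.preserving _
    (δ.pi02_D.measurableSet.inter hV.measurableSet)]
  refine measure_mono ?_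
  rintro ω ⟨hω, hD, hωV⟩
  rw [← δ.expansion_toFun hω hD]
  exact h _ hD hωV

/-- The cell need not be known to be Borel, so `μ` acts as an outer measure. From above, the cell is
contained in an r.e. open set on `D`; from below, the preimage of a measurable hull contains the
cylinder within the domain. -/
theorem measure_cell (hX : IsComputableMetricSpace s) (x : X) (n : ℕ) :
    (μ : Measure X) (δ.cell x n) =
      (δ.measure : Measure (ℕ → Bool)) (wordCylinder (initialWord (δ.expansion x) n)) := by
  rw [cell, cylinder_eq_wordCylinder]
  refine le_antisymm ?_ ?_
  · obtain ⟨R, -, hR⟩ := δ.exists_rePred_expansion hX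
    rw [← δ.measure_D_inter]
    refine (measure_mono ?_).trans (δ.measure_le_of_expansion_mem
      (isOpen_ballUnion s fun k => R (initialWord (δ.expansion x) n, k))
      fun y hy => (hR _ y hy).2)
    rintro y ⟨hy, ω, ⟨hω, hωC⟩, rfl⟩
    rw [← hR _ _ hy, δ.expansion_toFun hω hy]
    exact hωC
  · rw [← measure_toMeasurable (μ := (μ : Measure X)),
      δ.morphism.preserving _ (measurableSet_toMeasurable _ _), ← δ.measure_dom_inter]
    refine measure_mono fun ω hω => ⟨hω.1, ?_⟩
    exact subset_toMeasurable _ _ ⟨ω, hω, rfl⟩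

/-- At random points of `D`, complexity is bounded below. -/
theorem exists_le_measure_of_isRandom (hX : IsComputableProbabilitySpace s μ)
    {U : List Bool →. List Bool} (hU : IsUniversalPrefixMachine U) {x : X} (hx : IsRandom s μ x)
    (hxD : x ∈ δ.D) : ∃ c : ℕ, ∀ n, (1 / 2 : ℝ≥0∞) ^ (δ.pointComplexity U x n + c) ≤
      (δ.measure : Measure (ℕ → Bool)) (wordCylinder (initialWord (δ.expansion x) n)) := by
  obtain ⟨R, hR, hRx⟩ := δ.exists_rePred_expansion hX.space
  -- The index `(p, w, j)` records that `p` outputs `w` and that `2^j` is a lower approximation to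
  -- `1 / μ_δ[w]`.
  have hre : REPred fun r : (List Bool × List Bool × ℕ) × ℕ => (r.1.2.1 ∈ U r.1.1 ∧
      (δ.measure : Measure (ℕ → Bool)).real (wordCylinder r.1.2.1) <
        (((1 / 2) ^ r.1.2.2 : ℚ) : ℝ)) ∧ R (r.1.2.1, r.2) :=
    ((hU.1.1.rePred_mem.comp (f := fun r : (List Bool × List Bool × ℕ) × ℕ =>
      (r.1.1, r.1.2.1)) (by fun_prop)).and
      (δ.measure_computable.rePred_cylinder_lt.comp
        (f := fun r : (List Bool × List Bool × ℕ) × ℕ => (r.1.2.1, (1 / 2 : ℚ) ^ r.1.2.2))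
        (by fun_prop))).and
      (hR.comp (f := fun r : (List Bool × List Bool × ℕ) × ℕ => (r.1.2.1, r.2)) (by fun_prop))
  have hhalf : ∀ j : ℕ, ENNReal.ofReal (((1 / 2) ^ j : ℚ) : ℝ) = (1 / 2 : ℝ≥0∞) ^ j := fun j => by
    push_cast
    rw [ENNReal.ofReal_pow (by norm_num)]
    simp [ENNReal.ofReal_inv_of_pos]
  have hlt : ∀ (w : List Bool) (j : ℕ), (δ.measure : Measure (ℕ → Bool)).real (wordCylinder w) <
      (((1 / 2) ^ j : ℚ) : ℝ) ↔
        (δ.measure : Measure (ℕ → Bool)) (wordCylinder w) < (1 / 2 : ℝ≥0∞) ^ j := fun w j => by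
    rw [← hhalf, ENNReal.lt_ofReal_iff_toReal_lt (measure_ne_top _ _)]
    rfl
  have hg : ∀ p : List Bool, ∀ j : ℕ, ENNReal.ofReal ((2 ^ j * (1 / 2) ^ p.length : ℚ) : ℝ) =
      2 ^ j * (1 / 2 : ℝ≥0∞) ^ p.length := fun p j => by
    rw [← hhalf, Rat.cast_mul, ENNReal.ofReal_mul (by positivity)]
    push_cast
    rw [ENNReal.ofReal_pow (by norm_num)]
    simp
  let V : List Bool → Set X := fun w => ballUnion s fun k => R (w, k)
  have hVo : ∀ w, IsOpen (V w) := fun w => isOpen_ballUnion _ _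
  have hVle : ∀ w, (μ : Measure X) (V w) ≤ (δ.measure : Measure (ℕ → Bool)) (wordCylinder w) :=
    fun w => δ.measure_le_of_expansion_mem (hVo w) fun y hy => (hRx w y hy).2
  obtain ⟨M, hM, hbound⟩ := hx.exists_bound hre
    (g := fun a => 2 ^ a.2.2 * (1 / 2) ^ a.1.length) (by fun_prop) (fun a => by positivity)
    -- Summation over programs rather than words makes Kraft's inequality applicable: each program
    -- contributes at most `2^(-|p|)` to the integral. A null cylinder contributes nothing, as `∞ *
    -- 0 = 0`.
    (h := fun y => ∑' p : U.Dom, (V ((U p).get p.2)).indicator (fun _ =>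
      (1 / 2 : ℝ≥0∞) ^ p.1.length *
        ((δ.measure : Measure (ℕ → Bool)) (wordCylinder ((U p).get p.2)))⁻¹) y)
    (by
      rw [lintegral_tsum fun p => (measurable_const.indicator (hVo _).measurableSet).aemeasurable]
      refine (ENNReal.tsum_le_tsum fun p => ?_).trans
        (tsum_two_pow_neg_length_le_one hU.1.2)
      rw [lintegral_indicator_const (hVo _).measurableSet, mul_assoc]
      refine mul_le_of_le_one_right' ?_
      refine (mul_le_mul_right (hVle _) _).trans ?_
      rw [mul_comm]
      exact ENNReal.mul_inv_le_one _)
    (by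
      rintro ⟨p, w, j⟩ y ⟨k, ⟨⟨hw, hj⟩, hk⟩, hy⟩
      dsimp only at hw hj hk ⊢
      have hp : p ∈ U.Dom := Part.dom_iff_mem.2 ⟨w, hw⟩
      have hget : (U p).get hp = w := Part.get_eq_of_mem hw hp
      refine le_trans ?_ (ENNReal.le_tsum (⟨p, hp⟩ : U.Dom))
      dsimp only
      rw [hget, Set.indicator_of_mem (show y ∈ V w from ⟨k, hk, hy⟩), hg, mul_comm]
      gcongr
      have h1 := ((hlt w j).1 hj).le
      rw [ENNReal.le_inv_iff_le_inv, ENNReal.inv_pow]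
      simpa using h1)
  obtain ⟨c, hc⟩ := ENNReal.exists_nat_gt hM
  refine ⟨c, fun n => ?_⟩
  by_contra hcon
  rw [not_le] at hcon
  obtain ⟨p, hp, hpl⟩ := hU.exists_program (initialWord (δ.expansion x) n)
  have hxV : x ∈ V (initialWord (δ.expansion x) n) :=
    (hRx _ x hxD).1 (mem_wordCylinder_initialWord.2 fun _ _ => rfl)
  obtain ⟨k, hk, hxk⟩ := hxV
  -- For a shortest program and `j = H_n(x) + c` the weight is `2^c`, which exceeds the bound `M`.
  have h1 := hbound (p, initialWord (δ.expansion x) n, δ.pointComplexity U x n + c)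
    ⟨k, ⟨⟨hp, (hlt _ _).2 hcon⟩, hk⟩, hxk⟩
  dsimp only at h1
  rw [hg, hpl] at h1
  have h2 : (2 : ℝ≥0∞) ^ (δ.pointComplexity U x n + c) *
      (1 / 2) ^ complexity U (initialWord (δ.expansion x) n) = 2 ^ c := by
    have h3 : (2 : ℝ≥0∞) * (1 / 2) = 1 := by
      rw [one_div, ENNReal.mul_inv_cancel (by simp) (by simp)]
    rw [pointComplexity, pow_add, mul_right_comm, ← mul_pow, h3, one_pow, one_mul]
  rw [h2] at h1
  have h4 : (c : ℝ≥0∞) ≤ 2 ^ c := by exact_mod_cast Nat.lt_two_pow_self.le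
  exact absurd (hc.trans_le (h4.trans h1)) (lt_irrefl _)

end BinaryRepresentation

/-! ### From a complexity bound to randomness -/

theorem tsum_measure_wordCylinder_le {ν : Measure (ℕ → Bool)} {P : List Bool → Prop}
    (hP : ∀ v w, P v → P w → v <+: w → v = w) {W : Set (ℕ → Bool)}
    (hW : ∀ w, P w → wordCylinder w ⊆ W) : ∑' w : {w // P w}, ν (wordCylinder w) ≤ ν W := by
  refine (tsum_meas_le_meas_iUnion_of_disjoint ν (fun w => measurableSet_wordCylinder _) ?_).trans
    (measure_mono (Set.iUnion_subset fun w => hW _ w.2))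
  intro v w hvw
  refine Set.disjoint_left.2 fun ω hv hw => hvw (Subtype.ext ?_)
  rcases prefix_or_prefix_of_mem_wordCylinder hv hw with h | h
  · exact hP _ _ v.2 w.2 h
  · exact (hP _ _ w.2 v.2 h).symm

namespace BinaryRepresentation

variable {X : Type*} [MetricSpace X] [MeasurableSpace X] [BorelSpace X] {s : ℕ → X}
  {μ : ProbabilityMeasure X} (δ : BinaryRepresentation s μ)

/-- The sets where a test is large are generated, through the representation, by uniformly
recursively enumerable prefix-free sets of words of small measure. -/
theorem exists_prefixFree_of_isRandomnessTest (hX : IsComputableProbabilitySpace s μ)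
    {t : X → ℝ≥0∞} (ht : IsRandomnessTest s μ t) :
    ∃ P : ℕ × List Bool → Prop, REPred P ∧ (∀ m v w, P (m, v) → P (m, w) → v <+: w → v = w) ∧
      (∀ m, ∑' w : {w // P (m, w)}, (δ.measure : Measure (ℕ → Bool)) (wordCylinder w) ≤
        (1 / 4) ^ m) ∧
      ∀ x, t x = ∞ → ∀ m, ∃ n, P (m, initialWord (δ.expansion x) n) := by
  obtain ⟨T, hT, htT⟩ := ht.exists_rePred hX.measure
  have hS : REPred fun r : (ℕ × ℕ) × ℕ => T (Nat.pair r.1.2 r.2) ∧ 4 ^ r.1.1 < posRatNum r.2 :=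
    (hT.comp (by fun_prop)).and (REPred.rat_lt (by fun_prop) (by fun_prop))
  let S : ℕ × ℕ → Prop := fun q => ∃ i, T (Nat.pair q.2 i) ∧ 4 ^ q.1 < posRatNum i
  have hS' : REPred S := hS.projection
  have hStep : ∀ m y, y ∈ (ballUnion s fun k => S (m, k)) ↔ 4 ^ m < t y := by
    intro m y
    have hcast : ∀ i, (4 : ℚ) ^ m < posRatNum i ↔
        (4 : ℝ≥0∞) ^ m < ENNReal.ofReal (posRatNum i : ℝ) := by
      intro i
      have h4 : (4 : ℝ≥0∞) ^ m = ENNReal.ofReal (((4 : ℚ) ^ m : ℚ) : ℝ) := by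
        push_cast
        rw [ENNReal.ofReal_pow (by norm_num)]
        simp
      have hpos : (0 : ℝ) < posRatNum i := by exact_mod_cast posRatNum_pos i
      rw [h4, ENNReal.ofReal_lt_ofReal_iff hpos, Rat.cast_lt]
    rw [htT]
    simp only [iSup_apply, lt_iSup_iff]
    constructor
    · rintro ⟨k, ⟨i, hi, hm⟩, hy⟩
      refine ⟨Nat.pair k i, hi, ?_⟩
      rw [stepFunction, Nat.unpair_pair, Set.indicator_of_mem hy]
      exact (hcast i).1 hm
    · rintro ⟨k, hk, hlt⟩
      by_cases hy : y ∈ idealBall s k.unpair.1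
      · rw [stepFunction, Set.indicator_of_mem hy] at hlt
        exact ⟨k.unpair.1, ⟨k.unpair.2, by rwa [Nat.pair_unpair], (hcast _).2 hlt⟩, hy⟩
      · rw [stepFunction, Set.indicator_of_notMem hy] at hlt
        exact absurd hlt not_lt_zero
  -- Markov's inequality.
  have hSμ : ∀ m, (μ : Measure X) (ballUnion s fun k => S (m, k)) ≤ (1 / 4) ^ m := by
    intro m
    have h1 : 4 ^ m * (μ : Measure X) (ballUnion s fun k => S (m, k)) ≤ 1 := by
      rw [← lintegral_indicator_const (isOpen_ballUnion _ _).measurableSet]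
      refine (lintegral_mono fun y => ?_).trans ht.2
      by_cases hy : y ∈ ballUnion s fun k => S (m, k)
      · rw [Set.indicator_of_mem hy]
        exact ((hStep m y).1 hy).le
      · rw [Set.indicator_of_notMem hy]
        exact zero_le
    rw [one_div, ← ENNReal.inv_pow, ← one_div, ENNReal.le_div_iff_mul_le (by simp) (by simp),
      mul_comm]
    exact h1
  obtain ⟨R, hR, hpre⟩ := δ.morphism.computable.exists_rePred_preimage
    semidecidableDistLT_cantorIdeal denseRange_cantorIdeal hX.space.semidecidableDistLT
  have hW : REPred fun r : (ℕ × ℕ) × ℕ => S (r.1.1, r.2) ∧ R (r.2, r.1.2) :=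
    (hS'.comp (f := fun r : (ℕ × ℕ) × ℕ => (r.1.1, r.2)) (by fun_prop)).and
      (hR.comp (f := fun r : (ℕ × ℕ) × ℕ => (r.2, r.1.2)) (by fun_prop))
  -- `W` generates the preimage of `{t > 4^m}` only within the domain of `δ`; outside it differs by
  -- a null set, so the bound on the measure persists.
  let W : ℕ × ℕ → Prop := fun q => ∃ k, S (q.1, k) ∧ R (k, q.2)
  have hW' : REPred W := hW.projection
  have hWpre : ∀ m, ∀ ω ∈ δ.dom, δ.toFun ω ∈ (ballUnion s fun k => S (m, k)) ↔
      ω ∈ ballUnion cantorIdeal fun j => W (m, j) := by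
    intro m ω hω
    constructor
    · rintro ⟨k, hk, hy⟩
      obtain ⟨j, hj, hωj⟩ := (hpre k ω hω).1 hy
      exact ⟨j, ⟨k, hk, hj⟩, hωj⟩
    · rintro ⟨j, ⟨k, hk, hj⟩, hωj⟩
      exact ⟨k, hk, (hpre k ω hω).2 ⟨j, hj, hωj⟩⟩
  obtain ⟨Q, hQ, hQW⟩ := exists_rePred_words hW'
  obtain ⟨P, hP, hfree, hPQ⟩ := exists_prefixFree_of_rePred hQ
  refine ⟨P, hP, hfree, fun m => ?_, fun x hx m => ?_⟩
  · refine (tsum_measure_wordCylinder_le (hfree m)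
      (W := ballUnion cantorIdeal fun j => W (m, j)) fun w hw ω hω => ?_).trans ?_
    · refine (hQW m ω).2 ((hPQ m ω).2 ⟨w.length, ?_⟩)
      rwa [show initialWord ω w.length = w from hω]
    · rw [← δ.measure_dom_inter]
      refine le_trans (le_of_eq ?_) (hSμ m)
      rw [δ.morphism.preserving _ (isOpen_ballUnion _ _).measurableSet]
      congr 1
      ext ω
      exact and_congr_right fun hω => (hWpre m ω hω).symm
  · refine (hPQ m _).1 ((hQW m _).1 ((hWpre m _ (δ.expansion_mem_dom x)).1 ?_))
    rw [δ.toFun_expansion, hStep, hx]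
    exact ENNReal.pow_lt_top (by simp)

/-- For fixed `m` and `w` the admissible weights `2^(-l) < 2^m μ_δ[w]` add up to at most `2 * 2^m
μ_δ[w]`. Taking the words at level `m + 1` gives `2 * 2^m * 4^(-m-1) = 2^(-m-1)` for each `m`. -/
theorem tsum_requests_le_one {ν : Measure (ℕ → Bool)} {P : ℕ × List Bool → Prop}
    (hP : ∀ m, ∑' w : {w // P (m, w)}, ν (wordCylinder w) ≤ (1 / 4) ^ m) :
    ∑' a : {a : ℕ × List Bool × ℕ // P (a.1 + 1, a.2.1) ∧
      (1 / 2 : ℝ≥0∞) ^ (a.2.2 + a.1) < ν (wordCylinder a.2.1)}, (1 / 2 : ℝ≥0∞) ^ a.1.2.2 ≤ 1 := by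
  classical
  have h24 : ∀ m : ℕ, (2 : ℝ≥0∞) * (2 ^ m * (1 / 4) ^ (m + 1)) = 2⁻¹ ^ (m + 1) := by
    intro m
    have h2 : (2 : ℝ≥0∞) * 2⁻¹ = 1 := ENNReal.mul_inv_cancel (by simp) (by simp)
    have h4 : (1 / 4 : ℝ≥0∞) = 2⁻¹ * 2⁻¹ := by
      rw [one_div, ← ENNReal.mul_inv (by simp) (by simp)]
      norm_num
    rw [← mul_assoc, mul_comm 2, ← pow_succ, h4, mul_pow, ← mul_assoc, ← mul_pow, h2, one_pow,
      one_mul]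
  have hl : ∀ (m : ℕ) (w : List Bool), ∑' l : ℕ, {l : ℕ |
      (1 / 2 : ℝ≥0∞) ^ (l + m) < ν (wordCylinder w)}.indicator (fun l => (1 / 2 : ℝ≥0∞) ^ l) l ≤
        2 * (2 ^ m * ν (wordCylinder w)) := by
    intro m w
    have hset : {l : ℕ | (1 / 2 : ℝ≥0∞) ^ (l + m) < ν (wordCylinder w)} =
        {l : ℕ | (1 / 2 : ℝ≥0∞) ^ l < 2 ^ m * ν (wordCylinder w)} := by
      ext l
      change (1 / 2 : ℝ≥0∞) ^ (l + m) < _ ↔ (1 / 2 : ℝ≥0∞) ^ l < _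
      rw [pow_add, one_div, ← ENNReal.inv_pow (n := m), ← div_eq_mul_inv,
        ENNReal.div_lt_iff (by simp) (by simp), mul_comm]
    rw [hset, ← tsum_subtype]
    exact tsum_half_pow_lt_le _
  calc _ = ∑' a : ℕ × List Bool × ℕ, {a : ℕ × List Bool × ℕ | P (a.1 + 1, a.2.1) ∧
      (1 / 2 : ℝ≥0∞) ^ (a.2.2 + a.1) < ν (wordCylinder a.2.1)}.indicator
        (fun a => (1 / 2 : ℝ≥0∞) ^ a.2.2) a :=
        tsum_subtype {a : ℕ × List Bool × ℕ | P (a.1 + 1, a.2.1) ∧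
          (1 / 2 : ℝ≥0∞) ^ (a.2.2 + a.1) < ν (wordCylinder a.2.1)}
          (fun a => (1 / 2 : ℝ≥0∞) ^ a.2.2)
    _ = ∑' (m : ℕ) (w : List Bool), {w | P (m + 1, w)}.indicator (fun w => ∑' l : ℕ, {l : ℕ |
      (1 / 2 : ℝ≥0∞) ^ (l + m) < ν (wordCylinder w)}.indicator (fun l => (1 / 2 : ℝ≥0∞) ^ l) l)
        w := by
        rw [ENNReal.tsum_prod']
        refine tsum_congr fun m => ?_
        rw [ENNReal.tsum_prod']
        refine tsum_congr fun w => ?_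
        by_cases hw : P (m + 1, w)
        · rw [Set.indicator_of_mem (show w ∈ {w | P (m + 1, w)} from hw)]
          refine tsum_congr fun l => ?_
          simp [Set.indicator_apply, hw]
        · rw [Set.indicator_of_notMem (show w ∉ {w | P (m + 1, w)} from hw)]
          simp [hw]
    _ ≤ ∑' (m : ℕ) (w : List Bool), {w | P (m + 1, w)}.indicator
        (fun w => 2 * (2 ^ m * ν (wordCylinder w))) w :=
        ENNReal.tsum_le_tsum fun m => ENNReal.tsum_le_tsum fun w =>
          Set.indicator_le_indicator (hl m w)
    _ = ∑' m : ℕ, 2 * (2 ^ m * ∑' w : {w // P (m + 1, w)}, ν (wordCylinder w)) := by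
        refine tsum_congr fun m => ?_
        rw [← tsum_subtype, ENNReal.tsum_mul_left, ENNReal.tsum_mul_left]
        rfl
    _ ≤ ∑' m : ℕ, (2⁻¹ : ℝ≥0∞) ^ (m + 1) := by
        refine ENNReal.tsum_le_tsum fun m => ?_
        rw [← h24]
        gcongr
        exact hP (m + 1)
    _ = 1 := by
        rw [ENNReal.tsum_geometric_add_one, ENNReal.one_sub_inv_two, inv_inv,
          ENNReal.inv_mul_cancel (by simp) (by simp)]

/-- A lower bound on complexity implies randomness. -/
theorem isRandom_of_le_measure (hX : IsComputableProbabilitySpace s μ)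
    {U : List Bool →. List Bool} (hU : IsUniversalPrefixMachine U) {x : X} {c : ℕ}
    (hc : ∀ n, (1 / 2 : ℝ≥0∞) ^ (δ.pointComplexity U x n + c) ≤
      (δ.measure : Measure (ℕ → Bool)) (wordCylinder (initialWord (δ.expansion x) n))) :
    IsRandom s μ x := by
  rintro N ⟨t, ht, hN⟩ hxN
  obtain ⟨P, hP, hfree, hsum, hxP⟩ := δ.exists_prefixFree_of_isRandomnessTest hX ht
  have hre : REPred fun a : ℕ × List Bool × ℕ => P (a.1 + 1, a.2.1) ∧
      (1 / 2 : ℝ≥0∞) ^ (a.2.2 + a.1) <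
        (δ.measure : Measure (ℕ → Bool)) (wordCylinder a.2.1) := by
    refine (hP.comp (f := fun a : ℕ × List Bool × ℕ => (a.1 + 1, a.2.1)) (by fun_prop)).and
      ((δ.measure_computable.rePred_lt_cylinder.comp
        (f := fun a : ℕ × List Bool × ℕ => (a.2.1, (1 / 2 : ℚ) ^ (a.2.2 + a.1)))
        (by fun_prop)).of_eq fun a => ?_)
    have h1 : (1 / 2 : ℝ≥0∞) ^ (a.2.2 + a.1) =
        ENNReal.ofReal (((1 / 2 : ℚ) ^ (a.2.2 + a.1) : ℚ) : ℝ) := by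
      push_cast
      rw [ENNReal.ofReal_pow (by norm_num)]
      simp [ENNReal.ofReal_inv_of_pos]
    rw [h1, ENNReal.ofReal_lt_iff_lt_toReal (by positivity) (measure_ne_top _ _)]
    rfl
  obtain ⟨d, hd⟩ := hU.exists_complexity_le hre (out := fun a => a.2.1) (len := fun a => a.2.2)
    (by fun_prop) (by fun_prop) (tsum_requests_le_one hsum)
  -- At level `m = c + d + 2` an admissible `l` gives `H ≤ l + d`, whereas the least one will give
  -- `H + c ≥ l - 1 + m`, that is, `H ≥ l + d + 1`.
  obtain ⟨n, hn⟩ := hxP x (hN hxN) (c + d + 2 + 1)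
  have hle := hc n
  have hhalf1 : (1 / 2 : ℝ≥0∞) < 1 := by simp
  have hanti : StrictAnti fun i : ℕ => (1 / 2 : ℝ≥0∞) ^ i := by
    refine strictAnti_nat_of_succ_lt fun i => ?_
    rw [pow_succ]
    exact ENNReal.mul_lt_of_lt_div' (by
      rw [ENNReal.div_self (by simp) (by simp)]
      exact hhalf1)
  -- This excludes `l = 0`, so that `l - 1` is a true predecessor and fails to be admissible.
  have hsmall : (δ.measure : Measure (ℕ → Bool))
      (wordCylinder (initialWord (δ.expansion x) n)) ≤ (1 / 2) ^ (c + d + 2) := by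
    refine ((ENNReal.le_tsum (f := fun w : {w // P (c + d + 2 + 1, w)} =>
      (δ.measure : Measure (ℕ → Bool)) (wordCylinder w)) ⟨_, hn⟩).trans (hsum _)).trans ?_
    refine (pow_le_pow_of_le_one zero_le (by simp) (Nat.le_succ _)).trans ?_
    gcongr
    norm_num
  -- The assumed bound makes the measure of the cylinder positive, so some request for this word is
  -- admissible.
  have hex : ∃ l : ℕ, (1 / 2 : ℝ≥0∞) ^ (l + (c + d + 2)) <
      (δ.measure : Measure (ℕ → Bool)) (wordCylinder (initialWord (δ.expansion x) n)) := by
    refine ⟨δ.pointComplexity U x n + c + 1, lt_of_lt_of_le ?_ hle⟩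
    exact hanti (by omega)
  classical
  have hspec := Nat.find_spec hex
  obtain ⟨l, hl⟩ : ∃ l, l = Nat.find hex := ⟨_, rfl⟩
  rw [← hl] at hspec
  have hl0 : l ≠ 0 := by
    rintro rfl
    rw [zero_add] at hspec
    exact absurd hspec (not_lt.2 hsmall)
  have hmin := Nat.find_min hex (m := l - 1) (by omega)
  have hcomp := (hd (c + d + 2, initialWord (δ.expansion x) n, l) ⟨hn, hspec⟩).2
  have hfin := hanti.le_iff_ge.1 (hle.trans (not_lt.1 hmin))
  dsimp only at hcomp
  rw [pointComplexity] at hfin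
  omega

end BinaryRepresentation

end

/-! ### The characterization of random points -/

theorem mainTheorem6 {X : Type*} [MetricSpace X] [MeasurableSpace X] [BorelSpace X]
    (s : ℕ → X) (μ : ProbabilityMeasure X) (hX : IsComputableProbabilitySpace s μ)
    (δ : BinaryRepresentation s μ)
    (U : List Bool →. List Bool) (hU : IsUniversalPrefixMachine U) (x : X) :
    IsRandom s μ x ↔
      x ∈ δ.D ∧ ∃ c : ℝ, ∀ n : ℕ,
        -log2 ((μ : Measure X) (δ.cell x n)) - (c : EReal) ≤ (δ.pointComplexity U x n : EReal) := by
  constructor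
  · intro hx
    have hxD : x ∈ δ.D := by
      obtain ⟨S, hS, hD⟩ := δ.pi02_D.exists_rePred
      -- Each r.e. open set in the intersection contains `D`, hence has measure one.
      refine (hD x).2 fun n => hx.mem_ballUnion hX (hS.comp (f := fun k => (n, k)) (by fun_prop)) ?_
      refine le_antisymm prob_le_one ?_
      rw [← δ.full_D]
      exact measure_mono fun y hy => (hD y).1 hy n
    obtain ⟨c, hc⟩ := δ.exists_le_measure_of_isRandom hX hU hx hxD
    refine ⟨hxD, c, fun n => ?_⟩
    rw [neg_log2_sub_le_iff, δ.measure_cell hX.space]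
    exact hc n
  · rintro ⟨-, c, hc⟩
    -- A larger natural constant weakens the bound and allows the exponential form.
    obtain ⟨N, hN⟩ := exists_nat_ge c
    refine δ.isRandom_of_le_measure hX hU (c := N) fun n => ?_
    rw [← δ.measure_cell hX.space, ← neg_log2_sub_le_iff]
    refine le_trans (EReal.sub_le_sub le_rfl ?_) (hc n)
    exact_mod_cast hN
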